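/- Let $A,B$ be C*-algebras (not necessarily unital) and let $A\otimes B$ be their minimal tensor product. Let $L_0\xrightarrow{R_0}L_1\to\cdots\xrightarrow{R_N}L_{N+1}$ be a complex of right Hilbert $A$-modules and $M_0\xrightarrow{S_0}M_1\to\cdots\xrightarrow{S_{N'}}M_{N'+1}$ a complex of right Hilbert $B$-modules with adjointable differentials ($R_{j+1}R_j=0$, $S_{i+1}S_i=0$). Operators and modules with an index out of range are zero. Let $T=R\otimes S$ be the complex of Hilbert $A\otimes B$-modules $$E_k=\bigoplus_{j+i=k}L_j\otimes M_i\quad(0\le k\le N+N'+2),\qquad T_k=\bigoplus_{j+i=k}\bigl(R_j\otimes 1_{M_i}+\sigma_j\otimes S_i\bigr),\qquad \sigma_j=(-1)^j1_{L_j},$$ where $\otimes$ of modules is the exterior tensor product. For an adjointable complex $t=\{t_k:E_k\to E_{k+1}\}$ of Hilbert C*-modules, a *joint parametrix* is a pair of families of adjointable operators $P_{l,k},P_{r,k}:E_{k+1}\to E_k$ such that $1_{E_k}-P_{l,k}t_k-t_{k-1}P_{r,k-1}$ is compact for every $k$ (compact: in the operator-norm closure of the span of the operators $z\mapsto x\langle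 y,z\rangle$); it is a *parametrix* if $P_l=P_r$. The complex is *Fredholm* if it has a joint parametrix. An adjointable operator $D:E\to F$ is *Fredholm* if there is an adjointable $P:F\to E$ with $1-PD$ and $1-DP$ compact; its index in $K_0$ is denoted $\operatorname{ind}D$. The *even Dirac operator* of $t$ is $D_t^+=t+t^*:E_{\rm ev}=\bigoplus_k E_{2k}\to E_{\rm odd}=\bigoplus_k E_{2k+1}$, the odd one is $D_t^-=(D_t^+)^*$, and the index of a Fredholm complex is $\operatorname{ind}t:=\operatorname{ind}D_t^+$. Put $$D_R^+\#D_S^+=\begin{pmatrix}D_R^+\otimes1_{M_{\rm ev}}&-1_{L_{\rm odd}}\otimes D_S^-\\1_{L_{\rm ev}}\otimes D_S^+&D_R^-\otimes1_{M_{\rm odd}}\end{pmatrix}:\;(L_{\rm ev}\otimes M_{\rm ev})\oplus(L_{\rm odd}\otimes M_{\rm odd})\to(L_{\rm odd}\otimes M_{\rm ev})\oplus(L_{\rm ev}\otimes M_{\rm odd}).$$ Then: 1. There are unitaries $U:(L_{\rm ev}\otimes M_{\rm ev})\oplus(L_{\rm odd}\otimes M_{\rm odd})\to E_{\rm ev}$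 and $V:(L_{\rm odd}\otimes M_{\rm ev})\oplus(L_{\rm ev}\otimes M_{\rm odd})\to E_{\rm odd}$ with $V^*D_T^+U=D_R^+\#D_S^+$ (no Fredholm hypothesis is needed). 2. If $\hat P$ is a parametrix of $R$ and $\tilde P$ a parametrix of $S$, with $\hat C_j=1-\hat P_jR_j-R_{j-1}\hat P_{j-1}$ and $\tilde C_i=1-\tilde P_iS_i-S_{i-1}\tilde P_{i-1}$, then the operators $$P_k=\bigoplus_{j+i=k}\bigl(\hat P_j\otimes1_{M_i}+\sigma_j\hat C_j\otimes\tilde P_i\bigr)$$ form a parametrix of $T$, and $P_kT_k+T_{k-1}P_{k-1}=1_{E_k}-\bigoplus_{j+i=k}\hat C_j\otimes\tilde C_i$ for every $k$. (Here $\hat P_j\otimes1_{M_i}$ maps $L_{j+1}\otimes M_i$ to $L_j\otimes M_i$ and $\sigma_j\hat C_j\otimes\tilde P_i$ maps $L_j\otimes M_{i+1}$ to $L_j\otimes M_i$.) 3. If $R$ and $S$ are Fredholm, then the complex $T$ and the operators $D_T^+$ and $D_R^+\#D_S^+$ are Fredholm over $A\otimes B$, and $$\operatorname{ind}(R\otimes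 S)=\operatorname{ind}\bigl(D_R^+\#D_S^+\bigr)\in K_0(A\otimes B).$$ -/

import Mathlib

open scoped ComplexOrder TensorProduct InnerProductSpace
open MulOpposite

set_option linter.unusedSectionVars false

namespace HilbMod

noncomputable section

/-! ### Right Hilbert C⋆-modules

A right Hilbert `A`-module is a Mathlib `CStarModule` over the opposite algebra `Aᵐᵒᵖ`: the right
action of `a` is `op a • x`, the `A`-valued inner product is `unop (inner Aᵐᵒᵖ x y)`, and it satisfies
`⟨x, y a⟩ = ⟨x, y⟩ a`. -/

instance instStarOrderedRingMulOpposite {A : Type*} [NonUnitalCStarAlgebra A] [PartialOrder A]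
    [StarOrderedRing A] : StarOrderedRing Aᵐᵒᵖ := by
  refine StarOrderedRing.of_nonneg_iff' (fun {x y} hxy z => ?_) (fun x => ?_)
  · exact unop_le_unop.1 (by simpa using unop_le_unop.2 hxy)
  · constructor
    · intro h
      obtain ⟨s, hs⟩ := (CStarAlgebra.nonneg_iff_eq_mul_star_self (a := unop x)).1
        (unop_le_unop.2 h)
      exact ⟨op s, unop_injective (by simpa using hs)⟩
    · rintro ⟨s, rfl⟩
      exact unop_le_unop.1 (by simp)

/-- `A` as a right Hilbert module over itself: `⟨a, b⟩ = a⋆ b`. -/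
instance instCStarModuleSelf {A : Type*} [NonUnitalCStarAlgebra A] [PartialOrder A]
    [StarOrderedRing A] : CStarModule Aᵐᵒᵖ A where
  inner a b := op (star a * b)
  inner_add_right := by intros; simp [mul_add]
  inner_self_nonneg {x} := unop_le_unop.1 (by simp)
  inner_self {x} := by
    rw [op_eq_zero_iff, CStarRing.star_mul_self_eq_zero_iff]
  inner_op_smul_right {a x y} := unop_injective (by simp [mul_assoc])
  inner_smul_right_complex {z x y} := unop_injective (mul_smul_comm z (star x) y)
  star_inner x y := unop_injective (by simp [-op_mul])
  norm_eq_sqrt_norm_inner_self {x} := by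
    rw [norm_op, CStarRing.norm_star_mul_self, Real.sqrt_mul_self (norm_nonneg _)]

section Modules

variable {A : Type*} [NonUnitalCStarAlgebra A] [PartialOrder A] [StarOrderedRing A]
  {E F G E' F' : Type*}
  [NormedAddCommGroup E] [NormedSpace ℂ E] [SMul Aᵐᵒᵖ E] [CStarModule Aᵐᵒᵖ E]
  [NormedAddCommGroup F] [NormedSpace ℂ F] [SMul Aᵐᵒᵖ F] [CStarModule Aᵐᵒᵖ F]
  [NormedAddCommGroup G] [NormedSpace ℂ G] [SMul Aᵐᵒᵖ G] [CStarModule Aᵐᵒᵖ G]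
  [NormedAddCommGroup E'] [NormedSpace ℂ E'] [SMul Aᵐᵒᵖ E'] [CStarModule Aᵐᵒᵖ E']
  [NormedAddCommGroup F'] [NormedSpace ℂ F'] [SMul Aᵐᵒᵖ F'] [CStarModule Aᵐᵒᵖ F']

/-- The `A`-valued inner product of a right Hilbert `A`-module. -/
def ip (A : Type*) [NonUnitalCStarAlgebra A] [PartialOrder A] {E : Type*}
    [NormedAddCommGroup E] [NormedSpace ℂ E] [SMul Aᵐᵒᵖ E] [CStarModule Aᵐᵒᵖ E] (x y : E) : A :=
  unop (inner Aᵐᵒᵖ x y)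

lemma ext_inner {x y : E} (h : ∀ z : E, inner Aᵐᵒᵖ z x = inner Aᵐᵒᵖ z y) : x = y := by
  rw [← sub_eq_zero, ← CStarModule.inner_self (A := Aᵐᵒᵖ), CStarModule.inner_sub_right, h, sub_self]

lemma act_add (a : Aᵐᵒᵖ) (x y : E) : a • (x + y) = a • x + a • y :=
  ext_inner (A := A) fun z => by simp [mul_add]

lemma add_act (a b : Aᵐᵒᵖ) (x : E) : (a + b) • x = a • x + b • x :=
  ext_inner (A := A) fun z => by simp [add_mul]

lemma mul_act (a b : Aᵐᵒᵖ) (x : E) : (a * b) • x = a • b • x :=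
  ext_inner (A := A) fun z => by simp [mul_assoc]

lemma act_smul (a : Aᵐᵒᵖ) (c : ℂ) (x : E) : a • c • x = c • a • x :=
  ext_inner (A := A) fun z => by simp [mul_smul_comm]

lemma smul_act (a : Aᵐᵒᵖ) (c : ℂ) (x : E) : (c • a) • x = c • a • x :=
  ext_inner (A := A) fun z => by simp [smul_mul_assoc]

lemma norm_act_le (a : Aᵐᵒᵖ) (x : E) : ‖a • x‖ ≤ ‖x‖ * ‖a‖ := by
  refine (sq_le_sq₀ (norm_nonneg _) (by positivity)).1 ?_
  rw [CStarModule.norm_sq_eq Aᵐᵒᵖ, CStarModule.inner_op_smul_right, CStarModule.inner_op_smul_left,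
    mul_pow, CStarModule.norm_sq_eq Aᵐᵒᵖ]
  calc _ ≤ ‖a‖ * (‖inner Aᵐᵒᵖ x x‖ * ‖star a‖) :=
        (norm_mul_le _ _).trans (by gcongr; exact norm_mul_le _ _)
    _ = _ := by rw [norm_star]; ring

variable (A E F) in
/-- Adjointable operators `E → F` between Hilbert `A`-modules, bundled with their adjoint. (The
adjoint is unique, and such operators are automatically `A`-linear.) -/
structure Adj where
  toCLM : E →L[ℂ] F
  adjCLM : F →L[ℂ] E
  inner_adj : ∀ x y, inner Aᵐᵒᵖ (toCLM x) y = inner Aᵐᵒᵖ x (adjCLM y)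

namespace Adj

instance : CoeFun (Adj A E F) fun _ => E → F := ⟨fun T => T.toCLM⟩

/-- The adjoint `T⋆`. -/
def adj (T : Adj A E F) : Adj A F E where
  toCLM := T.adjCLM
  adjCLM := T.toCLM
  inner_adj x y := by
    rw [← CStarModule.star_inner, ← T.inner_adj, CStarModule.star_inner]

lemma toCLM_injective : Function.Injective (toCLM : Adj A E F → E →L[ℂ] F) := by
  rintro ⟨T, T', hT⟩ ⟨S, S', hS⟩ (rfl : T = S)
  congr
  ext y
  exact ext_inner (A := A) fun z => by rw [← hT, hS]

lemma map_act (T : Adj A E F) (a : Aᵐᵒᵖ) (x : E) : T (a • x) = a • T x :=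
  ext_inner (A := A) fun z => by
    have h : ∀ w : E, inner Aᵐᵒᵖ z (T w) = inner Aᵐᵒᵖ (T.adj z) w := fun w => (T.adj.inner_adj z w).symm
    rw [h, CStarModule.inner_op_smul_right, CStarModule.inner_op_smul_right, h]

/-- Composition `S T`. -/
def comp (S : Adj A F G) (T : Adj A E F) : Adj A E G where
  toCLM := S.toCLM ∘L T.toCLM
  adjCLM := T.adjCLM ∘L S.adjCLM
  inner_adj x y := by simp [S.inner_adj, T.inner_adj]

variable (A E) in
/-- The identity operator. -/
def id : Adj A E E where
  toCLM := .id ℂ E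
  adjCLM := .id ℂ E
  inner_adj _ _ := rfl

instance : Zero (Adj A E F) := ⟨⟨0, 0, by simp⟩⟩
instance : Add (Adj A E F) :=
  ⟨fun S T => ⟨S.toCLM + T.toCLM, S.adjCLM + T.adjCLM, by simp [S.inner_adj, T.inner_adj]⟩⟩
instance : Neg (Adj A E F) := ⟨fun T => ⟨-T.toCLM, -T.adjCLM, by simp [T.inner_adj]⟩⟩
instance : Sub (Adj A E F) :=
  ⟨fun S T => ⟨S.toCLM - T.toCLM, S.adjCLM - T.adjCLM, by simp [S.inner_adj, T.inner_adj]⟩⟩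
instance : SMul ℕ (Adj A E F) :=
  ⟨fun n T => ⟨(n : ℂ) • T.toCLM, (n : ℂ) • T.adjCLM, by simp [T.inner_adj]⟩⟩
instance : SMul ℤ (Adj A E F) :=
  ⟨fun n T => ⟨(n : ℂ) • T.toCLM, (n : ℂ) • T.adjCLM, by simp [T.inner_adj]⟩⟩

instance : AddCommGroup (Adj A E F) :=
  toCLM_injective.addCommGroup _ rfl (fun _ _ => rfl) (fun _ => rfl) (fun _ _ => rfl)
    (fun T n => by ext x; exact Nat.cast_smul_eq_nsmul ℂ n (T x))
    (fun T n => by ext x; exact Int.cast_smul_eq_zsmul ℂ n (T x))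

/-- An adjointable operator is unitary if `U⋆ U = 1` and `U U⋆ = 1`. -/
def IsUnitary (U : Adj A E F) : Prop := U.adj.comp U = id A E ∧ U.comp U.adj = id A F

/-- The compact operators `𝒦(E, F)`: the operator-norm closure of the linear span of the rank-one
operators `θ_{x,y} z = x ⟨y, z⟩`. -/
def IsCompact (T : Adj A E F) : Prop :=
  T.toCLM ∈ (Submodule.span ℂ
    {S : E →L[ℂ] F | ∃ (x : F) (y : E), ∀ z, S z = op (ip A y z) • x}).topologicalClosure

/-- An adjointable operator is `A`-Fredholm if it is invertible modulo compact operators. -/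
def IsFredholm (T : Adj A E F) : Prop :=
  ∃ P : Adj A F E, (id A E - P.comp T).IsCompact ∧ (id A F - T.comp P).IsCompact

/-- For `x ∈ E`, the adjointable operator `A → E`, `a ↦ x a`, with adjoint `y ↦ ⟨x, y⟩`. -/
def ket (x : E) : Adj A A E where
  toCLM := LinearMap.mkContinuous
    { toFun := fun a => op a • x
      map_add' := fun a b => by rw [op_add, add_act]
      map_smul' := fun c a => by rw [op_smul, smul_act, RingHom.id_apply] } ‖x‖
    fun a => norm_act_le (op a) x
  adjCLM := LinearMap.mkContinuous
    { toFun := fun y => ip A x y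
      map_add' := fun y z => by simp [ip]
      map_smul' := fun c y => by simp [ip] } ‖x‖
    fun y => CStarModule.norm_inner_le (A := Aᵐᵒᵖ) E (x := x) (y := y)
  inner_adj a y := by
    change inner Aᵐᵒᵖ (op a • x) y = op (star a * ip A x y)
    rw [CStarModule.inner_op_smul_left]
    rfl

end Adj

end Modules

/-! ### The universal Hilbert-space localization

For a Hilbert `A`-module `E`, `Loc A E` is the Hilbert space `⨁_f E ⊗_A H_f` over all positive
functionals `f` of `A`, where `H_f` is the GNS space of `f`: it is the completion of the finitely
supported families `(x_f)` in `E` for `⟨x, y⟩ = ∑_f f ⟨x_f, y_f⟩`. In particular `Loc A A` is the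
universal representation space of `A`. -/

lemma le_mul_of_logConvex {a : ℕ → ℝ} {K C : ℝ} (ha : ∀ n, 0 ≤ a n) (hK : 0 ≤ K)
    (h : ∀ n, a (n + 1) ^ 2 ≤ a n * a (n + 2)) (hC : ∀ n, a n ≤ C * K ^ n) : a 1 ≤ K * a 0 := by
  by_contra! hlt
  have h0 : 0 < a 0 := by
    rcases (ha 0).eq_or_lt with h0 | h0
    · have := h 0
      rw [← h0] at this hlt
      simp at this hlt
      nlinarith
    · exact h0
  have h1 : 0 < a 1 := lt_of_le_of_lt (by positivity) hlt
  set r := a 1 / a 0 with hr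
  have hr0 : 0 < r := by positivity
  have hstep : ∀ n, 0 < a n ∧ r * a n ≤ a (n + 1) := by
    intro n
    induction n with
    | zero => exact ⟨h0, by rw [hr]; field_simp; exact le_rfl⟩
    | succ n ih =>
      have hp : 0 < a (n + 1) := lt_of_lt_of_le (mul_pos hr0 ih.1) ih.2
      refine ⟨hp, ?_⟩
      have := h n
      have h2 : a n * (r * a (n + 1)) ≤ a n * a (n + 2) := by nlinarith [ih.2]
      exact le_of_mul_le_mul_left h2 ih.1
  have hpow : ∀ n, a 0 * r ^ n ≤ a n := by
    intro n
    induction n with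
    | zero => simp
    | succ n ih => nlinarith [(hstep n).2, pow_succ r n]
  have hKr : K < r := by rw [hr, lt_div_iff₀ h0]; exact hlt
  have hC0 : 0 < C := by
    have := hC 0
    simp at this
    linarith
  rcases hK.eq_or_lt with hK0 | hK0
  · have h3 := hC 1
    rw [← hK0] at h3
    simp at h3
    linarith
  · have hkr : 1 < r / K := by rw [one_lt_div hK0]; exact hKr
    obtain ⟨n, hn⟩ := pow_unbounded_of_one_lt (C / a 0) hkr
    have h4 := (hpow n).trans (hC n)
    rw [div_pow, lt_div_iff₀ (by positivity), div_mul_eq_mul_div, div_lt_iff₀ h0] at hn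
    linarith

lemma norm_le_of_symmetric {V : Type*} [SeminormedAddCommGroup V] [InnerProductSpace ℂ V]
    (R : V →ₗ[ℂ] V) (hR : ∀ u v : V, ⟪R u, v⟫_ℂ = ⟪u, R v⟫_ℂ) {K : ℝ} (hK : 0 ≤ K) (u : V)
    (hu : ∃ C : ℝ, ∀ n : ℕ, ‖(R ^ n) u‖ ≤ C * K ^ n) : ‖R u‖ ≤ K * ‖u‖ := by
  obtain ⟨C, hC⟩ := hu
  have := le_mul_of_logConvex (a := fun n => ‖(R ^ n) u‖) (fun n => norm_nonneg _) hK (fun n => ?_) hC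
  · simpa using this
  · have h1 : ‖(R ^ (n + 1)) u‖ ^ 2 = ‖⟪(R ^ n) u, (R ^ (n + 2)) u⟫_ℂ‖ := by
      rw [pow_succ' R (n + 1), Module.End.mul_apply, ← hR, ← Module.End.mul_apply, ← pow_succ',
        inner_self_eq_norm_sq_to_K]
      simp
    rw [h1]
    exact norm_inner_le_norm _ _

section Modules

variable {A : Type*} [NonUnitalCStarAlgebra A] [PartialOrder A] [StarOrderedRing A]
  {E F G : Type*}
  [NormedAddCommGroup E] [NormedSpace ℂ E] [SMul Aᵐᵒᵖ E] [CStarModule Aᵐᵒᵖ E]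
  [NormedAddCommGroup F] [NormedSpace ℂ F] [SMul Aᵐᵒᵖ F] [CStarModule Aᵐᵒᵖ F]
  [NormedAddCommGroup G] [NormedSpace ℂ G] [SMul Aᵐᵒᵖ G] [CStarModule Aᵐᵒᵖ G]

lemma ip_add_right (x y z : E) : ip A x (y + z) = ip A x y + ip A x z := by simp [ip]
lemma ip_add_left (x y z : E) : ip A (x + y) z = ip A x z + ip A y z := by simp [ip]
lemma ip_smul_left (c : ℂ) (x y : E) : ip A (c • x) y = star c • ip A x y := by simp [ip]
lemma star_ip (x y : E) : star (ip A x y) = ip A y x := by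
  rw [ip, ip, ← unop_star, CStarModule.star_inner]
lemma ip_self_nonneg (x : E) : 0 ≤ ip A x x := unop_le_unop.2 CStarModule.inner_self_nonneg
lemma norm_ip_le (x y : E) : ‖ip A x y‖ ≤ ‖x‖ * ‖y‖ := CStarModule.norm_inner_le (A := Aᵐᵒᵖ) E
lemma ip_adj (T : Adj A E F) (x : E) (y : F) : ip A (T x) y = ip A x (T.adj y) :=
  congrArg unop (T.inner_adj x y)

variable (A E) in
/-- Finitely supported families in `E` indexed by the positive functionals of `A`. -/
def PreLoc : Type _ := (A →ₚ[ℂ] ℂ) →₀ E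

instance : AddCommGroup (PreLoc A E) := inferInstanceAs (AddCommGroup ((A →ₚ[ℂ] ℂ) →₀ E))
instance : Module ℂ (PreLoc A E) := inferInstanceAs (Module ℂ ((A →ₚ[ℂ] ℂ) →₀ E))

/-- The family as a finitely supported function. -/
def PreLoc.equiv : PreLoc A E ≃ₗ[ℂ] ((A →ₚ[ℂ] ℂ) →₀ E) := LinearEquiv.refl ℂ _

/-- The inner product `∑_f f ⟨u_f, v_f⟩`. -/
def PreLoc.innerFn (u v : PreLoc A E) : ℂ :=
  (PreLoc.equiv u).sum fun f x => f (ip A x (PreLoc.equiv v f))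

lemma PreLoc.innerFn_eq (u v : PreLoc A E) (s : Finset (A →ₚ[ℂ] ℂ))
    (hs : (PreLoc.equiv u).support ⊆ s) :
    PreLoc.innerFn u v = ∑ f ∈ s, f (ip A (PreLoc.equiv u f) (PreLoc.equiv v f)) :=
  Finsupp.sum_of_support_subset _ hs _ (by simp [ip])

/-- The semi-inner product on `PreLoc A E`. -/
abbrev PreLoc.core : PreInnerProductSpace.Core ℂ (PreLoc A E) where
  inner u v := PreLoc.innerFn u v
  conj_inner_symm u v := by
    classical
    rw [PreLoc.innerFn_eq u v _ (Finset.subset_union_left (s₂ := (PreLoc.equiv v).support)),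
      PreLoc.innerFn_eq v u _ (Finset.subset_union_right (s₁ := (PreLoc.equiv u).support)), map_sum]
    refine Finset.sum_congr rfl fun f _ => ?_
    rw [← star_ip, map_star]
    simp
  re_inner_nonneg u := by
    rw [PreLoc.innerFn_eq u u _ subset_rfl, map_sum]
    exact Finset.sum_nonneg fun f _ =>
      (RCLike.nonneg_iff.mp (f.map_nonneg (ip_self_nonneg (PreLoc.equiv u f)))).1
  add_left u v w := by
    classical
    have h := Finsupp.support_add (g₁ := PreLoc.equiv u) (g₂ := PreLoc.equiv v)
    rw [← map_add] at h
    rw [PreLoc.innerFn_eq _ w _ h,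
      PreLoc.innerFn_eq u w _ (Finset.subset_union_left (s₂ := (PreLoc.equiv v).support)),
      PreLoc.innerFn_eq v w _ (Finset.subset_union_right (s₁ := (PreLoc.equiv u).support)),
      ← Finset.sum_add_distrib]
    exact Finset.sum_congr rfl fun f _ => by simp [ip_add_left]
  smul_left u v c := by
    have h := Finsupp.support_smul (b := c) (g := PreLoc.equiv u)
    rw [← map_smul] at h
    rw [PreLoc.innerFn_eq _ v _ h, PreLoc.innerFn_eq u v _ subset_rfl, Finset.mul_sum]
    exact Finset.sum_congr rfl fun f _ => by simp [ip_smul_left]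

instance : SeminormedAddCommGroup (PreLoc A E) :=
  InnerProductSpace.Core.toSeminormedAddCommGroup (c := PreLoc.core)
instance : InnerProductSpace ℂ (PreLoc A E) := InnerProductSpace.ofCore PreLoc.core

/-- Entrywise application of an adjointable operator. -/
def PreLoc.map (T : Adj A E F) : PreLoc A E →ₗ[ℂ] PreLoc A F :=
  PreLoc.equiv.symm.toLinearMap ∘ₗ Finsupp.mapRange.linearMap T.toCLM.toLinearMap ∘ₗ
    PreLoc.equiv.toLinearMap

lemma PreLoc.equiv_map (T : Adj A E F) (u : PreLoc A E) (f : A →ₚ[ℂ] ℂ) :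
    PreLoc.equiv (PreLoc.map T u) f = T (PreLoc.equiv u f) := by
  simp [PreLoc.map]

lemma PreLoc.inner_eq (u v : PreLoc A E) (s : Finset (A →ₚ[ℂ] ℂ))
    (hs : (PreLoc.equiv u).support ⊆ s) :
    ⟪u, v⟫_ℂ = ∑ f ∈ s, f (ip A (PreLoc.equiv u f) (PreLoc.equiv v f)) :=
  PreLoc.innerFn_eq u v s hs

lemma PreLoc.support_map (T : Adj A E F) (u : PreLoc A E) :
    (PreLoc.equiv (PreLoc.map T u)).support ⊆ (PreLoc.equiv u).support := by
  intro f
  rw [Finsupp.mem_support_iff, Finsupp.mem_support_iff, PreLoc.equiv_map]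
  exact fun h h' => h (by rw [h', map_zero])

lemma PreLoc.inner_map (T : Adj A E F) (u : PreLoc A E) (v : PreLoc A F) :
    ⟪PreLoc.map T u, v⟫_ℂ = ⟪u, PreLoc.map T.adj v⟫_ℂ := by
  rw [PreLoc.inner_eq _ v _ (PreLoc.support_map T u), PreLoc.inner_eq u _ _ subset_rfl]
  exact Finset.sum_congr rfl fun f _ => by rw [PreLoc.equiv_map, PreLoc.equiv_map, ip_adj]

lemma PreLoc.map_comp (S : Adj A F G) (T : Adj A E F) (u : PreLoc A E) :
    PreLoc.map (S.comp T) u = PreLoc.map S (PreLoc.map T u) := by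
  apply PreLoc.equiv.injective
  ext f
  rw [PreLoc.equiv_map, PreLoc.equiv_map, PreLoc.equiv_map]
  rfl

lemma PreLoc.norm_map_le (T : Adj A E F) (u : PreLoc A E) :
    ‖PreLoc.map T u‖ ≤ √‖T.adjCLM ∘L T.toCLM‖ * ‖u‖ := by
  set K := ‖T.adjCLM ∘L T.toCLM‖ with hK
  have hK0 : 0 ≤ K := norm_nonneg _
  have key : ‖PreLoc.map (T.adj.comp T) u‖ ≤ K * ‖u‖ := by
    refine norm_le_of_symmetric (PreLoc.map (T.adj.comp T)) (fun u v => PreLoc.inner_map _ u v)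
      hK0 u ?_
    have hpow : ∀ n f, ‖PreLoc.equiv ((PreLoc.map (T.adj.comp T) ^ n) u) f‖ ≤
        K ^ n * ‖PreLoc.equiv u f‖ := by
      intro n f
      induction n with
      | zero => simp
      | succ n ih =>
        rw [pow_succ', Module.End.mul_apply, PreLoc.equiv_map]
        calc _ ≤ K * ‖PreLoc.equiv ((PreLoc.map (T.adj.comp T) ^ n) u) f‖ :=
              (T.adjCLM ∘L T.toCLM).le_opNorm _
          _ ≤ K * (K ^ n * ‖PreLoc.equiv u f‖) := by gcongr
          _ = _ := by ring
    have hsupp : ∀ n, (PreLoc.equiv ((PreLoc.map (T.adj.comp T) ^ n) u)).support ⊆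
        (PreLoc.equiv u).support := by
      intro n
      induction n with
      | zero => simp
      | succ n ih =>
        rw [pow_succ', Module.End.mul_apply]
        exact (PreLoc.support_map _ _).trans ih
    have hf : ∀ f : A →ₚ[ℂ] ℂ, ∃ C : ℝ, 0 ≤ C ∧ ∀ a, ‖f a‖ ≤ C * ‖a‖ := by
      intro f
      obtain ⟨C, hC⟩ := f.exists_norm_apply_le
      exact ⟨C, C.2, hC⟩
    choose c hc0 hc using hf
    refine ⟨√(∑ f ∈ (PreLoc.equiv u).support, c f * ‖PreLoc.equiv u f‖ ^ 2), fun n => ?_⟩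
    refine (sq_le_sq₀ (norm_nonneg _) (by positivity)).1 ?_
    rw [mul_pow, Real.sq_sqrt (Finset.sum_nonneg fun f _ => mul_nonneg (hc0 f) (sq_nonneg _)),
      ← inner_self_eq_norm_sq (𝕜 := ℂ), PreLoc.inner_eq _ _ _ (hsupp n)]
    refine (RCLike.re_le_norm _).trans ((norm_sum_le _ _).trans ?_)
    rw [Finset.sum_mul]
    refine Finset.sum_le_sum fun f _ => (hc f _).trans ?_
    have h1 := norm_ip_le (A := A) (PreLoc.equiv ((PreLoc.map (T.adj.comp T) ^ n) u) f)
      (PreLoc.equiv ((PreLoc.map (T.adj.comp T) ^ n) u) f)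
    have h2 := hpow n f
    calc _ ≤ c f * (K ^ n * ‖PreLoc.equiv u f‖ * (K ^ n * ‖PreLoc.equiv u f‖)) :=
          mul_le_mul_of_nonneg_left (h1.trans (mul_le_mul h2 h2 (norm_nonneg _) (by positivity)))
            (hc0 f)
      _ = _ := by ring
  refine (sq_le_sq₀ (norm_nonneg _) (by positivity)).1 ?_
  rw [mul_pow, Real.sq_sqrt hK0, ← inner_self_eq_norm_sq (𝕜 := ℂ), PreLoc.inner_map,
    ← PreLoc.map_comp]
  calc _ ≤ ‖u‖ * ‖PreLoc.map (T.adj.comp T) u‖ := re_inner_le_norm _ _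
    _ ≤ ‖u‖ * (K * ‖u‖) := by gcongr
    _ = _ := by ring

variable (A E) in
/-- The universal Hilbert-space localization of `E`. -/
abbrev Loc : Type _ := UniformSpace.Completion (PreLoc A E)

/-- The bounded operator between localizations induced by an adjointable operator. -/
def loc (T : Adj A E F) : Loc A E →L[ℂ] Loc A F :=
  ((PreLoc.map T).mkContinuous _ (PreLoc.norm_map_le T)).completion

lemma loc_coe (T : Adj A E F) (u : PreLoc A E) :
    loc T (u : Loc A E) = ((PreLoc.map T u : PreLoc A F) : Loc A F) := by
  simp [loc]

lemma loc_comp (S : Adj A F G) (T : Adj A E F) : loc (S.comp T) = loc S ∘L loc T := by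
  ext u
  induction u using UniformSpace.Completion.induction_on with
  | hp => exact isClosed_eq (by fun_prop) (by fun_prop)
  | ih u => simp [loc_coe, PreLoc.map_comp]

lemma loc_adj (T : Adj A E F) : loc T.adj = (loc T).adjoint := by
  rw [ContinuousLinearMap.eq_adjoint_iff]
  intro u v
  induction u, v using UniformSpace.Completion.induction_on₂ with
  | hp => exact isClosed_eq (by fun_prop) (by fun_prop)
  | ih u v =>
    rw [loc_coe, loc_coe, UniformSpace.Completion.inner_coe, UniformSpace.Completion.inner_coe,
      PreLoc.inner_map]
    rfl

end Modules

/-! ### Minimal tensor product and exterior tensor product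

`TLoc A B E F` is the Hilbert-space tensor product of the localizations of `E` and `F`. The minimal
tensor product of `A` and `B` is the closed linear span of the operators `a ⊗ b` on `TLoc A B A B`
(the tensor product of the universal representations), and the exterior tensor product of `E` and
`F` is the closed linear span of the operators `x ⊗ y : TLoc A B A B → TLoc A B E F`. -/

lemma map_mem_of_closure_span {V W : Type*} [NormedAddCommGroup V] [NormedSpace ℂ V]
    [NormedAddCommGroup W] [NormedSpace ℂ W] {σ : ℂ →+* ℂ} (φ : V →ₛₗ[σ] W) (hφ : Continuous φ)
    {s : Set V} {K : Submodule ℂ W} (hK : IsClosed (K : Set W)) (h : ∀ v ∈ s, φ v ∈ K)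
    {v : V} (hv : v ∈ (Submodule.span ℂ s).topologicalClosure) : φ v ∈ K := by
  have : (Submodule.span ℂ s).topologicalClosure ≤ K.comap φ :=
    Submodule.topologicalClosure_minimal _ (Submodule.span_le.2 h) (hK.preimage hφ)
  exact this hv

lemma exists_star_mul_self_mem {B S : Type*} [NonUnitalCStarAlgebra B] [PartialOrder B]
    [StarOrderedRing B] [SetLike S B] [NonUnitalSubringClass S B] [SMulMemClass S ℂ B]
    [StarMemClass S B] (s : S) [IsClosed (s : Set B)] {b : B} (hb : b ∈ s) (h0 : 0 ≤ b) :
    ∃ c ∈ s, b = star c * c := by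
  refine ⟨CFC.sqrt b, ?_, ?_⟩
  · rw [CFC.sqrt_eq_real_sqrt b h0]
    exact cfcₙ_mem (𝕜' := ℂ) (s := s) Real.sqrt hb
  · rw [(CFC.sqrt_nonneg b).isSelfAdjoint.star_eq, CFC.sqrt_mul_sqrt_self b h0]

variable {A B : Type*} [NonUnitalCStarAlgebra A] [PartialOrder A] [StarOrderedRing A]
  [NonUnitalCStarAlgebra B] [PartialOrder B] [StarOrderedRing B]
  {E E' E'' F F' F'' : Type*}
  [NormedAddCommGroup E] [NormedSpace ℂ E] [SMul Aᵐᵒᵖ E] [CStarModule Aᵐᵒᵖ E]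
  [NormedAddCommGroup E'] [NormedSpace ℂ E'] [SMul Aᵐᵒᵖ E'] [CStarModule Aᵐᵒᵖ E']
  [NormedAddCommGroup E''] [NormedSpace ℂ E''] [SMul Aᵐᵒᵖ E''] [CStarModule Aᵐᵒᵖ E'']
  [NormedAddCommGroup F] [NormedSpace ℂ F] [SMul Bᵐᵒᵖ F] [CStarModule Bᵐᵒᵖ F]
  [NormedAddCommGroup F'] [NormedSpace ℂ F'] [SMul Bᵐᵒᵖ F'] [CStarModule Bᵐᵒᵖ F']
  [NormedAddCommGroup F''] [NormedSpace ℂ F''] [SMul Bᵐᵒᵖ F''] [CStarModule Bᵐᵒᵖ F'']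

variable (A B E F) in
/-- The Hilbert-space tensor product of the localizations of `E` and `F`. -/
def TLoc : Type _ := UniformSpace.Completion (Loc A E ⊗[ℂ] Loc B F)

instance : NormedAddCommGroup (TLoc A B E F) :=
  inferInstanceAs (NormedAddCommGroup (UniformSpace.Completion (Loc A E ⊗[ℂ] Loc B F)))
instance : InnerProductSpace ℂ (TLoc A B E F) :=
  inferInstanceAs (InnerProductSpace ℂ (UniformSpace.Completion (Loc A E ⊗[ℂ] Loc B F)))
instance : CompleteSpace (TLoc A B E F) :=
  inferInstanceAs (CompleteSpace (UniformSpace.Completion (Loc A E ⊗[ℂ] Loc B F)))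

/-- The inclusion of the algebraic tensor product. -/
def TLoc.mk (w : Loc A E ⊗[ℂ] Loc B F) : TLoc A B E F := UniformSpace.Completion.coe' w

/-- The operator on localizations induced by a pair of adjointable operators. -/
def rep (T : Adj A E E') (S : Adj B F F') : TLoc A B E F →L[ℂ] TLoc A B E' F' :=
  (TensorProduct.mapL (loc T) (loc S)).completion

lemma rep_mk (T : Adj A E E') (S : Adj B F F') (w : Loc A E ⊗[ℂ] Loc B F) :
    rep T S (TLoc.mk w) = TLoc.mk (TensorProduct.mapL (loc T) (loc S) w) :=
  ContinuousLinearMap.completion_apply_coe _ _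

lemma TLoc.inner_mk (v w : Loc A E ⊗[ℂ] Loc B F) : ⟪TLoc.mk v, TLoc.mk w⟫_ℂ = ⟪v, w⟫_ℂ :=
  UniformSpace.Completion.inner_coe v w

lemma TLoc.ext {H : Type*} [NormedAddCommGroup H] [NormedSpace ℂ H]
    {f g : TLoc A B E F →L[ℂ] H} (h : ∀ w, f (TLoc.mk w) = g (TLoc.mk w)) : f = g := by
  ext w
  induction w using UniformSpace.Completion.induction_on with
  | hp => exact isClosed_eq f.continuous g.continuous
  | ih w => exact h w

lemma rep_comp (T' : Adj A E' E'') (T : Adj A E E') (S' : Adj B F' F'') (S : Adj B F F') :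
    rep (T'.comp T) (S'.comp S) = rep T' S' ∘L rep T S :=
  TLoc.ext fun w => by
    rw [ContinuousLinearMap.comp_apply, rep_mk, rep_mk, rep_mk, loc_comp, loc_comp,
      TensorProduct.mapL_comp, ContinuousLinearMap.comp_apply]

lemma inner_mapL_adj (T : Adj A E E') (S : Adj B F F') (v : Loc A E' ⊗[ℂ] Loc B F')
    (w : Loc A E ⊗[ℂ] Loc B F) : ⟪TensorProduct.mapL (loc T.adj) (loc S.adj) v, w⟫_ℂ =
      ⟪v, TensorProduct.mapL (loc T) (loc S) w⟫_ℂ := by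
  induction v with
  | zero => simp
  | add a b ha hb => rw [map_add, inner_add_left, inner_add_left, ha, hb]
  | tmul a b =>
    induction w with
    | zero => simp
    | add c d hc hd => rw [map_add, inner_add_right, inner_add_right, hc, hd]
    | tmul c d =>
      rw [TensorProduct.mapL_tmul, TensorProduct.mapL_tmul, TensorProduct.inner_tmul,
        TensorProduct.inner_tmul, loc_adj, loc_adj, ContinuousLinearMap.adjoint_inner_left,
        ContinuousLinearMap.adjoint_inner_left]

lemma rep_adj (T : Adj A E E') (S : Adj B F F') : rep T.adj S.adj = (rep T S).adjoint := by
  rw [ContinuousLinearMap.eq_adjoint_iff]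
  intro u v
  induction u, v using UniformSpace.Completion.induction_on₂ with
  | hp =>
    exact isClosed_eq (((rep T.adj S.adj).continuous.comp continuous_fst).inner continuous_snd)
      (continuous_fst.inner ((rep T S).continuous.comp continuous_snd))
  | ih u v =>
    change ⟪rep T.adj S.adj (TLoc.mk u), TLoc.mk v⟫_ℂ = ⟪TLoc.mk u, rep T S (TLoc.mk v)⟫_ℂ
    rw [rep_mk, rep_mk, TLoc.inner_mk, TLoc.inner_mk, inner_mapL_adj]

/-- The operator `x ⊗ y : TLoc A B A B → TLoc A B E F`. -/
def gen (x : E) (y : F) : TLoc A B A B →L[ℂ] TLoc A B E F :=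
  rep (Adj.ket (A := A) x) (Adj.ket (A := B) y)

lemma comp_ket (T : Adj A E E') (x : E) : T.comp (Adj.ket x) = Adj.ket (T x) :=
  Adj.toCLM_injective (ContinuousLinearMap.ext fun a => T.map_act (op a) x)

lemma ket_comp_ket (x : E) (a : A) : (Adj.ket (A := A) x).comp (Adj.ket a) = Adj.ket (op a • x) :=
  comp_ket _ _

lemma adj_ket_comp_ket (x y : E) :
    (Adj.ket (A := A) x).adj.comp (Adj.ket y) = Adj.ket (ip A x y) :=
  comp_ket _ _

lemma adj_ket (a : A) : (Adj.ket (A := A) a).adj = Adj.ket (star a) :=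
  Adj.toCLM_injective (ContinuousLinearMap.ext fun _ => rfl)

lemma rep_comp_gen (T : Adj A E E') (S : Adj B F F') (x : E) (y : F) :
    rep T S ∘L gen x y = gen (T x) (S y) := by
  rw [gen, ← rep_comp, comp_ket, comp_ket, gen]

lemma gen_comp_gen (x : E) (y : F) (a : A) (b : B) :
    gen x y ∘L gen (A := A) (B := B) a b = gen (op a • x) (op b • y) := by
  rw [gen, rep_comp_gen]
  rfl

lemma adjoint_gen_comp_gen (x x' : E) (y y' : F) :
    (gen (A := A) (B := B) x y).adjoint ∘L gen x' y' = gen (ip A x x') (ip B y y') := by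
  rw [gen, ← rep_adj, rep_comp_gen]
  rfl

lemma adjoint_gen (a : A) (b : B) :
    (gen (A := A) (B := B) a b).adjoint = gen (star a) (star b) := by
  rw [gen, ← rep_adj, adj_ket, adj_ket, gen]

variable (A B E F) in
/-- The closed linear span of the operators `x ⊗ y`. -/
def closedSpan : Submodule ℂ (TLoc A B A B →L[ℂ] TLoc A B E F) :=
  (Submodule.span ℂ (Set.range fun p : E × F => gen (A := A) (B := B) p.1 p.2)).topologicalClosure

lemma isClosed_closedSpan : IsClosed (closedSpan A B E F : Set (TLoc A B A B →L[ℂ] TLoc A B E F)) :=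
  Submodule.isClosed_topologicalClosure _

lemma gen_mem (x : E) (y : F) : gen x y ∈ closedSpan A B E F :=
  Submodule.le_topologicalClosure _ (Submodule.subset_span ⟨(x, y), rfl⟩)

lemma rep_comp_mem (T : Adj A E E') (S : Adj B F F') {z : TLoc A B A B →L[ℂ] TLoc A B E F}
    (hz : z ∈ closedSpan A B E F) : rep T S ∘L z ∈ closedSpan A B E' F' := by
  refine map_mem_of_closure_span
    (ContinuousLinearMap.compL ℂ (TLoc A B A B) _ _ (rep T S)).toLinearMap
    (ContinuousLinearMap.continuous _) isClosed_closedSpan ?_ hz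
  rintro _ ⟨p, rfl⟩
  change rep T S ∘L gen p.1 p.2 ∈ _
  rw [rep_comp_gen]
  exact gen_mem _ _

lemma adjoint_mem {c : TLoc A B A B →L[ℂ] TLoc A B A B} (hc : c ∈ closedSpan A B A B) :
    c.adjoint ∈ closedSpan A B A B := by
  refine map_mem_of_closure_span
    (ContinuousLinearMap.adjoint (𝕜 := ℂ) (E := TLoc A B A B) (F := TLoc A B A B)).toLinearEquiv.toLinearMap
    (LinearIsometryEquiv.continuous _) isClosed_closedSpan ?_ hc
  rintro _ ⟨p, rfl⟩
  change (gen p.1 p.2).adjoint ∈ _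
  rw [adjoint_gen]
  exact gen_mem _ _

lemma comp_mem {z : TLoc A B A B →L[ℂ] TLoc A B E F} (hz : z ∈ closedSpan A B E F)
    {c : TLoc A B A B →L[ℂ] TLoc A B A B} (hc : c ∈ closedSpan A B A B) :
    z ∘L c ∈ closedSpan A B E F := by
  refine map_mem_of_closure_span
    (ContinuousLinearMap.compL ℂ (TLoc A B A B) _ _ z).toLinearMap
    (ContinuousLinearMap.continuous _) isClosed_closedSpan ?_ hc
  rintro _ ⟨p, rfl⟩
  change z ∘L gen p.1 p.2 ∈ _
  refine map_mem_of_closure_span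
    ((ContinuousLinearMap.compL ℂ (TLoc A B A B) (TLoc A B A B) (TLoc A B E F)).flip (gen p.1 p.2)).toLinearMap
    (ContinuousLinearMap.continuous _) isClosed_closedSpan ?_ hz
  rintro _ ⟨q, rfl⟩
  change gen q.1 q.2 ∘L gen p.1 p.2 ∈ _
  rw [gen_comp_gen]
  exact gen_mem _ _

lemma adjoint_comp_mem {z w : TLoc A B A B →L[ℂ] TLoc A B E F} (hz : z ∈ closedSpan A B E F)
    (hw : w ∈ closedSpan A B E F) : z.adjoint ∘L w ∈ closedSpan A B A B := by
  refine map_mem_of_closure_span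
    (ContinuousLinearMap.compL ℂ (TLoc A B A B) _ _ z.adjoint).toLinearMap
    (ContinuousLinearMap.continuous _) isClosed_closedSpan ?_ hw
  rintro _ ⟨p, rfl⟩
  change z.adjoint ∘L gen p.1 p.2 ∈ _
  refine map_mem_of_closure_span
    (((ContinuousLinearMap.compL ℂ (TLoc A B A B) (TLoc A B E F) (TLoc A B A B)).flip
      (gen p.1 p.2)).toLinearMap.comp
      (ContinuousLinearMap.adjoint (𝕜 := ℂ) (E := TLoc A B A B)
        (F := TLoc A B E F)).toLinearEquiv.toLinearMap)
    (((ContinuousLinearMap.compL ℂ (TLoc A B A B) (TLoc A B E F) (TLoc A B A B)).flip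
      (gen p.1 p.2)).continuous.comp (ContinuousLinearMap.adjoint (𝕜 := ℂ) (E := TLoc A B A B)
        (F := TLoc A B E F)).continuous)
    isClosed_closedSpan ?_ hz
  rintro _ ⟨q, rfl⟩
  change (gen q.1 q.2).adjoint ∘L gen p.1 p.2 ∈ _
  rw [adjoint_gen_comp_gen]
  exact gen_mem _ _

variable (A B) in
/-- The minimal tensor product as a C⋆-algebra of operators. -/
def minAlg : NonUnitalStarSubalgebra ℂ (TLoc A B A B →L[ℂ] TLoc A B A B) where
  toNonUnitalSubalgebra :=
    { (closedSpan A B A B) with mul_mem' := fun ha hb => comp_mem ha hb }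
  star_mem' ha := adjoint_mem ha

instance : IsClosed (minAlg A B : Set (TLoc A B A B →L[ℂ] TLoc A B A B)) :=
  isClosed_closedSpan

variable (A B) in
/-- The minimal (spatial) tensor product `A ⊗ B` of C⋆-algebras. -/
def MinTensor : Type _ := minAlg A B

/-- The underlying operator. -/
def MinTensor.toCLM (c : MinTensor A B) : TLoc A B A B →L[ℂ] TLoc A B A B := Subtype.val c

lemma MinTensor.toCLM_mem (c : MinTensor A B) : c.toCLM ∈ closedSpan A B A B := Subtype.property c

lemma MinTensor.ext {c d : MinTensor A B} (h : c.toCLM = d.toCLM) : c = d := Subtype.ext h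

instance : NonUnitalCStarAlgebra (MinTensor A B) :=
  inferInstanceAs (NonUnitalCStarAlgebra (minAlg A B))
instance : PartialOrder (MinTensor A B) := CStarAlgebra.spectralOrder _
instance : StarOrderedRing (MinTensor A B) := CStarAlgebra.spectralOrderedRing _

/-- The elementary tensor `a ⊗ b` in the minimal tensor product. -/
def MinTensor.tmul (a : A) (b : B) : MinTensor A B := ⟨gen a b, gen_mem a b⟩

lemma MinTensor.nonneg_of_eq_adjoint_comp (c : MinTensor A B)
    (z : TLoc A B A B →L[ℂ] TLoc A B E F) (h : c.toCLM = z.adjoint ∘L z) : 0 ≤ c := by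
  have h0 : 0 ≤ c.toCLM := by
    rw [h, ContinuousLinearMap.nonneg_iff_isPositive]
    exact ContinuousLinearMap.isPositive_adjoint_comp_self z
  obtain ⟨s, hs, hc⟩ := exists_star_mul_self_mem (minAlg A B) c.toCLM_mem h0
  let t : MinTensor A B := ⟨s, hs⟩
  have : c = star t * t := Subtype.ext hc
  rw [this]
  exact star_mul_self_nonneg t

variable (A B E F) in
/-- The exterior tensor product `E ⊗ F` of Hilbert C⋆-modules. -/
def ExtTensor : Type _ := closedSpan A B E F

/-- The underlying operator. -/
def ExtTensor.toCLM (z : ExtTensor A B E F) : TLoc A B A B →L[ℂ] TLoc A B E F := Subtype.val z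

lemma ExtTensor.toCLM_mem (z : ExtTensor A B E F) : z.toCLM ∈ closedSpan A B E F := Subtype.property z

lemma ExtTensor.ext {z w : ExtTensor A B E F} (h : z.toCLM = w.toCLM) : z = w := Subtype.ext h

instance : NormedAddCommGroup (ExtTensor A B E F) :=
  inferInstanceAs (NormedAddCommGroup (closedSpan A B E F))
instance : NormedSpace ℂ (ExtTensor A B E F) :=
  inferInstanceAs (NormedSpace ℂ (closedSpan A B E F))
instance : CompleteSpace (ExtTensor A B E F) :=
  (isClosed_closedSpan (A := A) (B := B) (E := E) (F := F)).completeSpace_coe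

instance : SMul (MinTensor A B)ᵐᵒᵖ (ExtTensor A B E F) :=
  ⟨fun c z => ⟨z.toCLM ∘L c.unop.toCLM, comp_mem z.toCLM_mem c.unop.toCLM_mem⟩⟩

instance : CStarModule (MinTensor A B)ᵐᵒᵖ (ExtTensor A B E F) where
  inner z w := op ⟨z.toCLM.adjoint ∘L w.toCLM, adjoint_comp_mem z.toCLM_mem w.toCLM_mem⟩
  inner_add_right := unop_injective (Subtype.ext (ContinuousLinearMap.comp_add _ _ _))
  inner_self_nonneg {z} := unop_le_unop.1 (MinTensor.nonneg_of_eq_adjoint_comp _ z.toCLM rfl)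
  inner_self {z} := by
    refine (op_eq_zero_iff _).trans ?_
    constructor
    · intro h
      have h1 : z.toCLM.adjoint ∘L z.toCLM = 0 := congrArg Subtype.val h
      have h2 := ContinuousLinearMap.norm_adjoint_comp_self z.toCLM
      rw [h1, norm_zero] at h2
      exact ExtTensor.ext (norm_eq_zero.1 (mul_self_eq_zero.1 h2.symm))
    · rintro rfl
      exact Subtype.ext (ContinuousLinearMap.comp_zero _)
  inner_op_smul_right {c z w} := unop_injective (Subtype.ext (ContinuousLinearMap.comp_assoc _ _ _).symm)
  inner_smul_right_complex {c z w} :=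
    unop_injective (Subtype.ext (ContinuousLinearMap.comp_smul _ _ _))
  star_inner z w := unop_injective (Subtype.ext (by
    change (z.toCLM.adjoint ∘L w.toCLM).adjoint = w.toCLM.adjoint ∘L z.toCLM
    rw [ContinuousLinearMap.adjoint_comp, ContinuousLinearMap.adjoint_adjoint]))
  norm_eq_sqrt_norm_inner_self z := by
    have h2 := ContinuousLinearMap.norm_adjoint_comp_self z.toCLM
    change ‖z.toCLM‖ = √‖z.toCLM.adjoint ∘L z.toCLM‖
    rw [h2, Real.sqrt_mul_self (norm_nonneg _)]

variable (A B) in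
/-- The elementary tensor `x ⊗ y` in the exterior tensor product. -/
def ExtTensor.tmul (x : E) (y : F) : ExtTensor A B E F := ⟨gen x y, gen_mem x y⟩

/-- `⟨x ⊗ y, x' ⊗ y'⟩ = ⟨x, x'⟩ ⊗ ⟨y, y'⟩`. -/
lemma ExtTensor.ip_tmul (x x' : E) (y y' : F) :
    ip (MinTensor A B) (ExtTensor.tmul A B x y) (ExtTensor.tmul A B x' y') =
      MinTensor.tmul (ip A x x') (ip B y y') :=
  Subtype.ext (adjoint_gen_comp_gen x x' y y')

/-- Elementary tensors span a dense subspace. -/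
lemma ExtTensor.dense_span :
    Dense (Submodule.span ℂ (Set.range fun p : E × F => ExtTensor.tmul A B p.1 p.2) :
      Set (ExtTensor A B E F)) := by
  refine Subtype.dense_iff.2 fun z hz => ?_
  have h : Subtype.val '' (Submodule.span ℂ (Set.range fun p : E × F =>
      (⟨gen p.1 p.2, gen_mem p.1 p.2⟩ : closedSpan A B E F)) : Set (closedSpan A B E F)) =
      (Submodule.span ℂ (Set.range fun p : E × F => gen (A := A) (B := B) p.1 p.2) : Set _) := by
    rw [← Submodule.coe_subtype, ← Submodule.map_coe, Submodule.map_span, ← Set.range_comp]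
    rfl
  exact h.symm ▸ hz

/-- The tensor product `T ⊗ S` of adjointable operators. -/
def Adj.tensor (T : Adj A E E') (S : Adj B F F') :
    Adj (MinTensor A B) (ExtTensor A B E F) (ExtTensor A B E' F') where
  toCLM := LinearMap.mkContinuous
    { toFun := fun z => ⟨rep T S ∘L z.toCLM, rep_comp_mem T S z.2⟩
      map_add' := fun _ _ => Subtype.ext (ContinuousLinearMap.comp_add _ _ _)
      map_smul' := fun _ _ => Subtype.ext (ContinuousLinearMap.comp_smul _ _ _) } ‖rep T S‖
    fun z => ContinuousLinearMap.opNorm_comp_le _ _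
  adjCLM := LinearMap.mkContinuous
    { toFun := fun z => ⟨rep T.adj S.adj ∘L z.toCLM, rep_comp_mem T.adj S.adj z.2⟩
      map_add' := fun _ _ => Subtype.ext (ContinuousLinearMap.comp_add _ _ _)
      map_smul' := fun _ _ => Subtype.ext (ContinuousLinearMap.comp_smul _ _ _) }
    ‖rep T.adj S.adj‖ fun z => ContinuousLinearMap.opNorm_comp_le _ _
  inner_adj z w := unop_injective (Subtype.ext (by
    change (rep T S ∘L z.toCLM).adjoint ∘L w.toCLM = z.toCLM.adjoint ∘L (rep T.adj S.adj ∘L w.toCLM)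
    rw [ContinuousLinearMap.adjoint_comp, rep_adj]
    rfl))

/-- `(T ⊗ S)(x ⊗ y) = T x ⊗ S y`. -/
lemma Adj.tensor_tmul (T : Adj A E E') (S : Adj B F F') (x : E) (y : F) :
    Adj.tensor T S (ExtTensor.tmul A B x y) = ExtTensor.tmul A B (T x) (S y) :=
  Subtype.ext (rep_comp_gen T S x y)

lemma Adj.adj_tensor (T : Adj A E E') (S : Adj B F F') :
    (Adj.tensor T S).adj = Adj.tensor T.adj S.adj := rfl

lemma Adj.tensor_comp (T' : Adj A E' E'') (T : Adj A E E') (S' : Adj B F' F'') (S : Adj B F F') :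
    Adj.tensor (T'.comp T) (S'.comp S) = (Adj.tensor T' S').comp (Adj.tensor T S) := by
  refine Adj.toCLM_injective (ContinuousLinearMap.ext fun z => Subtype.ext ?_)
  change rep (T'.comp T) (S'.comp S) ∘L z.toCLM = rep T' S' ∘L (rep T S ∘L z.toCLM)
  rw [rep_comp]
  rfl

/-! ### Orthogonal sums and operator matrices

Finite orthogonal sums of Hilbert `A`-modules are Mathlib's `WithCStarModule` structures on finite
products; their inner product is the sum of the inner products of the components. -/

section Sums

variable {A : Type*} [NonUnitalCStarAlgebra A] [PartialOrder A] [StarOrderedRing A]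

variable (A) in
/-- The orthogonal sum `⨁ i, E i` of a finite family of Hilbert `A`-modules. -/
abbrev OSum {ι : Type*} [Fintype ι] (E : ι → Type*) [∀ i, NormedAddCommGroup (E i)]
    [∀ i, NormedSpace ℂ (E i)] [∀ i, SMul Aᵐᵒᵖ (E i)] [∀ i, CStarModule Aᵐᵒᵖ (E i)] : Type _ :=
  WithCStarModule Aᵐᵒᵖ (Π i, E i)

variable (A) in
/-- The orthogonal sum `E ⊕ F` of two Hilbert `A`-modules. -/
abbrev OSum₂ (E F : Type*) [NormedAddCommGroup E] [NormedSpace ℂ E] [SMul Aᵐᵒᵖ E]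
    [CStarModule Aᵐᵒᵖ E] [NormedAddCommGroup F] [NormedSpace ℂ F] [SMul Aᵐᵒᵖ F]
    [CStarModule Aᵐᵒᵖ F] : Type _ :=
  WithCStarModule Aᵐᵒᵖ (E × F)

variable {ι κ τ : Type*} [Fintype ι] [Fintype κ] [Fintype τ]
  {E : ι → Type*} {F : κ → Type*} {G : τ → Type*}
  [∀ i, NormedAddCommGroup (E i)] [∀ i, NormedSpace ℂ (E i)] [∀ i, SMul Aᵐᵒᵖ (E i)]
  [∀ i, CStarModule Aᵐᵒᵖ (E i)]
  [∀ i, NormedAddCommGroup (F i)] [∀ i, NormedSpace ℂ (F i)] [∀ i, SMul Aᵐᵒᵖ (F i)]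
  [∀ i, CStarModule Aᵐᵒᵖ (F i)]
  [∀ i, NormedAddCommGroup (G i)] [∀ i, NormedSpace ℂ (G i)] [∀ i, SMul Aᵐᵒᵖ (G i)]
  [∀ i, CStarModule Aᵐᵒᵖ (G i)]

/-- The bounded operator with matrix `T`, where `T i j` maps the `i`-th summand of the source to the
`j`-th summand of the target. -/
def matrixCLM (T : ∀ i j, E i →L[ℂ] F j) : OSum A E →L[ℂ] OSum A F :=
  (WithCStarModule.equivL ℂ).symm.toContinuousLinearMap ∘L
    (ContinuousLinearMap.pi fun j => ∑ i, T i j ∘L ContinuousLinearMap.proj i) ∘L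
      (WithCStarModule.equivL ℂ).toContinuousLinearMap

lemma matrixCLM_apply (T : ∀ i j, E i →L[ℂ] F j) (x : OSum A E) (j : κ) :
    matrixCLM (A := A) T x j = ∑ i, T i j (x i) := by
  change (ContinuousLinearMap.pi fun j => ∑ i, T i j ∘L ContinuousLinearMap.proj i)
    (WithCStarModule.equivL ℂ x) j = _
  simp

/-- The adjointable operator `⨁ E i → ⨁ F j` with matrix `T`, where `T i j` maps the `i`-th summand
of the source to the `j`-th summand of the target: `(T x)_j = ∑ i, T i j (x_i)`. -/
def Adj.matrix (T : ∀ i j, Adj A (E i) (F j)) : Adj A (OSum A E) (OSum A F) where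
  toCLM := matrixCLM fun i j => (T i j).toCLM
  adjCLM := matrixCLM fun j i => (T i j).adjCLM
  inner_adj x y := by
    rw [WithCStarModule.pi_inner, WithCStarModule.pi_inner]
    simp only [matrixCLM_apply, CStarModule.inner_sum_left, CStarModule.inner_sum_right]
    rw [Finset.sum_comm]
    exact Finset.sum_congr rfl fun i _ => Finset.sum_congr rfl fun j _ => (T i j).inner_adj _ _

lemma Adj.matrix_apply (T : ∀ i j, Adj A (E i) (F j)) (x : OSum A E) (j : κ) :
    Adj.matrix T x j = ∑ i, T i j (x i) :=
  matrixCLM_apply _ x j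

lemma Adj.adj_matrix (T : ∀ i j, Adj A (E i) (F j)) :
    (Adj.matrix T).adj = Adj.matrix fun j i => (T i j).adj := rfl

lemma Adj.matrix_eq_zero {T : ∀ i j, Adj A (E i) (F j)} (h : ∀ i j, T i j = 0) :
    Adj.matrix T = 0 :=
  Adj.toCLM_injective <| ContinuousLinearMap.ext fun x => WithCStarModule.ext fun j => by
    rw [Adj.matrix_apply]
    refine Finset.sum_eq_zero fun i _ => ?_
    rw [h]
    rfl

lemma Adj.matrix_comp (S : ∀ j k, Adj A (F j) (G k)) (T : ∀ i j, Adj A (E i) (F j)) :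
    (Adj.matrix S).comp (Adj.matrix T) = Adj.matrix fun i k => ∑ j, (S j k).comp (T i j) :=
  Adj.toCLM_injective <| ContinuousLinearMap.ext fun x => WithCStarModule.ext fun k => by
    change Adj.matrix S (Adj.matrix T x) k = _
    simp only [Adj.matrix_apply, map_sum]
    rw [Finset.sum_comm]
    refine Finset.sum_congr rfl fun i _ => ?_
    exact (map_sum (AddMonoidHom.mk' (fun T : Adj A (E i) (G k) => T (x i)) fun _ _ => rfl)
      (fun j => (S j k).comp (T i j)) Finset.univ).symm

end Sums

section Block

variable {A : Type*} [NonUnitalCStarAlgebra A] [PartialOrder A] [StarOrderedRing A]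
  {E E' F F' : Type*}
  [NormedAddCommGroup E] [NormedSpace ℂ E] [SMul Aᵐᵒᵖ E] [CStarModule Aᵐᵒᵖ E]
  [NormedAddCommGroup E'] [NormedSpace ℂ E'] [SMul Aᵐᵒᵖ E'] [CStarModule Aᵐᵒᵖ E']
  [NormedAddCommGroup F] [NormedSpace ℂ F] [SMul Aᵐᵒᵖ F] [CStarModule Aᵐᵒᵖ F]
  [NormedAddCommGroup F'] [NormedSpace ℂ F'] [SMul Aᵐᵒᵖ F'] [CStarModule Aᵐᵒᵖ F']

/-- The bounded operator `(x, y) ↦ (a x + b y, c x + d y)`. -/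
def blockCLM (a : E →L[ℂ] F) (b : E' →L[ℂ] F) (c : E →L[ℂ] F') (d : E' →L[ℂ] F') :
    OSum₂ A E E' →L[ℂ] OSum₂ A F F' :=
  (WithCStarModule.equivL ℂ).symm.toContinuousLinearMap ∘L
    ((a.coprod b).prod (c.coprod d)) ∘L (WithCStarModule.equivL ℂ).toContinuousLinearMap

/-- The adjointable operator `E ⊕ E' → F ⊕ F'` with block matrix `[[a, b], [c, d]]`. -/
def Adj.block (a : Adj A E F) (b : Adj A E' F) (c : Adj A E F') (d : Adj A E' F') :
    Adj A (OSum₂ A E E') (OSum₂ A F F') where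
  toCLM := blockCLM a.toCLM b.toCLM c.toCLM d.toCLM
  adjCLM := blockCLM a.adjCLM c.adjCLM b.adjCLM d.adjCLM
  inner_adj x y := by
    change inner Aᵐᵒᵖ (a x.1 + b x.2) y.1 + inner Aᵐᵒᵖ (c x.1 + d x.2) y.2 =
      inner Aᵐᵒᵖ x.1 (a.adjCLM y.1 + c.adjCLM y.2) + inner Aᵐᵒᵖ x.2 (b.adjCLM y.1 + d.adjCLM y.2)
    rw [CStarModule.inner_add_left, CStarModule.inner_add_left, CStarModule.inner_add_right,
      CStarModule.inner_add_right, a.inner_adj, b.inner_adj, c.inner_adj, d.inner_adj]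
    abel

end Block

/-! ### Algebra of adjointable operators -/

section Algebra

variable {A B : Type*} [NonUnitalCStarAlgebra A] [PartialOrder A] [StarOrderedRing A]
  [NonUnitalCStarAlgebra B] [PartialOrder B] [StarOrderedRing B]
  {E E' F F' G : Type*}
  [NormedAddCommGroup E] [NormedSpace ℂ E] [SMul Aᵐᵒᵖ E] [CStarModule Aᵐᵒᵖ E]
  [NormedAddCommGroup E'] [NormedSpace ℂ E'] [SMul Aᵐᵒᵖ E'] [CStarModule Aᵐᵒᵖ E']
  [NormedAddCommGroup G] [NormedSpace ℂ G] [SMul Aᵐᵒᵖ G] [CStarModule Aᵐᵒᵖ G]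
  [NormedAddCommGroup F] [NormedSpace ℂ F] [SMul Bᵐᵒᵖ F] [CStarModule Bᵐᵒᵖ F]
  [NormedAddCommGroup F'] [NormedSpace ℂ F'] [SMul Bᵐᵒᵖ F'] [CStarModule Bᵐᵒᵖ F']

lemma Adj.ext {T S : Adj A E E'} (h : ∀ x, T x = S x) : T = S :=
  Adj.toCLM_injective (ContinuousLinearMap.ext h)

lemma Adj.sum_apply {ι : Type*} (s : Finset ι) (T : ι → Adj A E E') (x : E) :
    (∑ i ∈ s, T i) x = ∑ i ∈ s, T i x :=
  map_sum (AddMonoidHom.mk' (fun T : Adj A E E' => T x) fun _ _ => rfl) T s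

lemma Adj.comp_add (S : Adj A E' G) (T T' : Adj A E E') :
    S.comp (T + T') = S.comp T + S.comp T' := Adj.ext fun _ => map_add S.toCLM _ _

lemma Adj.add_comp (S S' : Adj A E' G) (T : Adj A E E') :
    (S + S').comp T = S.comp T + S'.comp T := Adj.ext fun _ => rfl

lemma Adj.comp_zsmul (S : Adj A E' G) (n : ℤ) (T : Adj A E E') :
    S.comp (n • T) = n • S.comp T := Adj.ext fun _ => map_smul S.toCLM _ _

lemma Adj.zsmul_comp (n : ℤ) (S : Adj A E' G) (T : Adj A E E') :
    (n • S).comp T = n • S.comp T := Adj.ext fun _ => rfl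

lemma Adj.comp_zero (S : Adj A E' G) : S.comp (0 : Adj A E E') = 0 := Adj.ext fun _ => map_zero S.toCLM

lemma Adj.zero_comp (T : Adj A E E') : (0 : Adj A E' G).comp T = 0 := Adj.ext fun _ => rfl

lemma Adj.comp_id (T : Adj A E E') : T.comp (Adj.id A E) = T := rfl

lemma Adj.id_comp (T : Adj A E E') : (Adj.id A E').comp T = T := rfl

lemma loc_zero : loc (0 : Adj A E E') = 0 := by
  ext u
  induction u using UniformSpace.Completion.induction_on with
  | hp => exact isClosed_eq (loc (0 : Adj A E E')).continuous continuous_const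
  | ih u =>
    rw [loc_coe]
    have : PreLoc.map (0 : Adj A E E') u = 0 := by
      apply PreLoc.equiv.injective
      ext f
      rw [PreLoc.equiv_map, map_zero]
      rfl
    rw [this]
    rfl

lemma rep_eq_zero {T : Adj A E E'} {S : Adj B F F'}
    (h : TensorProduct.mapL (loc T) (loc S) = 0) : rep T S = 0 :=
  TLoc.ext fun w => by
    rw [rep_mk, h]
    rfl

lemma Adj.zero_tensor (S : Adj B F F') : Adj.tensor (0 : Adj A E E') S = 0 :=
  Adj.ext fun z => ExtTensor.ext (by
    change rep (0 : Adj A E E') S ∘L z.toCLM = 0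
    rw [rep_eq_zero (by rw [loc_zero, TensorProduct.mapL_zero_left]),
      ContinuousLinearMap.zero_comp])

lemma Adj.tensor_zero (T : Adj A E E') : Adj.tensor T (0 : Adj B F F') = 0 :=
  Adj.ext fun z => ExtTensor.ext (by
    change rep T (0 : Adj B F F') ∘L z.toCLM = 0
    rw [rep_eq_zero (by rw [loc_zero, TensorProduct.mapL_zero_right]),
      ContinuousLinearMap.zero_comp])

/-- The matrix entry `(i, j)` of the diagonal operator with diagonal `T`. -/
def Adj.diag {ι : Type*} [DecidableEq ι] {L : ι → Type*} [∀ i, NormedAddCommGroup (L i)]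
    [∀ i, NormedSpace ℂ (L i)] [∀ i, SMul Aᵐᵒᵖ (L i)] [∀ i, CStarModule Aᵐᵒᵖ (L i)]
    (T : ∀ i, Adj A (L i) (L i)) (i j : ι) : Adj A (L i) (L j) :=
  if h : i = j then h ▸ T i else 0

variable (A) in
/-- The matrix entry `(i, j)` of the identity operator. -/
def Adj.one {ι : Type*} [DecidableEq ι] (L : ι → Type*) [∀ i, NormedAddCommGroup (L i)]
    [∀ i, NormedSpace ℂ (L i)] [∀ i, SMul Aᵐᵒᵖ (L i)] [∀ i, CStarModule Aᵐᵒᵖ (L i)]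
    (i j : ι) : Adj A (L i) (L j) :=
  Adj.diag (fun i => Adj.id A (L i)) i j

section one
variable {ι : Type*} [DecidableEq ι] {L : ι → Type*} [∀ i, NormedAddCommGroup (L i)]
    [∀ i, NormedSpace ℂ (L i)] [∀ i, SMul Aᵐᵒᵖ (L i)] [∀ i, CStarModule Aᵐᵒᵖ (L i)]

lemma Adj.one_self (i : ι) : Adj.one A L i i = Adj.id A (L i) := by simp [Adj.one, Adj.diag]

lemma Adj.one_of_ne {i j : ι} (h : i ≠ j) : Adj.one A L i j = 0 := by simp [Adj.one, Adj.diag, h]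

end one

end Algebra

/-! ### Complexes of Hilbert C⋆-modules -/

section Complexes

/-- An adjointable complex `L 0 → L 1 → ⋯ → L (N + 1)` of Hilbert `A`-modules. The operator `d i j`
is `0` unless `j = i + 1`. -/
structure HilbComplex (A : Type*) [NonUnitalCStarAlgebra A] [PartialOrder A] [StarOrderedRing A]
    {N : ℕ} (L : Fin (N + 2) → Type*) [∀ i, NormedAddCommGroup (L i)] [∀ i, NormedSpace ℂ (L i)]
    [∀ i, SMul Aᵐᵒᵖ (L i)] [∀ i, CStarModule Aᵐᵒᵖ (L i)] where
  d : ∀ i j, Adj A (L i) (L j)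
  shape : ∀ i j : Fin (N + 2), (i : ℕ) + 1 ≠ j → d i j = 0
  d_comp_d : ∀ i j k, (d j k).comp (d i j) = 0

variable {A B : Type*} [NonUnitalCStarAlgebra A] [PartialOrder A] [StarOrderedRing A]
  [NonUnitalCStarAlgebra B] [PartialOrder B] [StarOrderedRing B]
  {N M : ℕ} {L : Fin (N + 2) → Type*} {K : Fin (M + 2) → Type*}
  [∀ i, NormedAddCommGroup (L i)] [∀ i, NormedSpace ℂ (L i)] [∀ i, SMul Aᵐᵒᵖ (L i)]
  [∀ i, CStarModule Aᵐᵒᵖ (L i)]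
  [∀ i, NormedAddCommGroup (K i)] [∀ i, NormedSpace ℂ (K i)] [∀ i, SMul Bᵐᵒᵖ (K i)]
  [∀ i, CStarModule Bᵐᵒᵖ (K i)]

variable (A L) in
/-- The sum of the modules of even degree. -/
abbrev EvenPart : Type _ := OSum A fun k : {k : Fin (N + 2) // Even (k : ℕ)} => L k

variable (A L) in
/-- The sum of the modules of odd degree. -/
abbrev OddPart : Type _ := OSum A fun k : {k : Fin (N + 2) // Odd (k : ℕ)} => L k

namespace HilbComplex

variable (R : HilbComplex A L) (S : HilbComplex B K)

/-- The even Dirac operator `d + d⋆`, from the even part to the odd part. -/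
def evenDirac : Adj A (EvenPart A L) (OddPart A L) :=
  Adj.matrix fun k l => R.d k l + (R.d l k).adj

/-- The odd Dirac operator `d + d⋆`, from the odd part to the even part. -/
def oddDirac : Adj A (OddPart A L) (EvenPart A L) :=
  Adj.matrix fun k l => R.d k l + (R.d l k).adj

lemma adj_evenDirac : R.evenDirac.adj = R.oddDirac := by
  rw [evenDirac, oddDirac, Adj.adj_matrix]
  congr 1
  funext k l
  exact add_comm (R.d l.1 k.1).adj (R.d k.1 l.1)

/-- For operators `Pl k : L (k + 1) → L k` and `Pr k : L (k + 1) → L k`, the defect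
`C k = 1 - Pl k ∘ d k - d (k - 1) ∘ Pr (k - 1)`. -/
def defect (Pl Pr : ∀ i j, Adj A (L i) (L j)) (k : Fin (N + 2)) : Adj A (L k) (L k) :=
  Adj.id A (L k) - ∑ j, ((Pl j k).comp (R.d k j) + (R.d j k).comp (Pr k j))

/-- A joint parametrix of a complex: two families of operators of degree `-1` such that the defect
is compact in every degree. -/
structure IsJointParametrix (Pl Pr : ∀ i j, Adj A (L i) (L j)) : Prop where
  shape_left : ∀ i j : Fin (N + 2), (j : ℕ) + 1 ≠ i → Pl i j = 0
  shape_right : ∀ i j : Fin (N + 2), (j : ℕ) + 1 ≠ i → Pr i j = 0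
  compact : ∀ k, (R.defect Pl Pr k).IsCompact

/-- A parametrix of a complex is a joint parametrix whose two families agree. -/
def IsParametrix (P : ∀ i j, Adj A (L i) (L j)) : Prop := R.IsJointParametrix P P

/-- A complex is `A`-Fredholm if it has a joint parametrix. -/
def IsFredholm : Prop := ∃ Pl Pr, R.IsJointParametrix Pl Pr

end HilbComplex

variable (A B L K) in
/-- The `k`-th module `⨁_{j + i = k} L j ⊗ K i` of the tensor product of two complexes. -/
abbrev TensorModule (k : Fin (N + M + 1 + 2)) : Type _ :=
  OSum (MinTensor A B) fun p : {p : Fin (N + 2) × Fin (M + 2) // (p.1 : ℕ) + p.2 = k} =>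
    ExtTensor A B (L p.1.1) (K p.1.2)

/-- The component `L p.1 ⊗ K p.2 → L q.1 ⊗ K q.2` of the differential
`∑ (R_j ⊗ 1 + (-1)^j ⊗ S_i)`. -/
def tensorEntry (R : HilbComplex A L) (S : HilbComplex B K) (p q : Fin (N + 2) × Fin (M + 2)) :
    Adj (MinTensor A B) (ExtTensor A B (L p.1) (K p.2)) (ExtTensor A B (L q.1) (K q.2)) :=
  (R.d p.1 q.1).tensor (Adj.one B K p.2 q.2) +
    (-1 : ℤ) ^ (p.1 : ℕ) • (Adj.one A L p.1 q.1).tensor (S.d p.2 q.2)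

lemma tensorEntry_eq_zero (R : HilbComplex A L) (S : HilbComplex B K)
    (p q : Fin (N + 2) × Fin (M + 2)) (h : (p.1 : ℕ) + p.2 + 1 ≠ q.1 + q.2) :
    tensorEntry R S p q = 0 := by
  have h1 : (R.d p.1 q.1).tensor (Adj.one B K p.2 q.2) = 0 := by
    by_cases h2 : p.2 = q.2
    · rw [R.shape _ _ (by rw [h2] at h; omega), Adj.zero_tensor]
    · rw [Adj.one_of_ne h2, Adj.tensor_zero]
  have h2 : (Adj.one A L p.1 q.1).tensor (S.d p.2 q.2) = 0 := by
    by_cases h2 : p.1 = q.1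
    · rw [S.shape _ _ (by rw [h2] at h; omega), Adj.tensor_zero]
    · rw [Adj.one_of_ne h2, Adj.zero_tensor]
  rw [tensorEntry, h1, h2, smul_zero, add_zero]

lemma sum_tensorEntry_comp (R : HilbComplex A L) (S : HilbComplex B K)
    (p r : Fin (N + 2) × Fin (M + 2)) :
    ∑ q, (tensorEntry R S q r).comp (tensorEntry R S p q) = 0 := by
  have h : ∀ q : Fin (N + 2) × Fin (M + 2), (tensorEntry R S q r).comp (tensorEntry R S p q) =
      (if q = (r.1, p.2) then
        (-1 : ℤ) ^ (r.1 : ℕ) • (R.d p.1 r.1).tensor (S.d p.2 r.2) else 0) +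
      (if q = (p.1, r.2) then
        (-1 : ℤ) ^ (p.1 : ℕ) • (R.d p.1 r.1).tensor (S.d p.2 r.2) else 0) := by
    intro q
    obtain ⟨p₁, p₂⟩ := p
    obtain ⟨q₁, q₂⟩ := q
    obtain ⟨r₁, r₂⟩ := r
    simp only [tensorEntry, Adj.comp_add, Adj.add_comp, Adj.comp_zsmul, Adj.zsmul_comp,
      ← Adj.tensor_comp, R.d_comp_d, S.d_comp_d, Adj.zero_tensor, Adj.tensor_zero, smul_zero,
      zero_add, add_zero, Prod.mk.injEq]
    congr 1
    · by_cases h : q₁ = r₁ ∧ q₂ = p₂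
      · obtain ⟨rfl, rfl⟩ := h
        simp [Adj.one_self, Adj.comp_id, Adj.id_comp]
      · rw [if_neg h]
        by_cases h1 : q₁ = r₁
        · have h2 : p₂ ≠ q₂ := fun h2 => h ⟨h1, h2.symm⟩
          rw [Adj.one_of_ne h2, Adj.comp_zero, Adj.tensor_zero, smul_zero]
        · rw [Adj.one_of_ne h1, Adj.zero_comp, Adj.zero_tensor, smul_zero]
    · by_cases h : q₁ = p₁ ∧ q₂ = r₂
      · obtain ⟨rfl, rfl⟩ := h
        simp [Adj.one_self, Adj.comp_id, Adj.id_comp]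
      · rw [if_neg h]
        by_cases h1 : q₁ = p₁
        · have h2 : q₂ ≠ r₂ := fun h2 => h ⟨h1, h2⟩
          rw [Adj.one_of_ne h2, Adj.zero_comp, Adj.tensor_zero, smul_zero]
        · rw [Adj.one_of_ne (Ne.symm h1), Adj.comp_zero, Adj.zero_tensor, smul_zero]
  rw [Finset.sum_congr rfl fun q _ => h q, Finset.sum_add_distrib, Finset.sum_ite_eq',
    Finset.sum_ite_eq', if_pos (Finset.mem_univ _), if_pos (Finset.mem_univ _)]
  by_cases hpr : (p.1 : ℕ) + 1 = r.1
  · rw [← hpr, pow_succ, mul_neg_one, neg_smul, neg_add_cancel]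
  · rw [R.shape _ _ hpr, Adj.zero_tensor, smul_zero, smul_zero, add_zero]

lemma sum_tensorEntry_comp_of_degree (R : HilbComplex A L) (S : HilbComplex B K) (n : ℕ)
    (p r : Fin (N + 2) × Fin (M + 2)) :
    ∑ q : {q : Fin (N + 2) × Fin (M + 2) // (q.1 : ℕ) + q.2 = n},
      (tensorEntry R S q.1 r).comp (tensorEntry R S p q.1) = 0 := by
  by_cases h : (p.1 : ℕ) + p.2 + 1 = n
  · rw [← sum_tensorEntry_comp R S p r]
    refine (Finset.sum_subtype (Finset.univ.filter fun q : Fin (N + 2) × Fin (M + 2) =>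
      (q.1 : ℕ) + q.2 = n) (by simp) (fun q =>
        (tensorEntry R S q r).comp (tensorEntry R S p q))).symm.trans ?_
    refine Finset.sum_subset (Finset.subset_univ _) fun q _ hq => ?_
    simp only [Finset.mem_filter, Finset.mem_univ, true_and] at hq
    rw [tensorEntry_eq_zero R S p q (by omega), Adj.comp_zero]
  · refine Finset.sum_eq_zero fun q _ => ?_
    rw [tensorEntry_eq_zero R S p q.1 (by rw [q.2]; exact h), Adj.comp_zero]

/-- The tensor product of two complexes: `E k = ⨁_{j + i = k} L j ⊗ K i` with differential
`∑ (R_j ⊗ 1 + (-1)^j ⊗ S_i)`. -/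
def HilbComplex.tensor (R : HilbComplex A L) (S : HilbComplex B K) :
    HilbComplex (MinTensor A B) (TensorModule A B L K) where
  d k l := Adj.matrix fun p q => tensorEntry R S p.1 q.1
  shape k l h := Adj.matrix_eq_zero fun p q =>
    tensorEntry_eq_zero R S p.1 q.1 (by rw [p.2, q.2]; exact h)
  d_comp_d i j k := (Adj.matrix_comp _ _).trans <| Adj.matrix_eq_zero fun p r =>
    sum_tensorEntry_comp_of_degree R S j p.1 r.1

/-- The operators `⨁_{j + i = k} P_j ⊗ 1 + (-1)^j C_j ⊗ Q_i`, where `C` is the defect of `P`. -/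
def HilbComplex.tensorParametrix (R : HilbComplex A L)
    (P : ∀ i j, Adj A (L i) (L j)) (Q : ∀ i j, Adj B (K i) (K j)) (k l : Fin (N + M + 1 + 2)) :
    Adj (MinTensor A B) (TensorModule A B L K k) (TensorModule A B L K l) :=
  Adj.matrix fun p q => (P p.1.1 q.1.1).tensor (Adj.one B K p.1.2 q.1.2) +
    (-1 : ℤ) ^ (p.1.1 : ℕ) • (Adj.diag (R.defect P P) p.1.1 q.1.1).tensor (Q p.1.2 q.1.2)

end Complexes

section Sharp

variable {A B : Type*} [NonUnitalCStarAlgebra A] [PartialOrder A] [StarOrderedRing A]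
  [NonUnitalCStarAlgebra B] [PartialOrder B] [StarOrderedRing B]
  {E E' F F' : Type*}
  [NormedAddCommGroup E] [NormedSpace ℂ E] [SMul Aᵐᵒᵖ E] [CStarModule Aᵐᵒᵖ E]
  [NormedAddCommGroup E'] [NormedSpace ℂ E'] [SMul Aᵐᵒᵖ E'] [CStarModule Aᵐᵒᵖ E']
  [NormedAddCommGroup F] [NormedSpace ℂ F] [SMul Bᵐᵒᵖ F] [CStarModule Bᵐᵒᵖ F]
  [NormedAddCommGroup F'] [NormedSpace ℂ F'] [SMul Bᵐᵒᵖ F'] [CStarModule Bᵐᵒᵖ F']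

/-- The sharp product `[[T ⊗ 1, -1 ⊗ S⋆], [1 ⊗ S, T⋆ ⊗ 1]]` of `T : E → E'` and `S : F → F'`, an
operator `(E ⊗ F) ⊕ (E' ⊗ F') → (E' ⊗ F) ⊕ (E ⊗ F')`. -/
def Adj.sharp (T : Adj A E E') (S : Adj B F F') :
    Adj (MinTensor A B) (OSum₂ (MinTensor A B) (ExtTensor A B E F) (ExtTensor A B E' F'))
      (OSum₂ (MinTensor A B) (ExtTensor A B E' F) (ExtTensor A B E F')) :=
  Adj.block (T.tensor (Adj.id B F)) (-(Adj.id A E').tensor S.adj)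
    ((Adj.id A E).tensor S) (T.adj.tensor (Adj.id B F'))

end Sharp

/-! ### The group `K₀` -/

section KTheory

/-- Idempotent matrices of all finite sizes over a ring. -/
abbrev Idem (R : Type*) [Ring R] : Type _ :=
  Σ n : ℕ, {p : Matrix (Fin n) (Fin n) R // p * p = p}

/-- The relations `[r] = [p] + [q]` whenever the idempotent `r` is (Murray-von Neumann) equivalent
to the block-diagonal idempotent `p ⊕ q`. -/
def K0Rel (R : Type*) [Ring R] : Set (FreeAbelianGroup (Idem R)) :=
  {z | ∃ r p q : Idem R,
    (∃ (x : Matrix (Fin r.1) (Fin p.1 ⊕ Fin q.1) R) (y : Matrix (Fin p.1 ⊕ Fin q.1) (Fin r.1) R),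
      x * y = r.2.1 ∧ y * x = Matrix.fromBlocks p.2.1 0 0 q.2.1) ∧
    z = FreeAbelianGroup.of r - FreeAbelianGroup.of p - FreeAbelianGroup.of q}

/-- The algebraic `K₀`-group of a unital ring: the Grothendieck group of the monoid of equivalence
classes of idempotent matrices. -/
abbrev K0Ring (R : Type*) [Ring R] : Type _ :=
  FreeAbelianGroup (Idem R) ⧸ AddSubgroup.closure (K0Rel R)

/-- The class of an idempotent matrix. -/
def K0Ring.mk {R : Type*} [Ring R] {n : ℕ} (p : Matrix (Fin n) (Fin n) R) (hp : p * p = p) :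
    K0Ring R :=
  QuotientAddGroup.mk (FreeAbelianGroup.of ⟨n, p, hp⟩)

/-- The class of the free module of rank `n`. -/
def K0Ring.free (R : Type*) [Ring R] (n : ℕ) : K0Ring R :=
  K0Ring.mk (1 : Matrix (Fin n) (Fin n) R) (one_mul 1)

/-- The image of an idempotent matrix under a ring homomorphism. -/
def Idem.map {R R' : Type*} [Ring R] [Ring R'] (f : R →+* R') (e : Idem R) : Idem R' :=
  ⟨e.1, f.mapMatrix e.2.1, by rw [← map_mul, e.2.2]⟩

/-- Functoriality of `K₀`. -/
def K0Ring.map {R R' : Type*} [Ring R] [Ring R'] (f : R →+* R') : K0Ring R →+ K0Ring R' :=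
  QuotientAddGroup.map _ _ (FreeAbelianGroup.map (Idem.map f)) <| by
    rw [AddSubgroup.closure_le]
    rintro _ ⟨r, p, q, ⟨x, y, hxy, hyx⟩, rfl⟩
    have h1 : x.map f * y.map f = r.2.1.map f := by rw [← Matrix.map_mul, hxy]
    have h2 : y.map f * x.map f = Matrix.fromBlocks (p.2.1.map f) 0 0 (q.2.1.map f) := by
      rw [← Matrix.map_mul, hyx, Matrix.fromBlocks_map, Matrix.map_zero _ (map_zero f),
        Matrix.map_zero _ (map_zero f)]
    exact AddSubgroup.subset_closure ⟨r.map f, p.map f, q.map f, ⟨x.map f, y.map f, h1, h2⟩,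
      by simp only [map_sub, FreeAbelianGroup.map_of_apply]⟩

/-- The `K₀`-group of a (not necessarily unital) C⋆-algebra `A`: the kernel of the map
`K₀(Ã) → K₀(ℂ)` induced by the augmentation of the unitization `Ã`. -/
abbrev K0 (A : Type*) [NonUnitalCStarAlgebra A] : Type _ :=
  (K0Ring.map (Unitization.fstHom ℂ A : Unitization ℂ A →+* ℂ)).ker

end KTheory

/-! ### The Fredholm index -/

section Index

variable {A : Type*} [NonUnitalCStarAlgebra A] [PartialOrder A] [StarOrderedRing A]
  {E F : Type*}
  [NormedAddCommGroup E] [NormedSpace ℂ E] [SMul Aᵐᵒᵖ E] [CStarModule Aᵐᵒᵖ E]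
  [NormedAddCommGroup F] [NormedSpace ℂ F] [SMul Aᵐᵒᵖ F] [CStarModule Aᵐᵒᵖ F]

/-- The right action `x c` of an element `c` of the unitization `Ã` on a Hilbert `A`-module. -/
def uact (x : E) (c : Unitization ℂ A) : E := c.fst • x + op c.snd • x

/-- The operator `E ⊕ Ãⁿ → F`, `(e, a) ↦ T e + ∑ x_i a_i`. -/
def stabilize (T : Adj A E F) {n : ℕ} (x : Fin n → F) (v : E × (Fin n → Unitization ℂ A)) : F :=
  T v.1 + ∑ i, uact (x i) (v.2 i)

/-- `HasIndex T κ` says that `κ = [ker Φ] - [Ãⁿ]` for some surjection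
`Φ : E ⊕ Ãⁿ → F`, `(e, a) ↦ T e + ∑ x_i a_i`, whose kernel is finitely generated and projective over
`Ã`; the latter is witnessed by an idempotent matrix `p` over `Ã` and a right `Ã`-linear map `φ` from
`Ãᵐ` onto `ker Φ` with the same kernel as `p`, so that `ker Φ` is isomorphic to `p Ãᵐ`. -/
def HasIndex (T : Adj A E F) (κ : K0 A) : Prop :=
  ∃ (n : ℕ) (x : Fin n → F), Function.Surjective (stabilize T x) ∧
    ∃ (m : ℕ) (p : Matrix (Fin m) (Fin m) (Unitization ℂ A)) (hp : p * p = p)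
      (φ : (Fin m → Unitization ℂ A) →+ E × (Fin n → Unitization ℂ A)),
      (∀ v c, φ (fun i => v i * c) = (uact (φ v).1 c, fun i => (φ v).2 i * c)) ∧
      Set.range φ = {w | stabilize T x w = 0} ∧
      (∀ v, φ v = 0 ↔ p.mulVec v = 0) ∧
      (κ : K0Ring (Unitization ℂ A)) = K0Ring.mk p hp - K0Ring.free (Unitization ℂ A) n

open scoped Classical in
/-- The Fredholm index in `K₀(A)` of an adjointable operator between Hilbert `A`-modules. If `T` is
`A`-Fredholm, there is exactly one `κ` with `HasIndex T κ`: after adding to `T` finitely many columns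
`x_i`, it becomes surjective with finitely generated projective kernel, and the class
`[ker Φ] - [Ãⁿ]` does not depend on the choice of the `x_i`. If `T` has closed range, it equals
`[ker T] - [ker T⋆]`. -/
def fredholmIndex (T : Adj A E F) : K0 A :=
  if h : ∃ κ, HasIndex T κ then h.choose else 0

/-- The Fredholm index of a complex is the index of its even Dirac operator. -/
def HilbComplex.index {N : ℕ} {L : Fin (N + 2) → Type*} [∀ i, NormedAddCommGroup (L i)]
    [∀ i, NormedSpace ℂ (L i)] [∀ i, SMul Aᵐᵒᵖ (L i)] [∀ i, CStarModule Aᵐᵒᵖ (L i)]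
    (R : HilbComplex A L) : K0 A :=
  fredholmIndex R.evenDirac

end Index

end

end HilbMod

open HilbMod

/-! The computations run over operator matrices indexed by bidegrees `(j, i)`; analysis enters only
through compactness and one positivity argument.

Parametrix of the tensor product. Write `C` and `C'` for the defects of `P` and `Q`. Because `d² =
0`, the defect `C` commutes with the differential of `R`. In `P_T T + T P_T` the mixed terms `P ⊗ S`
and `R C ⊗ Q` each occur twice, and since `P` and `R` shift the first degree by one, the two signs
are opposite. What survives is `(1 - C) ⊗ 1 + C ⊗ (1 - C') = 1 - C ⊗ C'` (`sum_parametrixEntry`).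
This defect is compact because rank-one operators tensor to rank-one operators and `‖T ⊗ S‖ ≤ ‖T‖
‖S‖` (`Adj.IsCompact.tensor`). Fredholmness supplies only a joint parametrix `(Pl, Pr)`, but then
`Pl d Pr` is a parametrix (`one_sub_mul_mul`).

Fredholm Dirac operators. On the sum of all modules, `D² = d d⋆ + d⋆ d`. The operator `e = d p` is
idempotent modulo compacts, and idempotents satisfy `e e⋆ + (1 - e)⋆ (1 - e) = 1 + (e - e⋆)⋆ (e -
e⋆) ≥ 1`. The left side is dominated by a multiple of the Laplacian, so that multiple is at least
`1` up to a compact term, and the Laplacian is invertible modulo compacts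
(`Adj.exists_laplacian_parametrix`). This takes place in the C⋆-algebra of adjointable operators on
a complete module. Compressing to even and odd parts gives `IsFredholm.evenDirac`.

The unitaries. The domain of the sharp product and the even part of the tensor complex have the same
coordinates `L j ⊗ K i`, `j + i` even, and likewise for the odd parts. Two families of coordinate
maps that resolve the identity and have the same Gram matrix define a unitary
(`Adj.isUnitary_glue`), and it intertwines operators with the same matrix entries
(`Adj.glue_comp_comp_glue`). The sign `(-1)^j` is already the minus sign in the corner of the sharp
product, so the unitaries merely regroup summands.

The index. A unitary equivalence carries each witness of `HasIndex` to a witness with the same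
class, so the two predicates coincide and so do the values chosen from them
(`fredholmIndex_unitary`). Uniqueness of the index plays no role. -/

namespace HilbMod

noncomputable section

namespace Adj

/-! ### Algebra and norms of adjointable operators -/

section Basic

variable {A : Type*} [NonUnitalCStarAlgebra A] [PartialOrder A] [StarOrderedRing A]
  {E F G H : Type*}
  [NormedAddCommGroup E] [NormedSpace ℂ E] [SMul Aᵐᵒᵖ E] [CStarModule Aᵐᵒᵖ E]
  [NormedAddCommGroup F] [NormedSpace ℂ F] [SMul Aᵐᵒᵖ F] [CStarModule Aᵐᵒᵖ F]
  [NormedAddCommGroup G] [NormedSpace ℂ G] [SMul Aᵐᵒᵖ G] [CStarModule Aᵐᵒᵖ G]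
  [NormedAddCommGroup H] [NormedSpace ℂ H] [SMul Aᵐᵒᵖ H] [CStarModule Aᵐᵒᵖ H]

@[simp] lemma add_apply (S T : Adj A E F) (x : E) : (S + T) x = S x + T x := rfl
@[simp] lemma zero_apply (x : E) : (0 : Adj A E F) x = 0 := rfl

@[simp] lemma adj_adj (T : Adj A E F) : T.adj.adj = T := rfl
@[simp] lemma adj_comp (S : Adj A F G) (T : Adj A E F) : (S.comp T).adj = T.adj.comp S.adj := rfl
@[simp] lemma adj_add (S T : Adj A E F) : (S + T).adj = S.adj + T.adj := rfl
@[simp] lemma adj_sub (S T : Adj A E F) : (S - T).adj = S.adj - T.adj := rfl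
@[simp] lemma adj_zero : (0 : Adj A E F).adj = 0 := rfl
@[simp] lemma adj_zsmul (n : ℤ) (T : Adj A E F) : (n • T).adj = n • T.adj := rfl

lemma adj_sum {ι : Type*} (s : Finset ι) (T : ι → Adj A E F) :
    (∑ i ∈ s, T i).adj = ∑ i ∈ s, (T i).adj :=
  map_sum (AddMonoidHom.mk' (fun T : Adj A E F => T.adj) fun _ _ => rfl) T s

lemma comp_assoc (R : Adj A G H) (S : Adj A F G) (T : Adj A E F) :
    (R.comp S).comp T = R.comp (S.comp T) := rfl

lemma comp_sub (S : Adj A F G) (T T' : Adj A E F) : S.comp (T - T') = S.comp T - S.comp T' :=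
  Adj.ext fun _ => map_sub S.toCLM _ _

lemma sub_comp (S S' : Adj A F G) (T : Adj A E F) : (S - S').comp T = S.comp T - S'.comp T :=
  Adj.ext fun _ => rfl

lemma comp_neg (S : Adj A F G) (T : Adj A E F) : S.comp (-T) = -S.comp T :=
  Adj.ext fun _ => map_neg S.toCLM _

lemma neg_comp (S : Adj A F G) (T : Adj A E F) : (-S).comp T = -S.comp T :=
  Adj.ext fun _ => rfl

lemma comp_sum {ι : Type*} (s : Finset ι) (S : Adj A F G) (T : ι → Adj A E F) :
    S.comp (∑ i ∈ s, T i) = ∑ i ∈ s, S.comp (T i) :=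
  map_sum (AddMonoidHom.mk' (fun T : Adj A E F => S.comp T) fun _ _ => comp_add _ _ _) T s

lemma sum_comp {ι : Type*} (s : Finset ι) (S : ι → Adj A F G) (T : Adj A E F) :
    (∑ i ∈ s, S i).comp T = ∑ i ∈ s, (S i).comp T :=
  map_sum (AddMonoidHom.mk' (fun S : Adj A F G => S.comp T) fun _ _ => add_comp _ _ _) S s

/-- Cauchy–Schwarz applied to `‖T⋆ y‖² = ‖⟨y, T T⋆ y⟩‖`, then division by `‖T⋆ y‖`. Applied to `T`
and `T⋆` it makes the adjoint isometric. -/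
lemma norm_adj_toCLM_le (T : Adj A E F) : ‖T.adj.toCLM‖ ≤ ‖T.toCLM‖ := by
  refine ContinuousLinearMap.opNorm_le_bound _ (norm_nonneg _) fun y => ?_
  rcases (norm_nonneg (T.adj y)).eq_or_lt with h | h
  · change ‖T.adj y‖ ≤ _
    rw [← h]
    positivity
  refine le_of_mul_le_mul_right ?_ h
  change ‖T.adj y‖ * ‖T.adj y‖ ≤ _
  rw [← sq, CStarModule.norm_sq_eq Aᵐᵒᵖ, T.adj.inner_adj]
  calc _ ≤ ‖y‖ * ‖T (T.adj y)‖ := CStarModule.norm_inner_le (A := Aᵐᵒᵖ) F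
    _ ≤ ‖y‖ * (‖T.toCLM‖ * ‖T.adj y‖) := by gcongr; exact T.toCLM.le_opNorm _
    _ = _ := by ring

lemma norm_adj_toCLM (T : Adj A E F) : ‖T.adj.toCLM‖ = ‖T.toCLM‖ :=
  le_antisymm T.norm_adj_toCLM_le T.adj.norm_adj_toCLM_le

/-- Cauchy–Schwarz for `‖T x‖² = ‖⟨x, T⋆ T x⟩‖`. This is the C⋆-inequality behind `instCStarRing`.
-/
lemma norm_toCLM_sq_le (T : Adj A E F) : ‖T.toCLM‖ * ‖T.toCLM‖ ≤ ‖(T.adj.comp T).toCLM‖ := by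
  rw [← sq]
  refine (Real.le_sqrt (norm_nonneg _) (norm_nonneg _)).1 ?_
  refine ContinuousLinearMap.opNorm_le_bound _ (Real.sqrt_nonneg _) fun x => ?_
  refine (sq_le_sq₀ (norm_nonneg _) (by positivity)).1 ?_
  rw [mul_pow, Real.sq_sqrt (norm_nonneg _), CStarModule.norm_sq_eq Aᵐᵒᵖ, T.inner_adj]
  calc _ ≤ ‖x‖ * ‖(T.adj.comp T).toCLM x‖ := CStarModule.norm_inner_le (A := Aᵐᵒᵖ) E
    _ ≤ ‖x‖ * (‖(T.adj.comp T).toCLM‖ * ‖x‖) := by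
        gcongr; exact (T.adj.comp T).toCLM.le_opNorm _
    _ = _ := by ring

instance instSMulComplex : SMul ℂ (Adj A E F) :=
  ⟨fun c T => ⟨c • T.toCLM, star c • T.adjCLM, by simp [T.inner_adj]⟩⟩

lemma adj_smul (c : ℂ) (T : Adj A E F) : (c • T).adj = star c • T.adj :=
  Adj.ext fun _ => rfl

instance instModuleComplex : Module ℂ (Adj A E F) :=
  Function.Injective.module ℂ (AddMonoidHom.mk' (toCLM : Adj A E F → E →L[ℂ] F) fun _ _ => rfl)
    toCLM_injective fun _ _ => rfl

variable (A E F) in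
/-- The linear inclusion of the adjointable operators in the bounded operators. -/
def toCLMₗ : Adj A E F →ₗ[ℂ] E →L[ℂ] F where
  toFun := toCLM
  map_add' _ _ := rfl
  map_smul' _ _ := rfl

/-! #### Compact operators -/

/-- The rank-one operator `z ↦ x ⟨y, z⟩`. -/
def rankOne (x : F) (y : E) : Adj A E F := (ket x).comp (ket y).adj

variable (A E F) in
/-- The finite-rank operators. -/
def finiteRank : Submodule ℂ (Adj A E F) :=
  Submodule.span ℂ (Set.range fun p : F × E => rankOne (A := A) p.1 p.2)

variable (A E F) in
/-- The closed subspace of bounded operators in which the compact operators lie. -/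
def compactCLM : Submodule ℂ (E →L[ℂ] F) :=
  (Submodule.span ℂ
    {S : E →L[ℂ] F | ∃ (x : F) (y : E), ∀ z, S z = op (ip A y z) • x}).topologicalClosure

lemma isCompact_iff (T : Adj A E F) : T.IsCompact ↔ T.toCLM ∈ compactCLM A E F := Iff.rfl

/-- Rank-one operators are adjointable, so the span in the definition of compactness is the image of
`finiteRank`. Approximants can therefore be taken adjointable, which is needed to form their
adjoints and tensor products. -/
lemma isCompact_iff_approx (T : Adj A E F) :
    T.IsCompact ↔ ∀ ε > 0, ∃ S ∈ finiteRank A E F, ‖(T - S).toCLM‖ < ε := by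
  have h : Submodule.span ℂ {S : E →L[ℂ] F | ∃ (x : F) (y : E), ∀ z, S z = op (ip A y z) • x} =
      (finiteRank A E F).map (toCLMₗ A E F) := by
    rw [finiteRank, Submodule.map_span, ← Set.range_comp]
    congr 1
    ext S
    constructor
    · rintro ⟨x, y, hS⟩
      exact ⟨(x, y), ContinuousLinearMap.ext fun z => (hS z).symm⟩
    · rintro ⟨p, rfl⟩
      exact ⟨p.1, p.2, fun z => rfl⟩
  rw [isCompact_iff, compactCLM, h, ← SetLike.mem_coe, Submodule.topologicalClosure_coe,
    Metric.mem_closure_iff]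
  refine forall₂_congr fun ε _ => ?_
  constructor
  · rintro ⟨_, ⟨S, hS, rfl⟩, hd⟩
    exact ⟨S, hS, by rwa [dist_eq_norm] at hd⟩
  · rintro ⟨S, hS, hd⟩
    exact ⟨_, ⟨S, hS, rfl⟩, by rw [dist_eq_norm]; exact hd⟩

lemma isCompact_zero : (0 : Adj A E F).IsCompact := (compactCLM A E F).zero_mem

lemma IsCompact.add {S T : Adj A E F} (hS : S.IsCompact) (hT : T.IsCompact) :
    (S + T).IsCompact := (compactCLM A E F).add_mem hS hT

lemma IsCompact.neg {T : Adj A E F} (hT : T.IsCompact) : (-T).IsCompact :=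
  (compactCLM A E F).neg_mem hT

lemma IsCompact.sub {S T : Adj A E F} (hS : S.IsCompact) (hT : T.IsCompact) :
    (S - T).IsCompact := (compactCLM A E F).sub_mem hS hT

lemma IsCompact.smul {T : Adj A E F} (c : ℂ) (hT : T.IsCompact) : (c • T).IsCompact :=
  (compactCLM A E F).smul_mem c hT

lemma IsCompact.sum {ι : Type*} {s : Finset ι} {T : ι → Adj A E F}
    (h : ∀ i ∈ s, (T i).IsCompact) : (∑ i ∈ s, T i).IsCompact :=
  Finset.sum_induction T IsCompact (fun _ _ => IsCompact.add) isCompact_zero h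

/-- On generators `S θ_{x,y} = θ_{S x, y}` because `S` is `A`-linear; continuity does the rest. -/
lemma IsCompact.comp_left {T : Adj A E F} (hT : T.IsCompact) (S : Adj A F G) :
    (S.comp T).IsCompact := by
  refine map_mem_of_closure_span (ContinuousLinearMap.compL ℂ E F G S.toCLM).toLinearMap
    (ContinuousLinearMap.continuous _) (Submodule.isClosed_topologicalClosure _) ?_ hT
  rintro R ⟨x, y, hR⟩
  refine Submodule.le_topologicalClosure _ (Submodule.subset_span ⟨S x, y, fun z => ?_⟩)
  change S (R z) = _
  rw [hR, map_act]

/-- On generators `θ_{x,y} S = θ_{x, S⋆ y}`. -/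
lemma IsCompact.comp_right {T : Adj A F G} (hT : T.IsCompact) (S : Adj A E F) :
    (T.comp S).IsCompact := by
  refine map_mem_of_closure_span
    ((ContinuousLinearMap.compL ℂ E F G).flip S.toCLM).toLinearMap
    (ContinuousLinearMap.continuous _) (Submodule.isClosed_topologicalClosure _) ?_ hT
  rintro R ⟨x, y, hR⟩
  refine Submodule.le_topologicalClosure _ (Submodule.subset_span ⟨x, S.adj y, fun z => ?_⟩)
  change R (S z) = _
  rw [hR]
  congr 2
  exact (ip_adj S.adj y z).symm

lemma adj_mem_finiteRank {S : Adj A E F} (hS : S ∈ finiteRank A E F) :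
    S.adj ∈ finiteRank A F E := by
  induction hS using Submodule.span_induction with
  | mem S h =>
    obtain ⟨p, rfl⟩ := h
    exact Submodule.subset_span ⟨(p.2, p.1), rfl⟩
  | zero => exact Submodule.zero_mem _
  | add S S' _ _ h h' => exact Submodule.add_mem _ h h'
  | smul c S _ h => rw [adj_smul]; exact Submodule.smul_mem _ _ h

/-- The adjoint is isometric and exchanges `θ_{x,y}` with `θ_{y,x}`, so it carries finite-rank
approximations to finite-rank approximations. -/
lemma IsCompact.adj {T : Adj A E F} (hT : T.IsCompact) : T.adj.IsCompact := by
  rw [isCompact_iff_approx] at hT ⊢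
  intro ε hε
  obtain ⟨S, hS, hd⟩ := hT ε hε
  exact ⟨S.adj, adj_mem_finiteRank hS, by rwa [← adj_sub, norm_adj_toCLM]⟩

/-! #### Unitaries and Fredholm operators -/

lemma IsUnitary.adj {U : Adj A E F} (h : U.IsUnitary) : U.adj.IsUnitary := ⟨h.2, h.1⟩

/-- Modulo the compacts, a left inverse `P` and a right inverse `Q` agree: `P ≡ P T Q ≡ Q`. Hence
`P` alone works on both sides. -/
lemma isFredholm_of_left_right {T : Adj A E F} {P Q : Adj A F E}
    (hP : (Adj.id A E - P.comp T).IsCompact) (hQ : (Adj.id A F - T.comp Q).IsCompact) :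
    T.IsFredholm := by
  refine ⟨P, hP, ?_⟩
  have h : Adj.id A F - T.comp P = (Adj.id A F - T.comp Q) +
      (T.comp ((Adj.id A E - P.comp T).comp Q) - T.comp (P.comp (Adj.id A F - T.comp Q))) := by
    simp only [comp_sub, sub_comp, comp_id, id_comp, comp_assoc]
    abel
  rw [h]
  exact hQ.add (((hP.comp_right Q).comp_left T).sub ((hQ.comp_left P).comp_left T))

/-- The parametrix is conjugated along with the operator: `U⋆ P V`. -/
lemma IsFredholm.of_unitary {T : Adj A E F} {U : Adj A G E} {V : Adj A H F}
    (hT : T.IsFredholm) (hU : U.IsUnitary) (hV : V.IsUnitary) :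
    (V.adj.comp (T.comp U)).IsFredholm := by
  obtain ⟨P, h1, h2⟩ := hT
  refine ⟨U.adj.comp (P.comp V), ?_, ?_⟩
  · have h : Adj.id A G - (U.adj.comp (P.comp V)).comp (V.adj.comp (T.comp U)) =
        U.adj.comp ((Adj.id A E - P.comp T).comp U) := by
      have h3 : (U.adj.comp (P.comp V)).comp (V.adj.comp (T.comp U)) =
        U.adj.comp (P.comp ((V.comp V.adj).comp (T.comp U))) := rfl
      rw [h3, hV.2, id_comp, sub_comp, comp_sub, id_comp, hU.1]
      rfl
    rw [h]
    exact (h1.comp_right U).comp_left _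
  · have h : Adj.id A H - (V.adj.comp (T.comp U)).comp (U.adj.comp (P.comp V)) =
        V.adj.comp ((Adj.id A F - T.comp P).comp V) := by
      have h3 : (V.adj.comp (T.comp U)).comp (U.adj.comp (P.comp V)) =
        V.adj.comp (T.comp ((U.comp U.adj).comp (P.comp V))) := rfl
      rw [h3, hU.2, id_comp, sub_comp, comp_sub, id_comp, hV.1]
      rfl
    rw [h]
    exact (h2.comp_right V).comp_left _

end Basic

end Adj

/-! ### Additivity of tensor products and tensor products of compact operators -/

section Tensor

variable {A B : Type*} [NonUnitalCStarAlgebra A] [PartialOrder A] [StarOrderedRing A]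
  [NonUnitalCStarAlgebra B] [PartialOrder B] [StarOrderedRing B]
  {E E' F F' : Type*}
  [NormedAddCommGroup E] [NormedSpace ℂ E] [SMul Aᵐᵒᵖ E] [CStarModule Aᵐᵒᵖ E]
  [NormedAddCommGroup E'] [NormedSpace ℂ E'] [SMul Aᵐᵒᵖ E'] [CStarModule Aᵐᵒᵖ E']
  [NormedAddCommGroup F] [NormedSpace ℂ F] [SMul Bᵐᵒᵖ F] [CStarModule Bᵐᵒᵖ F]
  [NormedAddCommGroup F'] [NormedSpace ℂ F'] [SMul Bᵐᵒᵖ F'] [CStarModule Bᵐᵒᵖ F']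

lemma loc_ext {f g : Loc A E →L[ℂ] Loc A E'} (h : ∀ u : PreLoc A E, f u = g u) : f = g := by
  ext u
  induction u using UniformSpace.Completion.induction_on with
  | hp => exact isClosed_eq f.continuous g.continuous
  | ih u => exact h u

lemma loc_add (S T : Adj A E E') : loc (S + T) = loc S + loc T :=
  loc_ext fun u => by
    have h : PreLoc.map (S + T) u = PreLoc.map S u + PreLoc.map T u := by
      apply PreLoc.equiv.injective
      ext f
      simp [PreLoc.equiv_map]
    rw [_root_.add_apply, loc_coe, loc_coe, loc_coe, h,
      UniformSpace.Completion.coe_add]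

lemma loc_smul (c : ℂ) (T : Adj A E E') : loc (c • T) = c • loc T :=
  loc_ext fun u => by
    have h : PreLoc.map (c • T) u = c • PreLoc.map T u := by
      apply PreLoc.equiv.injective
      ext f
      rw [PreLoc.equiv_map, map_smul, Finsupp.smul_apply, PreLoc.equiv_map]
      rfl
    rw [_root_.smul_apply, loc_coe, loc_coe, h, UniformSpace.Completion.coe_smul]

lemma loc_id : loc (Adj.id A E) = .id ℂ _ :=
  loc_ext fun u => by
    have h : PreLoc.map (Adj.id A E) u = u := by
      apply PreLoc.equiv.injective
      ext f
      rw [PreLoc.equiv_map]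
      rfl
    rw [loc_coe, h]
    rfl

/-- The bound `√‖T⋆ T‖` is available from `PreLoc.norm_map_le`, and `‖T⋆ T‖ ≤ ‖T‖²`. -/
lemma norm_loc_le (T : Adj A E E') : ‖loc T‖ ≤ ‖T.toCLM‖ := by
  refine ContinuousLinearMap.opNorm_le_bound _ (norm_nonneg _) fun u => ?_
  induction u using UniformSpace.Completion.induction_on with
  | hp => exact isClosed_le (by fun_prop) (by fun_prop)
  | ih u =>
    rw [loc_coe, UniformSpace.Completion.norm_coe, UniformSpace.Completion.norm_coe]
    refine (PreLoc.norm_map_le T u).trans (mul_le_mul_of_nonneg_right ?_ (norm_nonneg _))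
    refine Real.sqrt_le_iff.2 ⟨norm_nonneg _, (ContinuousLinearMap.opNorm_comp_le _ _).trans ?_⟩
    rw [sq]
    exact mul_le_mul_of_nonneg_right T.norm_adj_toCLM_le (norm_nonneg _)

lemma rep_ext {T : Adj A E E'} {S : Adj B F F'} {f : TLoc A B E F →L[ℂ] TLoc A B E' F'}
    (h : ∀ w, TLoc.mk (TensorProduct.mapL (loc T) (loc S) w) = f (TLoc.mk w)) : rep T S = f :=
  TLoc.ext fun w => (rep_mk T S w).trans (h w)

lemma TLoc.mk_add (v w : Loc A E ⊗[ℂ] Loc B F) :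
    TLoc.mk (v + w) = TLoc.mk v + TLoc.mk w := UniformSpace.Completion.coe_add v w

lemma TLoc.mk_smul (c : ℂ) (w : Loc A E ⊗[ℂ] Loc B F) :
    TLoc.mk (c • w) = c • TLoc.mk w := UniformSpace.Completion.coe_smul c w

lemma TLoc.norm_mk (w : Loc A E ⊗[ℂ] Loc B F) : ‖TLoc.mk w‖ = ‖w‖ :=
  UniformSpace.Completion.norm_coe w

lemma rep_add_left (T T' : Adj A E E') (S : Adj B F F') :
    rep (T + T') S = rep T S + rep T' S :=
  rep_ext fun w => by
    rw [loc_add, TensorProduct.mapL_add_left, _root_.add_apply,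
      _root_.add_apply, rep_mk, rep_mk, TLoc.mk_add]

lemma rep_add_right (T : Adj A E E') (S S' : Adj B F F') :
    rep T (S + S') = rep T S + rep T S' :=
  rep_ext fun w => by
    rw [loc_add, TensorProduct.mapL_add_right, _root_.add_apply,
      _root_.add_apply, rep_mk, rep_mk, TLoc.mk_add]

lemma rep_smul_left (c : ℂ) (T : Adj A E E') (S : Adj B F F') :
    rep (c • T) S = c • rep T S :=
  rep_ext fun w => by
    rw [loc_smul, TensorProduct.mapL_smul_left, _root_.smul_apply,
      _root_.smul_apply, rep_mk, TLoc.mk_smul]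

lemma rep_smul_right (c : ℂ) (T : Adj A E E') (S : Adj B F F') :
    rep T (c • S) = c • rep T S :=
  rep_ext fun w => by
    rw [loc_smul, TensorProduct.mapL_smul_right, _root_.smul_apply,
      _root_.smul_apply, rep_mk, TLoc.mk_smul]

lemma rep_id : rep (Adj.id A E) (Adj.id B F) = .id ℂ _ :=
  rep_ext fun w => by rw [loc_id, loc_id, TensorProduct.mapL_id_id]; rfl

/-- Inherited from the bound for tensor products of Hilbert-space operators. It makes `T ⊗ S` norm
continuous in each variable, so compactness can be checked by approximation. -/
lemma norm_rep_le (T : Adj A E E') (S : Adj B F F') :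
    ‖rep T S‖ ≤ ‖T.toCLM‖ * ‖S.toCLM‖ := by
  refine ContinuousLinearMap.opNorm_le_bound _ (by positivity) fun u => ?_
  induction u using UniformSpace.Completion.induction_on with
  | hp => exact isClosed_le (rep T S).continuous.norm (continuous_const.mul continuous_norm)
  | ih w =>
    change ‖rep T S (TLoc.mk w)‖ ≤ _ * ‖TLoc.mk w‖
    rw [rep_mk, TLoc.norm_mk, TLoc.norm_mk]
    refine (ContinuousLinearMap.le_opNorm _ _).trans (mul_le_mul_of_nonneg_right ?_ (norm_nonneg _))
    exact (TensorProduct.norm_mapL_le _ _).trans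
      (mul_le_mul (norm_loc_le T) (norm_loc_le S) (norm_nonneg _) (norm_nonneg _))

namespace Adj

lemma tensor_ext {T : Adj A E E'} {S : Adj B F F'}
    {f : Adj (MinTensor A B) (ExtTensor A B E F) (ExtTensor A B E' F')}
    (h : ∀ z : ExtTensor A B E F, rep T S ∘L z.toCLM = (f z).toCLM) : T.tensor S = f :=
  Adj.ext fun z => ExtTensor.ext (h z)

lemma add_tensor (T T' : Adj A E E') (S : Adj B F F') :
    (T + T').tensor S = T.tensor S + T'.tensor S :=
  tensor_ext fun z => by rw [rep_add_left, ContinuousLinearMap.add_comp]; rfl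

lemma tensor_add (T : Adj A E E') (S S' : Adj B F F') :
    T.tensor (S + S') = T.tensor S + T.tensor S' :=
  tensor_ext fun z => by rw [rep_add_right, ContinuousLinearMap.add_comp]; rfl

lemma smul_tensor (c : ℂ) (T : Adj A E E') (S : Adj B F F') :
    (c • T).tensor S = c • T.tensor S :=
  tensor_ext fun z => by rw [rep_smul_left, ContinuousLinearMap.smul_comp]; rfl

lemma tensor_smul (c : ℂ) (T : Adj A E E') (S : Adj B F F') :
    T.tensor (c • S) = c • T.tensor S :=
  tensor_ext fun z => by rw [rep_smul_right, ContinuousLinearMap.smul_comp]; rfl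

lemma id_tensor_id : (Adj.id A E).tensor (Adj.id B F) = Adj.id _ _ :=
  tensor_ext fun z => by rw [rep_id]; rfl

/-- The tensor product as an additive map in the first argument. -/
def tensorLeft (S : Adj B F F') :
    Adj A E E' →+ Adj (MinTensor A B) (ExtTensor A B E F) (ExtTensor A B E' F') :=
  AddMonoidHom.mk' (fun T => T.tensor S) fun T T' => add_tensor T T' S

/-- The tensor product as an additive map in the second argument. -/
def tensorRight (T : Adj A E E') :
    Adj B F F' →+ Adj (MinTensor A B) (ExtTensor A B E F) (ExtTensor A B E' F') :=
  AddMonoidHom.mk' (fun S => T.tensor S) fun S S' => tensor_add T S S'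

lemma sub_tensor (T T' : Adj A E E') (S : Adj B F F') :
    (T - T').tensor S = T.tensor S - T'.tensor S := map_sub (tensorLeft S) T T'

lemma tensor_sub (T : Adj A E E') (S S' : Adj B F F') :
    T.tensor (S - S') = T.tensor S - T.tensor S' := map_sub (tensorRight T) S S'

lemma zsmul_tensor (n : ℤ) (T : Adj A E E') (S : Adj B F F') :
    (n • T).tensor S = n • T.tensor S := map_zsmul (tensorLeft S) n T

lemma sum_tensor {ι : Type*} (s : Finset ι) (T : ι → Adj A E E') (S : Adj B F F') :
    (∑ i ∈ s, T i).tensor S = ∑ i ∈ s, (T i).tensor S := map_sum (tensorLeft S) T s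

lemma tensor_sum {ι : Type*} (s : Finset ι) (T : Adj A E E') (S : ι → Adj B F F') :
    T.tensor (∑ i ∈ s, S i) = ∑ i ∈ s, T.tensor (S i) := map_sum (tensorRight T) S s

lemma norm_tensor_le (T : Adj A E E') (S : Adj B F F') :
    ‖(T.tensor S).toCLM‖ ≤ ‖T.toCLM‖ * ‖S.toCLM‖ :=
  ContinuousLinearMap.opNorm_le_bound _ (by positivity) fun z =>
    (ContinuousLinearMap.opNorm_comp_le (rep T S) z.toCLM).trans
      (mul_le_mul_of_nonneg_right (norm_rep_le T S) (norm_nonneg _))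

/-- Each rank-one operator is a ket times the adjoint of a ket, and `rep` respects composition and
adjoints. -/
lemma rankOne_tensor_rankOne (x : E') (y : E) (x' : F') (y' : F) :
    (rankOne (A := A) x y).tensor (rankOne (A := B) x' y') =
      rankOne (ExtTensor.tmul A B x x') (ExtTensor.tmul A B y y') :=
  tensor_ext fun z => by
    change rep ((ket x).comp (ket y).adj) ((ket x').comp (ket y').adj) ∘L z.toCLM =
      gen x x' ∘L ((gen y y').adjoint ∘L z.toCLM)
    rw [rep_comp, gen, gen, ← rep_adj]
    rfl

lemma isCompact_rankOne (x : E') (y : E) : (rankOne (A := A) x y).IsCompact :=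
  Submodule.le_topologicalClosure _ (Submodule.subset_span ⟨x, y, fun _ => rfl⟩)

lemma isCompact_of_approx {T : Adj A E E'}
    (h : ∀ ε > 0, ∃ S : Adj A E E', S.IsCompact ∧ ‖(T - S).toCLM‖ < ε) : T.IsCompact := by
  refine (Submodule.isClosed_topologicalClosure _).closure_subset (Metric.mem_closure_iff.2 ?_)
  intro ε hε
  obtain ⟨S, hS, hd⟩ := h ε hε
  exact ⟨S.toCLM, hS, by rw [dist_eq_norm]; exact hd⟩

/-- The tensor product of compact operators is compact. -/
lemma IsCompact.tensor {T : Adj A E E'} {S : Adj B F F'} (hT : T.IsCompact) (hS : S.IsCompact) :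
    (T.tensor S).IsCompact := by
  -- By bilinearity this reduces to rank-one factors. Afterwards the factors are approximated one at
  -- a time, first `T` and then `S`.
  have h1 : ∀ T ∈ finiteRank A E E', ∀ S ∈ finiteRank B F F', (T.tensor S).IsCompact := by
    intro T hT S hS
    induction hT using Submodule.span_induction with
    | mem T h =>
      obtain ⟨p, rfl⟩ := h
      induction hS using Submodule.span_induction with
      | mem S h =>
        obtain ⟨q, rfl⟩ := h
        simp only [rankOne_tensor_rankOne]
        exact isCompact_rankOne _ _
      | zero => rw [tensor_zero]; exact isCompact_zero
      | add S S' _ _ h h' => rw [tensor_add]; exact h.add h'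
      | smul c S _ h => rw [tensor_smul]; exact h.smul c
    | zero => rw [zero_tensor]; exact isCompact_zero
    | add S S' _ _ h h' => rw [add_tensor]; exact h.add h'
    | smul c S _ h => rw [smul_tensor]; exact h.smul c
  have h2 : ∀ T : Adj A E E', T.IsCompact → ∀ S ∈ finiteRank B F F', (T.tensor S).IsCompact := by
    intro T hT S hS
    refine isCompact_of_approx fun ε hε => ?_
    -- The added `1` keeps the denominator positive when `S = 0`.
    obtain ⟨T', hT', hd⟩ := (isCompact_iff_approx T).1 hT (ε / (‖S.toCLM‖ + 1)) (by positivity)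
    refine ⟨T'.tensor S, h1 T' hT' S hS, ?_⟩
    rw [← sub_tensor]
    refine (norm_tensor_le _ _).trans_lt ?_
    rw [lt_div_iff₀ (by positivity)] at hd
    refine lt_of_le_of_lt ?_ hd
    gcongr
    linarith
  refine isCompact_of_approx fun ε hε => ?_
  obtain ⟨S', hS', hd⟩ := (isCompact_iff_approx S).1 hS (ε / (‖T.toCLM‖ + 1)) (by positivity)
  refine ⟨T.tensor S', h2 T hT S' hS', ?_⟩
  rw [← tensor_sub]
  refine (norm_tensor_le _ _).trans_lt ?_
  rw [lt_div_iff₀ (by positivity), mul_comm] at hd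
  refine lt_of_le_of_lt ?_ hd
  gcongr
  linarith

end Adj

end Tensor

/-! ### Orthogonal sums -/

namespace Adj

section Sums

variable {A : Type*} [NonUnitalCStarAlgebra A] [PartialOrder A] [StarOrderedRing A]
  {ι κ : Type*} [Fintype ι] [Fintype κ] [DecidableEq ι] [DecidableEq κ]
  {E : ι → Type*} {F : κ → Type*}
  [∀ i, NormedAddCommGroup (E i)] [∀ i, NormedSpace ℂ (E i)] [∀ i, SMul Aᵐᵒᵖ (E i)]
  [∀ i, CStarModule Aᵐᵒᵖ (E i)]
  [∀ i, NormedAddCommGroup (F i)] [∀ i, NormedSpace ℂ (F i)] [∀ i, SMul Aᵐᵒᵖ (F i)]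
  [∀ i, CStarModule Aᵐᵒᵖ (F i)]

lemma diag_self {L : ι → Type*} [∀ i, NormedAddCommGroup (L i)]
    [∀ i, NormedSpace ℂ (L i)] [∀ i, SMul Aᵐᵒᵖ (L i)] [∀ i, CStarModule Aᵐᵒᵖ (L i)]
    (T : ∀ i, Adj A (L i) (L i)) (i : ι) : Adj.diag T i i = T i := by simp [Adj.diag]

lemma diag_of_ne {L : ι → Type*} [∀ i, NormedAddCommGroup (L i)]
    [∀ i, NormedSpace ℂ (L i)] [∀ i, SMul Aᵐᵒᵖ (L i)] [∀ i, CStarModule Aᵐᵒᵖ (L i)]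
    (T : ∀ i, Adj A (L i) (L i)) {i j : ι} (h : i ≠ j) : Adj.diag T i j = 0 := by
  simp [Adj.diag, h]

lemma one_adj (i j : ι) : (Adj.one A E i j).adj = Adj.one A E j i := by
  by_cases h : i = j
  · subst h; rw [one_self]; rfl
  · rw [one_of_ne h, one_of_ne (Ne.symm h)]; rfl

variable (A E) in
/-- The projection onto a summand of an orthogonal sum. -/
def proj (i : ι) : Adj A (OSum A E) (E i) where
  toCLM := ContinuousLinearMap.proj i ∘L (WithCStarModule.equivL ℂ).toContinuousLinearMap
  adjCLM := (WithCStarModule.equivL ℂ).symm.toContinuousLinearMap ∘L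
    ContinuousLinearMap.pi fun j => (Adj.one A E i j).toCLM
  inner_adj x y := by
    rw [WithCStarModule.pi_inner]
    change inner Aᵐᵒᵖ (x i) y = ∑ j, inner Aᵐᵒᵖ (x j) (Adj.one A E i j y)
    rw [Finset.sum_eq_single i]
    · rw [one_self]; rfl
    · intro j _ hj
      rw [one_of_ne (Ne.symm hj)]
      simp
    · simp

lemma adj_proj_apply (i j : ι) (y : E i) : (proj A E i).adj y j = Adj.one A E i j y := rfl

lemma proj_comp_adj (i j : ι) : (proj A E j).comp (proj A E i).adj = Adj.one A E i j :=
  Adj.ext fun _ => rfl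

/-- This resolution of the identity, inserted on both sides of an operator, reduces statements about
operators between orthogonal sums to their matrix entries. -/
lemma sum_adj_proj_comp : ∑ i, (proj A E i).adj.comp (proj A E i) = Adj.id A (OSum A E) := by
  refine Adj.ext fun x => WithCStarModule.ext fun j => ?_
  change (proj A E j).comp (∑ i, (proj A E i).adj.comp (proj A E i)) x = _
  rw [comp_sum, sum_apply, Finset.sum_eq_single j]
  · rw [← comp_assoc, proj_comp_adj, one_self]; rfl
  · intro i _ hi
    rw [← comp_assoc, proj_comp_adj, one_of_ne hi]; rfl
  · simp

lemma proj_comp_matrix_comp (T : ∀ i j, Adj A (E i) (F j)) (i : ι) (j : κ) :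
    (proj A F j).comp ((Adj.matrix T).comp (proj A E i).adj) = T i j := by
  refine Adj.ext fun x => ?_
  change Adj.matrix T ((proj A E i).adj x) j = _
  rw [matrix_apply, Finset.sum_eq_single i]
  · rw [adj_proj_apply, one_self]; rfl
  · intro k _ hk
    rw [adj_proj_apply, one_of_ne (Ne.symm hk)]
    simp
  · simp

lemma matrix_ext {S T : Adj A (OSum A E) (OSum A F)}
    (h : ∀ i j, (proj A F j).comp (S.comp (proj A E i).adj) =
      (proj A F j).comp (T.comp (proj A E i).adj)) : S = T := by
  have key : ∀ S : Adj A (OSum A E) (OSum A F), S = ∑ j, ∑ i, (proj A F j).adj.comp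
      (((proj A F j).comp (S.comp (proj A E i).adj)).comp (proj A E i)) := by
    intro S
    calc S = (∑ j, (proj A F j).adj.comp (proj A F j)).comp
          (S.comp (∑ i, (proj A E i).adj.comp (proj A E i))) := by
          rw [sum_adj_proj_comp, sum_adj_proj_comp]; rfl
      _ = _ := by
          rw [sum_comp]
          refine Finset.sum_congr rfl fun j _ => ?_
          rw [comp_sum, comp_sum]
          rfl
  rw [key S, key T]
  simp only [h]

lemma matrix_eq_sum (T : ∀ i j, Adj A (E i) (F j)) :
    Adj.matrix T = ∑ j, ∑ i, (proj A F j).adj.comp ((T i j).comp (proj A E i)) := by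
  calc Adj.matrix T = (∑ j, (proj A F j).adj.comp (proj A F j)).comp
          ((Adj.matrix T).comp (∑ i, (proj A E i).adj.comp (proj A E i))) := by
          rw [sum_adj_proj_comp, sum_adj_proj_comp]; rfl
    _ = _ := by
      rw [sum_comp]
      refine Finset.sum_congr rfl fun j _ => ?_
      rw [comp_sum, comp_sum]
      refine Finset.sum_congr rfl fun i _ => ?_
      rw [← proj_comp_matrix_comp T i j]
      rfl

/-- A matrix is a finite sum of its entries composed with adjointable projections and inclusions,
and compacts form an ideal. -/
lemma IsCompact.matrix {T : ∀ i j, Adj A (E i) (F j)} (h : ∀ i j, (T i j).IsCompact) :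
    (Adj.matrix T).IsCompact := by
  rw [matrix_eq_sum]
  exact IsCompact.sum fun j _ => IsCompact.sum fun i _ => ((h i j).comp_right _).comp_left _

lemma matrix_add (S T : ∀ i j, Adj A (E i) (F j)) :
    Adj.matrix S + Adj.matrix T = Adj.matrix fun i j => S i j + T i j :=
  matrix_ext fun i j => by
    rw [add_comp, comp_add]
    simp only [proj_comp_matrix_comp]

lemma matrix_sub (S T : ∀ i j, Adj A (E i) (F j)) :
    Adj.matrix S - Adj.matrix T = Adj.matrix fun i j => S i j - T i j :=
  matrix_ext fun i j => by
    rw [sub_comp, comp_sub]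
    simp only [proj_comp_matrix_comp]

lemma matrix_sum {τ : Type*} (s : Finset τ) (T : τ → ∀ i j, Adj A (E i) (F j)) :
    ∑ t ∈ s, Adj.matrix (T t) = Adj.matrix fun i j => ∑ t ∈ s, T t i j :=
  matrix_ext fun i j => by
    rw [sum_comp, comp_sum]
    simp only [proj_comp_matrix_comp]

lemma matrix_one : Adj.matrix (Adj.one A E) = Adj.id A (OSum A E) :=
  matrix_ext fun i j => by
    rw [proj_comp_matrix_comp, id_comp, proj_comp_adj]

end Sums

end Adj

/-! ### The C⋆-algebra of adjointable operators on a Hilbert module -/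

namespace Adj

section CStar

variable {A : Type*} [NonUnitalCStarAlgebra A] [PartialOrder A] [StarOrderedRing A]
  {E F : Type*}
  [NormedAddCommGroup E] [NormedSpace ℂ E] [SMul Aᵐᵒᵖ E] [CStarModule Aᵐᵒᵖ E]
  [NormedAddCommGroup F] [NormedSpace ℂ F] [SMul Aᵐᵒᵖ F] [CStarModule Aᵐᵒᵖ F]

instance instRing : Ring (Adj A E E) where
  __ := (inferInstance : AddCommGroup (Adj A E E))
  mul := comp
  one := Adj.id A E
  mul_assoc _ _ _ := rfl
  one_mul _ := rfl
  mul_one _ := rfl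
  left_distrib := comp_add
  right_distrib := add_comp
  zero_mul := zero_comp
  mul_zero := comp_zero

lemma mul_eq_comp (S T : Adj A E E) : S * T = S.comp T := rfl
lemma one_eq_id : (1 : Adj A E E) = Adj.id A E := rfl

variable (A E) in
/-- The inclusion of the adjointable operators in the bounded operators, as a ring homomorphism. -/
def toCLMHom : Adj A E E →+* (E →L[ℂ] E) where
  toFun := toCLM
  map_one' := rfl
  map_mul' _ _ := rfl
  map_zero' := rfl
  map_add' _ _ := rfl

instance instNormedRing : NormedRing (Adj A E E) :=
  NormedRing.induced _ _ (toCLMHom A E) toCLM_injective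

instance instAlgebra : Algebra ℂ (Adj A E E) :=
  Algebra.ofModule (fun _ _ _ => Adj.ext fun _ => rfl) fun c S T =>
    Adj.ext fun x => map_smul S.toCLM c (T x)

instance instNormedAlgebra : NormedAlgebra ℂ (Adj A E E) where
  norm_smul_le c T := norm_smul_le c T.toCLM

instance instStarRing : StarRing (Adj A E E) where
  star := adj
  star_involutive _ := rfl
  star_mul _ _ := rfl
  star_add _ _ := rfl

lemma star_eq_adj (T : Adj A E E) : star T = T.adj := rfl

instance instStarModule : StarModule ℂ (Adj A E E) := ⟨adj_smul⟩

instance instCStarRing : CStarRing (Adj A E E) := ⟨norm_toCLM_sq_le⟩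

/-- The adjoint is isometric, so the adjoints of a Cauchy sequence are Cauchy too. By continuity of
the inner product the two limits are adjoint to each other. -/
instance instCompleteSpace [CompleteSpace E] : CompleteSpace (Adj A E E) := by
  refine Metric.complete_of_cauchySeq_tendsto fun u hu => ?_
  have h1 : CauchySeq fun n => (u n).toCLM := by
    rw [Metric.cauchySeq_iff] at hu ⊢
    exact fun ε hε => (hu ε hε).imp fun N h m hm n hn => by
      have := h m hm n hn
      rwa [dist_eq_norm] at this ⊢
  have h2 : CauchySeq fun n => (u n).adjCLM := by
    rw [Metric.cauchySeq_iff] at hu ⊢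
    refine fun ε hε => (hu ε hε).imp fun N h m hm n hn => ?_
    have := h m hm n hn
    rw [dist_eq_norm] at this ⊢
    exact ((u m - u n).norm_adj_toCLM).trans_lt this
  obtain ⟨T, hT⟩ := cauchySeq_tendsto_of_complete h1
  obtain ⟨T', hT'⟩ := cauchySeq_tendsto_of_complete h2
  have hx : ∀ x, Filter.Tendsto (fun n => u n x) Filter.atTop (nhds (T x)) := fun x =>
    ((ContinuousLinearMap.apply ℂ E x).continuous.tendsto T).comp hT
  have hy : ∀ y, Filter.Tendsto (fun n => (u n).adjCLM y) Filter.atTop (nhds (T' y)) := fun y =>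
    ((ContinuousLinearMap.apply ℂ E y).continuous.tendsto T').comp hT'
  let S : Adj A E E := ⟨T, T', fun x y => by
    have l1 := (CStarModule.continuous_inner (A := Aᵐᵒᵖ) (E := E)).continuousAt.tendsto.comp
      ((hx x).prodMk_nhds (tendsto_const_nhds (x := y)))
    have l2 := (CStarModule.continuous_inner (A := Aᵐᵒᵖ) (E := E)).continuousAt.tendsto.comp
      ((tendsto_const_nhds (x := x)).prodMk_nhds (hy y))
    exact tendsto_nhds_unique l1 (l2.congr fun n => ((u n).inner_adj x y).symm)⟩
  refine ⟨S, ?_⟩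
  rw [tendsto_iff_dist_tendsto_zero] at hT ⊢
  refine hT.congr fun n => ?_
  rw [dist_eq_norm, dist_eq_norm]
  rfl

instance instCStarAlgebra [CompleteSpace E] : CStarAlgebra (Adj A E E) where
  star_smul := adj_smul

instance instPartialOrder [CompleteSpace E] : PartialOrder (Adj A E E) :=
  CStarAlgebra.spectralOrder _
instance instStarOrderedRing [CompleteSpace E] : StarOrderedRing (Adj A E E) :=
  CStarAlgebra.spectralOrderedRing _

lemma IsCompact.mul_left {T : Adj A E E} (hT : T.IsCompact) (S : Adj A E E) : (S * T).IsCompact :=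
  hT.comp_left S

lemma IsCompact.mul_right {T : Adj A E E} (hT : T.IsCompact) (S : Adj A E E) : (T * S).IsCompact :=
  hT.comp_right S

end CStar

end Adj

/-! ### Invertibility of the Laplacian modulo compact operators -/

namespace Adj

section Laplacian

variable {A : Type*} [NonUnitalCStarAlgebra A] [PartialOrder A] [StarOrderedRing A]
  {E : Type*} [NormedAddCommGroup E] [NormedSpace ℂ E] [SMul Aᵐᵒᵖ E] [CStarModule Aᵐᵒᵖ E]
  [CompleteSpace E]

/-- If `d² = 0` and `1 - q d - d p` is compact, then the Laplacian `d d⋆ + d⋆ d` is invertible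
modulo compact operators. -/
lemma exists_laplacian_parametrix {d p q : Adj A E E} (hd : d * d = 0)
    (hC : (1 - q * d - d * p).IsCompact) :
    ∃ G : Adj A E E, (1 - G * (d * star d + star d * d)).IsCompact ∧
      (1 - (d * star d + star d * d) * G).IsCompact := by
  set C := 1 - q * d - d * p with hCdef
  set e := d * p with he
  clear_value C e
  -- `e = d p` is idempotent modulo compacts: multiplying `C = 1 - q d - e` by `e` on the right
  -- kills `q d` because `d² = 0`.
  have he2 : e * e = e - C * e := by
    have h : C * e = e - q * (d * d) * p - e * e := by rw [hCdef, he]; noncomm_ring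
    rw [h, hd]; noncomm_ring
  have he2' : star e * star e = star e - star e * star C := by
    rw [← star_mul, he2, star_sub, star_mul]
  have hf : q * d = 1 - e - C := by rw [hCdef]; abel
  have hC' : (star C).IsCompact := hC.adj
  -- `k` collects the compact errors made when `e² = e` and `q d = 1 - e` are used as if they were
  -- exact.
  let k := -(star e * star C) - C * e - (1 - star e) * C - star C * (1 - e) + star C * C
  have hk : k.IsCompact :=
    ((((hC'.mul_left _).neg.sub (hC.mul_right _)).sub (hC.mul_left _)).sub (hC'.mul_right _)).add
      (hC.mul_left _)
  -- The identity `e e⋆ + (1 - e)⋆ (1 - e) = 1 + (e - e⋆)⋆ (e - e⋆)` for idempotents, corrected by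
  -- `k`.
  have key : e * star e + star (q * d) * (q * d) = 1 + star (e - star e) * (e - star e) + k := by
    have h : star (e - star e) * (e - star e) =
        star e * e - star e * star e - e * e + e * star e := by
      rw [star_sub, star_star]; noncomm_ring
    rw [h, he2, he2', hf, star_sub, star_sub, star_one]
    simp only [k]
    noncomm_ring
  -- One constant serves both estimates `d p p⋆ d⋆ ≤ ‖p p⋆‖ d d⋆` and `d⋆ q⋆ q d ≤ ‖q⋆ q‖ d⋆ d`.
  set r : ℝ := ‖p * star p‖ + ‖star q * q‖ with hr
  have h1 : e * star e ≤ r • (d * star d) := by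
    have h := CStarAlgebra.star_right_conjugate_le_norm_smul (a := d) (b := p * star p)
      (IsSelfAdjoint.mul_star_self p)
    have h' : e * star e = d * (p * star p) * star d := by rw [he, star_mul]; noncomm_ring
    rw [h']
    refine h.trans (smul_le_smul_of_nonneg_right ?_ (mul_star_self_nonneg d))
    rw [hr]; linarith [norm_nonneg (star q * q)]
  have h2 : star (q * d) * (q * d) ≤ r • (star d * d) := by
    have h := CStarAlgebra.star_left_conjugate_le_norm_smul (a := d) (b := star q * q)
      (IsSelfAdjoint.star_mul_self q)
    have h' : star (q * d) * (q * d) = star d * (star q * q) * d := by rw [star_mul]; noncomm_ring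
    rw [h']
    refine h.trans (smul_le_smul_of_nonneg_right ?_ (star_mul_self_nonneg d))
    rw [hr]; linarith [norm_nonneg (p * star p)]
  have h3 : 1 ≤ r • (d * star d + star d * d) - k := by
    rw [le_sub_iff_add_le, smul_add]
    refine le_trans ?_ (add_le_add h1 h2)
    rw [key]
    exact add_le_add_left (le_add_of_nonneg_right (star_mul_self_nonneg _)) k
  -- Writing `Δ` for the Laplacian, `u = r Δ - k` dominates `1`, hence is invertible. With `G = r
  -- u⁻¹` the two errors are exactly `-u⁻¹ k` and `-k u⁻¹`.
  obtain ⟨u, hu⟩ := CStarAlgebra.isUnit_of_le 1 h3 isStrictlyPositive_one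
  refine ⟨r • (↑u⁻¹ : Adj A E E), ?_, ?_⟩
  · have h4 : 1 - (r • (↑u⁻¹ : Adj A E E)) * (d * star d + star d * d) = -(↑u⁻¹ * k) := by
      have h5 := u.inv_mul
      rw [hu, mul_sub, mul_smul_comm] at h5
      rw [smul_mul_assoc, ← h5]
      abel
    rw [h4]
    exact (hk.mul_left _).neg
  · have h4 : 1 - (d * star d + star d * d) * (r • (↑u⁻¹ : Adj A E E)) = -(k * ↑u⁻¹) := by
      have h5 := u.mul_inv
      rw [hu, sub_mul, smul_mul_assoc] at h5
      rw [mul_smul_comm, ← h5]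
      abel
    rw [h4]
    exact (hk.mul_right _).neg

end Laplacian

end Adj

/-! ### Fredholm complexes and their Dirac operators -/

namespace Adj

section One

variable {A : Type*} [NonUnitalCStarAlgebra A] [PartialOrder A] [StarOrderedRing A]
  {ι : Type*} [Fintype ι] [DecidableEq ι] {L : ι → Type*}
  [∀ i, NormedAddCommGroup (L i)] [∀ i, NormedSpace ℂ (L i)] [∀ i, SMul Aᵐᵒᵖ (L i)]
  [∀ i, CStarModule Aᵐᵒᵖ (L i)]
  {F : Type*} [NormedAddCommGroup F] [NormedSpace ℂ F] [SMul Aᵐᵒᵖ F] [CStarModule Aᵐᵒᵖ F]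

lemma sum_comp_diag (C : ∀ i, Adj A (L i) (L i)) (T : ∀ i, Adj A (L i) F) (j : ι) :
    ∑ i, (T i).comp (Adj.diag C j i) = (T j).comp (C j) := by
  rw [Finset.sum_eq_single j]
  · rw [diag_self]
  · intro i _ hi
    rw [diag_of_ne C (Ne.symm hi), comp_zero]
  · simp

lemma sum_diag_comp (C : ∀ i, Adj A (L i) (L i)) (T : ∀ i, Adj A F (L i)) (j : ι) :
    ∑ i, (Adj.diag C i j).comp (T i) = (C j).comp (T j) := by
  rw [Finset.sum_eq_single j]
  · rw [diag_self]
  · intro i _ hi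
    rw [diag_of_ne C hi, zero_comp]
  · simp

lemma sum_comp_one (T : ∀ i, Adj A (L i) F) (j : ι) :
    ∑ i, (T i).comp (Adj.one A L j i) = T j := sum_comp_diag _ T j

lemma sum_one_comp (T : ∀ i, Adj A F (L i)) (j : ι) :
    ∑ i, (Adj.one A L i j).comp (T i) = T j := sum_diag_comp _ T j

/-- Kronecker-delta collapse when the sum runs over a subtype: an index `j` outside it meets no
nonzero term. -/
lemma sum_subtype_comp_one {p : ι → Prop} [DecidablePred p] (T : ∀ k : {k // p k}, Adj A (L k) F)
    (j : ι) : ∑ k, (T k).comp (Adj.one A L j k) = if h : p j then T ⟨j, h⟩ else 0 := by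
  split_ifs with h
  · rw [Finset.sum_eq_single ⟨j, h⟩]
    · rw [one_self, comp_id]
    · intro k _ hk
      rw [one_of_ne (fun h' => hk (Subtype.ext h'.symm)), comp_zero]
    · simp
  · refine Finset.sum_eq_zero fun k _ => ?_
    rw [one_of_ne (fun h' : j = k => h (by rw [h']; exact k.2)), comp_zero]

variable (A L) in
/-- The projection of an orthogonal sum onto the sum of some of the summands. -/
def subProj (p : ι → Prop) [DecidablePred p] :
    Adj A (OSum A L) (OSum A fun k : {k // p k} => L k) :=
  Adj.matrix fun j k => Adj.one A L j k

lemma subProj_comp_adj (p : ι → Prop) [DecidablePred p] :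
    (subProj A L p).comp (subProj A L p).adj = Adj.id A _ := by
  rw [subProj, adj_matrix, matrix_comp, ← matrix_one]
  congr 1
  funext k l
  simp only [one_adj]
  rw [sum_comp_one]
  by_cases h : k = l
  · subst h; rw [one_self, one_self]
  · rw [one_of_ne h, one_of_ne (fun h' => h (Subtype.ext h'))]

end One

end Adj

/-- With `C = 1 - q d - d p`, replacing both `q` and `p` by `q d p` changes the defect to `C + q C d
+ d C p`, which lies in every two-sided ideal containing `C`. This turns a joint parametrix into a
parametrix. -/
lemma one_sub_mul_mul {Q : Type*} [Ring Q] {d p q : Q} (hd : d * d = 0) :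
    1 - q * (d * p) * d - d * (q * (d * p)) =
      (1 - q * d - d * p) + q * ((1 - q * d - d * p) * d) + d * ((1 - q * d - d * p) * p) := by
  have h1 : (1 - q * d - d * p) * d = d - q * (d * d) - d * p * d := by noncomm_ring
  have h2 : d * ((1 - q * d - d * p) * p) = d * p - d * q * d * p - (d * d) * p * p := by
    noncomm_ring
  rw [h1, h2, hd]
  noncomm_ring

/-! ### The total differential and Dirac operator of one complex -/

namespace HilbComplex

section Single

variable {A : Type*} [NonUnitalCStarAlgebra A] [PartialOrder A] [StarOrderedRing A]
  {N : ℕ} {L : Fin (N + 2) → Type*}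
  [∀ i, NormedAddCommGroup (L i)] [∀ i, NormedSpace ℂ (L i)] [∀ i, SMul Aᵐᵒᵖ (L i)]
  [∀ i, CStarModule Aᵐᵒᵖ (L i)]
  (R : HilbComplex A L)

/-- `Pl d` and `d Pr` preserve degree, so every off-diagonal entry vanishes. Thus the defects in
separate degrees are the blocks of one defect on the total sum. -/
lemma one_sub_sum_eq_diag {Pl Pr : ∀ i j, Adj A (L i) (L j)}
    (hl : ∀ i j : Fin (N + 2), (j : ℕ) + 1 ≠ i → Pl i j = 0)
    (hr : ∀ i j : Fin (N + 2), (j : ℕ) + 1 ≠ i → Pr i j = 0) (i k : Fin (N + 2)) :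
    Adj.one A L i k - ∑ j, ((Pl j k).comp (R.d i j) + (R.d j k).comp (Pr i j)) =
      Adj.diag (R.defect Pl Pr) i k := by
  by_cases h : i = k
  · subst h
    rw [Adj.one_self, Adj.diag_self, defect]
  · have h' : (i : ℕ) ≠ k := fun h' => h (Fin.ext h')
    rw [Adj.one_of_ne h, Adj.diag_of_ne _ h, zero_sub, neg_eq_zero]
    refine Finset.sum_eq_zero fun j _ => ?_
    have h1 : (Pl j k).comp (R.d i j) = 0 := by
      by_cases h2 : (i : ℕ) + 1 = j
      · rw [hl j k (by omega), Adj.zero_comp]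
      · rw [R.shape _ _ h2, Adj.comp_zero]
    have h2 : (R.d j k).comp (Pr i j) = 0 := by
      by_cases h2 : (j : ℕ) + 1 = i
      · rw [R.shape j k (by omega), Adj.zero_comp]
      · rw [hr _ _ h2, Adj.comp_zero]
    rw [h1, h2, add_zero]

lemma isCompact_diag {C : ∀ i, Adj A (L i) (L i)} (h : ∀ i, (C i).IsCompact) (i j : Fin (N + 2)) :
    (Adj.diag C i j).IsCompact := by
  by_cases hij : i = j
  · subst hij; rw [Adj.diag_self]; exact h i
  · rw [Adj.diag_of_ne _ hij]; exact Adj.isCompact_zero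

/-- The differential on the sum of all modules of a complex. -/
def total : Adj A (OSum A L) (OSum A L) := Adj.matrix R.d

lemma total_mul_total : R.total * R.total = 0 :=
  (Adj.matrix_comp _ _).trans <| Adj.matrix_eq_zero fun i k =>
    Finset.sum_eq_zero fun j _ => R.d_comp_d i j k

lemma total_defect_eq {Pl Pr : ∀ i j, Adj A (L i) (L j)}
    (hl : ∀ i j : Fin (N + 2), (j : ℕ) + 1 ≠ i → Pl i j = 0)
    (hr : ∀ i j : Fin (N + 2), (j : ℕ) + 1 ≠ i → Pr i j = 0) :
    1 - Adj.matrix Pl * R.total - R.total * Adj.matrix Pr =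
      Adj.matrix (Adj.diag (R.defect Pl Pr)) := by
  rw [Adj.one_eq_id, ← Adj.matrix_one, total, Adj.mul_eq_comp, Adj.mul_eq_comp, Adj.matrix_comp,
    Adj.matrix_comp, Adj.matrix_sub, Adj.matrix_sub]
  congr 1
  funext i k
  rw [← R.one_sub_sum_eq_diag hl hr, Finset.sum_add_distrib, sub_sub]

lemma isCompact_total_defect {Pl Pr : ∀ i j, Adj A (L i) (L j)}
    (h : R.IsJointParametrix Pl Pr) :
    (1 - Adj.matrix Pl * R.total - R.total * Adj.matrix Pr).IsCompact := by
  rw [R.total_defect_eq h.shape_left h.shape_right]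
  exact Adj.IsCompact.matrix (isCompact_diag h.compact)

/-- The Dirac operator on the sum of all modules of a complex. -/
def dirac : Adj A (OSum A L) (OSum A L) := R.total + R.total.adj

lemma dirac_eq_matrix : R.dirac = Adj.matrix fun k l => R.d k l + (R.d l k).adj := by
  rw [dirac, total, Adj.adj_matrix, Adj.matrix_add]

/-- The differential and its adjoint change the degree by one and hence its parity. For this reason
the total Dirac operator exchanges the even and odd parts. -/
lemma dirac_entry_eq_zero {k l : Fin (N + 2)} (h : Even (k : ℕ) ↔ Even (l : ℕ)) :
    R.d k l + (R.d l k).adj = 0 := by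
  rw [R.shape k l, R.shape l k, Adj.adj_zero, add_zero]
  · intro h'
    rw [← h', Nat.even_add_one] at h
    tauto
  · intro h'
    rw [← h', Nat.even_add_one] at h
    tauto

lemma subProj_odd_comp_dirac :
    (Adj.subProj A L fun k => Odd (k : ℕ)).comp R.dirac =
      R.evenDirac.comp (Adj.subProj A L fun k => Even (k : ℕ)) := by
  rw [Adj.subProj, Adj.subProj, dirac_eq_matrix, evenDirac, Adj.matrix_comp, Adj.matrix_comp]
  congr 1
  funext k l
  rw [Adj.sum_one_comp (fun i => R.d k i + (R.d i k).adj), Adj.sum_subtype_comp_one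
    (fun i : {k : Fin (N + 2) // Even (k : ℕ)} => R.d i l + (R.d l i).adj)]
  split_ifs with h
  · rfl
  · refine R.dirac_entry_eq_zero ?_
    have := l.2
    rw [← Nat.not_even_iff_odd] at this
    tauto

lemma subProj_even_comp_dirac :
    (Adj.subProj A L fun k => Even (k : ℕ)).comp R.dirac =
      R.oddDirac.comp (Adj.subProj A L fun k => Odd (k : ℕ)) := by
  rw [Adj.subProj, Adj.subProj, dirac_eq_matrix, oddDirac, Adj.matrix_comp, Adj.matrix_comp]
  congr 1
  funext k l
  rw [Adj.sum_one_comp (fun i => R.d k i + (R.d i k).adj), Adj.sum_subtype_comp_one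
    (fun i : {k : Fin (N + 2) // Odd (k : ℕ)} => R.d i l + (R.d l i).adj)]
  split_ifs with h
  · rfl
  · refine R.dirac_entry_eq_zero ?_
    have := l.2
    rw [Nat.not_odd_iff_even] at h
    tauto

lemma dirac_comp_adj_subProj :
    R.dirac.comp (Adj.subProj A L fun k => Even (k : ℕ)).adj =
      (Adj.subProj A L fun k => Odd (k : ℕ)).adj.comp R.evenDirac := by
  have h := congrArg Adj.adj R.subProj_even_comp_dirac
  rw [Adj.adj_comp, Adj.adj_comp, ← R.adj_evenDirac, Adj.adj_adj, show R.dirac.adj = R.dirac from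
    add_comm R.total.adj R.total] at h
  exact h

/-- The square terms drop out because `d² = 0` and, taking adjoints, `(d⋆)² = 0`. -/
lemma dirac_mul_dirac : R.dirac * R.dirac = R.total * star R.total + star R.total * R.total := by
  have h : star R.total * star R.total = 0 := by rw [← star_mul, total_mul_total, star_zero]
  calc R.dirac * R.dirac = R.total * R.total + star R.total * star R.total +
        (R.total * star R.total + star R.total * R.total) := by
        rw [dirac, ← Adj.star_eq_adj]; noncomm_ring
    _ = _ := by rw [h, total_mul_total, add_zero, zero_add]

/-- The even Dirac operator of a Fredholm complex is Fredholm. -/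
theorem IsFredholm.evenDirac [∀ i, CompleteSpace (L i)] {R : HilbComplex A L}
    (h : R.IsFredholm) : R.evenDirac.IsFredholm := by
  obtain ⟨Pl, Pr, h⟩ := h
  obtain ⟨G, h1, h2⟩ := Adj.exists_laplacian_parametrix R.total_mul_total
    (R.isCompact_total_defect h)
  rw [← R.dirac_mul_dirac] at h1 h2
  set πe := Adj.subProj A L fun k => Even (k : ℕ) with he
  set πo := Adj.subProj A L fun k => Odd (k : ℕ) with ho
  -- `G D` inverts `D` on the left modulo compacts and `D G` on the right. Both are cut down to maps
  -- from the odd to the even part, and the intertwining relations move the projections past `D`.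
  refine Adj.isFredholm_of_left_right (P := πe.comp ((G * R.dirac).comp πo.adj))
    (Q := πe.comp ((R.dirac * G).comp πo.adj)) ?_ ?_
  · have h3 : Adj.id A _ - (πe.comp ((G * R.dirac).comp πo.adj)).comp R.evenDirac =
        πe.comp ((1 - G * (R.dirac * R.dirac)).comp πe.adj) := by
      rw [Adj.sub_comp, Adj.comp_sub, Adj.one_eq_id, Adj.id_comp, he, Adj.subProj_comp_adj, ← he,
        Adj.comp_assoc, Adj.comp_assoc, ho, ← R.dirac_comp_adj_subProj]
      rfl
    rw [h3]
    exact (h1.comp_right _).comp_left _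
  · have h3 : Adj.id A _ - R.evenDirac.comp (πe.comp ((R.dirac * G).comp πo.adj)) =
        πo.comp ((1 - R.dirac * R.dirac * G).comp πo.adj) := by
      rw [Adj.sub_comp, Adj.comp_sub, Adj.one_eq_id, Adj.id_comp, ho, Adj.subProj_comp_adj, ← ho,
        ← Adj.comp_assoc, he, ← R.subProj_odd_comp_dirac]
      rfl
    rw [h3]
    exact (h2.comp_right _).comp_left _

/-- A Fredholm complex has a parametrix. -/
theorem IsFredholm.exists_isParametrix {R : HilbComplex A L} (h : R.IsFredholm) :
    ∃ P, R.IsParametrix P := by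
  obtain ⟨Pl, Pr, h⟩ := h
  -- The matrix entries of `Pl d Pr`, which has degree `-1 + 1 - 1 = -1`.
  let P : ∀ i j, Adj A (L i) (L j) := fun i j =>
    ∑ b, (Pl b j).comp (∑ a, (R.d a b).comp (Pr i a))
  have hP : Adj.matrix P = Adj.matrix Pl * (R.total * Adj.matrix Pr) := by
    rw [Adj.mul_eq_comp, Adj.mul_eq_comp, total, Adj.matrix_comp, Adj.matrix_comp]
  have hs : ∀ i j : Fin (N + 2), (j : ℕ) + 1 ≠ i → P i j = 0 := by
    intro i j hij
    refine Finset.sum_eq_zero fun b _ => ?_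
    by_cases hb : (j : ℕ) + 1 = b
    · rw [Finset.sum_eq_zero, Adj.comp_zero]
      intro a _
      by_cases ha : (a : ℕ) + 1 = b
      · rw [h.shape_right i a (by omega), Adj.comp_zero]
      · rw [R.shape a b ha, Adj.zero_comp]
    · rw [h.shape_left b j hb, Adj.zero_comp]
  refine ⟨P, hs, hs, fun k => ?_⟩
  have hC := R.isCompact_total_defect h
  have hd := R.total_mul_total
  have hc := (hC.add ((hC.mul_right R.total).mul_left (Adj.matrix Pl))).add
    ((hC.mul_right (Adj.matrix Pr)).mul_left R.total)
  rw [← one_sub_mul_mul hd, ← hP] at hc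
  rw [R.total_defect_eq hs hs] at hc
  -- Compactness was proved for the total defect; compressing it to the `k`-th summand recovers the
  -- defect in degree `k`.
  have hk : (Adj.proj A L k).comp ((Adj.matrix (Adj.diag (R.defect P P))).comp
      (Adj.proj A L k).adj) = R.defect P P k :=
    (Adj.proj_comp_matrix_comp _ k k).trans (Adj.diag_self _ k)
  rw [← hk]
  exact (hc.comp_right _).comp_left _

lemma IsParametrix.isFredholm {R : HilbComplex A L} {P : ∀ i j, Adj A (L i) (L j)}
    (h : R.IsParametrix P) : R.IsFredholm := ⟨P, P, h⟩

end Single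

end HilbComplex

/-! ### The parametrix of a tensor product -/

section TensorParametrix

variable {A B : Type*} [NonUnitalCStarAlgebra A] [PartialOrder A] [StarOrderedRing A]
  [NonUnitalCStarAlgebra B] [PartialOrder B] [StarOrderedRing B]
  {N M : ℕ} {L : Fin (N + 2) → Type*} {K : Fin (M + 2) → Type*}
  [∀ i, NormedAddCommGroup (L i)] [∀ i, NormedSpace ℂ (L i)] [∀ i, SMul Aᵐᵒᵖ (L i)]
  [∀ i, CStarModule Aᵐᵒᵖ (L i)]
  [∀ i, NormedAddCommGroup (K i)] [∀ i, NormedSpace ℂ (K i)] [∀ i, SMul Bᵐᵒᵖ (K i)]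
  [∀ i, CStarModule Bᵐᵒᵖ (K i)]

section TensorComp

variable {E E' E'' F F' F'' : Type*}
  [NormedAddCommGroup E] [NormedSpace ℂ E] [SMul Aᵐᵒᵖ E] [CStarModule Aᵐᵒᵖ E]
  [NormedAddCommGroup E'] [NormedSpace ℂ E'] [SMul Aᵐᵒᵖ E'] [CStarModule Aᵐᵒᵖ E']
  [NormedAddCommGroup E''] [NormedSpace ℂ E''] [SMul Aᵐᵒᵖ E''] [CStarModule Aᵐᵒᵖ E'']
  [NormedAddCommGroup F] [NormedSpace ℂ F] [SMul Bᵐᵒᵖ F] [CStarModule Bᵐᵒᵖ F]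
  [NormedAddCommGroup F'] [NormedSpace ℂ F'] [SMul Bᵐᵒᵖ F'] [CStarModule Bᵐᵒᵖ F']
  [NormedAddCommGroup F''] [NormedSpace ℂ F''] [SMul Bᵐᵒᵖ F''] [CStarModule Bᵐᵒᵖ F'']

/-- Here and in the variants below, signs are absorbed into the first tensor factor. A
degree-dependent sign then no longer prevents a sum over bidegrees from factoring through
`sum_prod_tensor`. -/
lemma Adj.tensor_comp_zsmul (T' : Adj A E' E'') (T : Adj A E E') (S' : Adj B F' F'')
    (S : Adj B F F') (n : ℤ) : (T'.tensor S').comp (n • T.tensor S) =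
      ((n • T').comp T).tensor (S'.comp S) := by
  rw [comp_zsmul, zsmul_comp, zsmul_tensor, tensor_comp]

lemma Adj.zsmul_tensor_comp (T' : Adj A E' E'') (T : Adj A E E') (S' : Adj B F' F'')
    (S : Adj B F F') (n : ℤ) : (n • T'.tensor S').comp (T.tensor S) =
      (T'.comp (n • T)).tensor (S'.comp S) := by
  rw [comp_zsmul, zsmul_comp, zsmul_tensor, tensor_comp]

lemma Adj.zsmul_tensor_comp_zsmul (T' : Adj A E' E'') (T : Adj A E E') (S' : Adj B F' F'')
    (S : Adj B F F') (m n : ℤ) : (m • T'.tensor S').comp (n • T.tensor S) =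
      ((m • n • T').comp T).tensor (S'.comp S) := by
  rw [comp_zsmul, zsmul_comp, zsmul_comp, zsmul_comp, zsmul_tensor, zsmul_tensor, tensor_comp,
    smul_comm]

lemma Adj.zsmul_tensor_comp_zsmul' (T' : Adj A E' E'') (T : Adj A E E') (S' : Adj B F' F'')
    (S : Adj B F F') (m n : ℤ) : (m • T'.tensor S').comp (n • T.tensor S) =
      (T'.comp (m • n • T)).tensor (S'.comp S) := by
  rw [zsmul_tensor_comp_zsmul, zsmul_comp, zsmul_comp, comp_zsmul, comp_zsmul]

lemma Adj.add_comp_add (S S' : Adj A E' E'') (T T' : Adj A E E') :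
    (S + S').comp (T + T') = S.comp T + S.comp T' + (S'.comp T + S'.comp T') := by
  rw [add_comp, comp_add, comp_add]

end TensorComp

lemma Adj.sum_prod_tensor {ι κ : Type*} [Fintype ι] [Fintype κ]
    {E E' F F' : Type*}
    [NormedAddCommGroup E] [NormedSpace ℂ E] [SMul Aᵐᵒᵖ E] [CStarModule Aᵐᵒᵖ E]
    [NormedAddCommGroup E'] [NormedSpace ℂ E'] [SMul Aᵐᵒᵖ E'] [CStarModule Aᵐᵒᵖ E']
    [NormedAddCommGroup F] [NormedSpace ℂ F] [SMul Bᵐᵒᵖ F] [CStarModule Bᵐᵒᵖ F]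
    [NormedAddCommGroup F'] [NormedSpace ℂ F'] [SMul Bᵐᵒᵖ F'] [CStarModule Bᵐᵒᵖ F']
    (f : ι → Adj A E E') (g : κ → Adj B F F') :
    ∑ r : ι × κ, (f r.1).tensor (g r.2) = (∑ i, f i).tensor (∑ j, g j) := by
  rw [Adj.sum_tensor, Fintype.sum_prod_type]
  refine Finset.sum_congr rfl fun i _ => ?_
  change ∑ j, (f i).tensor (g j) = _
  rw [Adj.tensor_sum]

/-- The component `L p.1 ⊗ K p.2 → L q.1 ⊗ K q.2` of the parametrix of a tensor product. -/
def parametrixEntry (R : HilbComplex A L) (P : ∀ i j, Adj A (L i) (L j))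
    (Q : ∀ i j, Adj B (K i) (K j)) (p q : Fin (N + 2) × Fin (M + 2)) :
    Adj (MinTensor A B) (ExtTensor A B (L p.1) (K p.2)) (ExtTensor A B (L q.1) (K q.2)) :=
  (P p.1 q.1).tensor (Adj.one B K p.2 q.2) +
    (-1 : ℤ) ^ (p.1 : ℕ) • (Adj.diag (R.defect P P) p.1 q.1).tensor (Q p.2 q.2)

/-- Both sides equal `d - d P d` since `d² = 0`; that is, the defect of a parametrix is a chain map.
-/
lemma HilbComplex.defect_comp_d (R : HilbComplex A L) (P : ∀ i j, Adj A (L i) (L j))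
    (hP : ∀ i j : Fin (N + 2), (j : ℕ) + 1 ≠ i → P i j = 0) (i j : Fin (N + 2)) :
    (R.defect P P j).comp (R.d i j) = (R.d i j).comp (R.defect P P i) := by
  by_cases hij : (i : ℕ) + 1 = j
  · have h1 : (R.defect P P j).comp (R.d i j) =
        R.d i j - (R.d i j).comp ((P j i).comp (R.d i j)) := by
      rw [defect, Adj.sub_comp, Adj.id_comp, Adj.sum_comp, Finset.sum_eq_single i]
      · rw [Adj.add_comp, Adj.comp_assoc, R.d_comp_d, Adj.comp_zero, zero_add, Adj.comp_assoc]
      · intro k _ hk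
        rw [Adj.add_comp, Adj.comp_assoc, R.d_comp_d, Adj.comp_zero, zero_add,
          hP j k (fun h => hk (Fin.ext (by omega))), Adj.comp_zero, Adj.zero_comp]
      · simp
    have h2 : (R.d i j).comp (R.defect P P i) =
        R.d i j - (R.d i j).comp ((P j i).comp (R.d i j)) := by
      rw [defect, Adj.comp_sub, Adj.comp_id, Adj.comp_sum, Finset.sum_eq_single j]
      · rw [Adj.comp_add, ← Adj.comp_assoc _ (R.d j i), R.d_comp_d, Adj.zero_comp, add_zero]
      · intro k _ hk
        rw [Adj.comp_add, ← Adj.comp_assoc _ (R.d k i), R.d_comp_d, Adj.zero_comp, add_zero,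
          R.shape i k (fun h => hk (Fin.ext (by omega))), Adj.comp_zero, Adj.comp_zero]
      · simp
    rw [h1, h2]
  · rw [R.shape i j hij, Adj.comp_zero, Adj.zero_comp]

lemma neg_one_pow_smul_add {G : Type*} [AddCommGroup G] {a b : ℕ} {x : G}
    (h : a + 1 ≠ b → x = 0) : (-1 : ℤ) ^ a • x + (-1 : ℤ) ^ b • x = 0 := by
  by_cases hab : a + 1 = b
  · rw [← hab, pow_succ, mul_neg_one, neg_smul, add_neg_cancel]
  · rw [h hab, smul_zero, smul_zero, add_zero]

/-- Bookkeeping for the eight terms of `P_T T + T P_T`: the mixed pairs `b`, `c` cancel, and the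
pairs `a`, `d` telescope through `y`. -/
lemma add_four_comm {G : Type*} [AddCommGroup G] {a b c d a' b' c' d' x y z : G}
    (hb : b' + b = 0) (hc : c' + c = 0) (ha : a + a' = x - y) (hd : d + d' = y - z) :
    a + b + (c + d) + (a' + c' + (b' + d')) = x - z := by
  calc _ = (a + a') + (d + d') + (c' + c) + (b' + b) := by abel
    _ = _ := by rw [ha, hd, hb, hc]; abel

-- The homotopy formula entry by entry. The intermediate degree `r` ranges over all bidegrees rather
-- than over one total degree, so that sums over `r` split as products of sums in the two factors.
set_option maxHeartbeats 1000000 in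
lemma sum_parametrixEntry (R : HilbComplex A L) (S : HilbComplex B K)
    {P : ∀ i j, Adj A (L i) (L j)} {Q : ∀ i j, Adj B (K i) (K j)}
    (hP : ∀ i j : Fin (N + 2), (j : ℕ) + 1 ≠ i → P i j = 0)
    (hQ : ∀ i j : Fin (M + 2), (j : ℕ) + 1 ≠ i → Q i j = 0) (p q : Fin (N + 2) × Fin (M + 2)) :
    ∑ r, ((parametrixEntry R P Q r q).comp (tensorEntry R S p r) +
      (tensorEntry R S r q).comp (parametrixEntry R P Q p r)) =
    (Adj.one A L p.1 q.1).tensor (Adj.one B K p.2 q.2) -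
      (Adj.diag (R.defect P P) p.1 q.1).tensor (Adj.diag (S.defect Q Q) p.2 q.2) := by
  obtain ⟨p₁, p₂⟩ := p
  obtain ⟨q₁, q₂⟩ := q
  have hPR := R.one_sub_sum_eq_diag hP hP p₁ q₁
  have hQS := S.one_sub_sum_eq_diag hQ hQ p₂ q₂
  -- The identity and diagonal factors fix coordinates of `r`, which determines the signs. In the
  -- third term `C` has been commuted past `d`; in the fourth the two signs multiply to `1`.
  have h1 : ∑ r, (parametrixEntry R P Q r (q₁, q₂)).comp (tensorEntry R S (p₁, p₂) r) =
      (∑ j, (P j q₁).comp (R.d p₁ j)).tensor (Adj.one B K p₂ q₂) +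
      (-1 : ℤ) ^ (p₁ : ℕ) • (P p₁ q₁).tensor (S.d p₂ q₂) +
      ((-1 : ℤ) ^ (q₁ : ℕ) • ((R.d p₁ q₁).comp (R.defect P P p₁)).tensor (Q p₂ q₂) +
      (Adj.diag (R.defect P P) p₁ q₁).tensor (∑ i, (Q i q₂).comp (S.d p₂ i))) := by
    have h (r : Fin (N + 2) × Fin (M + 2)) :
        (parametrixEntry R P Q r (q₁, q₂)).comp (tensorEntry R S (p₁, p₂) r) =
        ((P r.1 q₁).comp (R.d p₁ r.1)).tensor
          ((Adj.one B K r.2 q₂).comp (Adj.one B K p₂ r.2)) +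
        (((-1 : ℤ) ^ (p₁ : ℕ) • P r.1 q₁).comp (Adj.one A L p₁ r.1)).tensor
          ((Adj.one B K r.2 q₂).comp (S.d p₂ r.2)) +
        (((Adj.diag (R.defect P P) r.1 q₁).comp ((-1 : ℤ) ^ (r.1 : ℕ) • R.d p₁ r.1)).tensor
          ((Q r.2 q₂).comp (Adj.one B K p₂ r.2)) +
        (((-1 : ℤ) ^ (r.1 : ℕ) • (-1 : ℤ) ^ (p₁ : ℕ) • Adj.diag (R.defect P P) r.1 q₁).comp
          (Adj.one A L p₁ r.1)).tensor ((Q r.2 q₂).comp (S.d p₂ r.2))) := by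
      rw [parametrixEntry, tensorEntry, Adj.add_comp_add, ← Adj.tensor_comp,
        Adj.tensor_comp_zsmul, Adj.zsmul_tensor_comp, Adj.zsmul_tensor_comp_zsmul]
    rw [Finset.sum_congr rfl fun r _ => h r]
    simp only [Finset.sum_add_distrib]
    rw [Adj.sum_prod_tensor (fun j => (P j q₁).comp (R.d p₁ j))
        (fun i => (Adj.one B K i q₂).comp (Adj.one B K p₂ i)),
      Adj.sum_prod_tensor (fun j => ((-1 : ℤ) ^ (p₁ : ℕ) • P j q₁).comp (Adj.one A L p₁ j))
        (fun i => (Adj.one B K i q₂).comp (S.d p₂ i)),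
      Adj.sum_prod_tensor (fun j : Fin (N + 2) => (Adj.diag (R.defect P P) j q₁).comp
        ((-1 : ℤ) ^ (j : ℕ) • R.d p₁ j)) (fun i => (Q i q₂).comp (Adj.one B K p₂ i)),
      Adj.sum_prod_tensor (fun j : Fin (N + 2) => ((-1 : ℤ) ^ (j : ℕ) • (-1 : ℤ) ^ (p₁ : ℕ) •
        Adj.diag (R.defect P P) j q₁).comp (Adj.one A L p₁ j))
        (fun i => (Q i q₂).comp (S.d p₂ i)),
      Adj.sum_one_comp (fun i => Adj.one B K p₂ i),
      Adj.sum_comp_one (fun j => (-1 : ℤ) ^ (p₁ : ℕ) • P j q₁),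
      Adj.sum_one_comp (fun i => S.d p₂ i),
      Adj.sum_diag_comp _ (fun j : Fin (N + 2) => (-1 : ℤ) ^ (j : ℕ) • R.d p₁ j),
      Adj.sum_comp_one (fun i => Q i q₂),
      Adj.sum_comp_one (fun j : Fin (N + 2) => (-1 : ℤ) ^ (j : ℕ) • (-1 : ℤ) ^ (p₁ : ℕ) •
        Adj.diag (R.defect P P) j q₁),
      smul_smul, ← mul_pow, neg_one_mul, neg_neg, one_pow, one_smul, Adj.comp_zsmul,
      R.defect_comp_d P hP, Adj.zsmul_tensor, Adj.zsmul_tensor]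
  have h2 : ∑ r, (tensorEntry R S r (q₁, q₂)).comp (parametrixEntry R P Q (p₁, p₂) r) =
      (∑ j, (R.d j q₁).comp (P p₁ j)).tensor (Adj.one B K p₂ q₂) +
      (-1 : ℤ) ^ (p₁ : ℕ) • ((R.d p₁ q₁).comp (R.defect P P p₁)).tensor (Q p₂ q₂) +
      ((-1 : ℤ) ^ (q₁ : ℕ) • (P p₁ q₁).tensor (S.d p₂ q₂) +
      (Adj.diag (R.defect P P) p₁ q₁).tensor (∑ i, (S.d i q₂).comp (Q p₂ i))) := by
    have h (r : Fin (N + 2) × Fin (M + 2)) :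
        (tensorEntry R S r (q₁, q₂)).comp (parametrixEntry R P Q (p₁, p₂) r) =
        ((R.d r.1 q₁).comp (P p₁ r.1)).tensor
          ((Adj.one B K r.2 q₂).comp (Adj.one B K p₂ r.2)) +
        (((-1 : ℤ) ^ (p₁ : ℕ) • R.d r.1 q₁).comp (Adj.diag (R.defect P P) p₁ r.1)).tensor
          ((Adj.one B K r.2 q₂).comp (Q p₂ r.2)) +
        (((Adj.one A L r.1 q₁).comp ((-1 : ℤ) ^ (r.1 : ℕ) • P p₁ r.1)).tensor
          ((S.d r.2 q₂).comp (Adj.one B K p₂ r.2)) +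
        ((Adj.one A L r.1 q₁).comp
          ((-1 : ℤ) ^ (r.1 : ℕ) • (-1 : ℤ) ^ (p₁ : ℕ) • Adj.diag (R.defect P P) p₁ r.1)).tensor
          ((S.d r.2 q₂).comp (Q p₂ r.2))) := by
      rw [parametrixEntry, tensorEntry, Adj.add_comp_add, ← Adj.tensor_comp,
        Adj.tensor_comp_zsmul, Adj.zsmul_tensor_comp, Adj.zsmul_tensor_comp_zsmul']
    -- The diagonal entry vanishes unless `p₁ = q₁`, where the two signs cancel.
    have hs : (-1 : ℤ) ^ (q₁ : ℕ) • (-1 : ℤ) ^ (p₁ : ℕ) • Adj.diag (R.defect P P) p₁ q₁ =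
        Adj.diag (R.defect P P) p₁ q₁ := by
      by_cases hpq : p₁ = q₁
      · rw [hpq, smul_smul, ← mul_pow, neg_one_mul, neg_neg, one_pow, one_smul]
      · rw [Adj.diag_of_ne _ hpq, smul_zero, smul_zero]
    rw [Finset.sum_congr rfl fun r _ => h r]
    simp only [Finset.sum_add_distrib]
    rw [Adj.sum_prod_tensor (fun j => (R.d j q₁).comp (P p₁ j))
        (fun i => (Adj.one B K i q₂).comp (Adj.one B K p₂ i)),
      Adj.sum_prod_tensor (fun j : Fin (N + 2) => (Adj.one A L j q₁).comp
        ((-1 : ℤ) ^ (j : ℕ) • P p₁ j))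
        (fun i => (S.d i q₂).comp (Adj.one B K p₂ i)),
      Adj.sum_prod_tensor (fun j => ((-1 : ℤ) ^ (p₁ : ℕ) • R.d j q₁).comp
        (Adj.diag (R.defect P P) p₁ j)) (fun i => (Adj.one B K i q₂).comp (Q p₂ i)),
      Adj.sum_prod_tensor (fun j : Fin (N + 2) => (Adj.one A L j q₁).comp
        ((-1 : ℤ) ^ (j : ℕ) • (-1 : ℤ) ^ (p₁ : ℕ) • Adj.diag (R.defect P P) p₁ j))
        (fun i => (S.d i q₂).comp (Q p₂ i)),
      Adj.sum_one_comp (fun i => Adj.one B K p₂ i),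
      Adj.sum_one_comp (fun j : Fin (N + 2) => (-1 : ℤ) ^ (j : ℕ) • P p₁ j),
      Adj.sum_comp_one (fun i => S.d i q₂),
      Adj.sum_comp_diag _ (fun j => (-1 : ℤ) ^ (p₁ : ℕ) • R.d j q₁),
      Adj.sum_one_comp (fun i => Q p₂ i),
      Adj.sum_one_comp (fun j : Fin (N + 2) => (-1 : ℤ) ^ (j : ℕ) • (-1 : ℤ) ^ (p₁ : ℕ) •
        Adj.diag (R.defect P P) p₁ j), hs, Adj.zsmul_comp, Adj.zsmul_tensor, Adj.zsmul_tensor]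
  -- `P` lowers and `d` raises the first degree by one, so in each mixed pair the signs taken at
  -- `p₁` and `q₁` are opposite.
  have h3 : (-1 : ℤ) ^ (q₁ : ℕ) • (P p₁ q₁).tensor (S.d p₂ q₂) +
      (-1 : ℤ) ^ (p₁ : ℕ) • (P p₁ q₁).tensor (S.d p₂ q₂) = 0 :=
    neg_one_pow_smul_add fun h => by rw [hP _ _ h, Adj.zero_tensor]
  have h4 : (-1 : ℤ) ^ (p₁ : ℕ) • ((R.d p₁ q₁).comp (R.defect P P p₁)).tensor (Q p₂ q₂) +
      (-1 : ℤ) ^ (q₁ : ℕ) • ((R.d p₁ q₁).comp (R.defect P P p₁)).tensor (Q p₂ q₂) = 0 :=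
    neg_one_pow_smul_add fun h => by rw [R.shape _ _ h, Adj.zero_comp, Adj.zero_tensor]
  -- `(P R + R P) ⊗ 1 = (1 - C) ⊗ 1`. The next identity is `C ⊗ (Q S + S Q) = C ⊗ (1 - C')`, and
  -- adding the two cancels `C ⊗ 1`.
  have h5 : (∑ j, (P j q₁).comp (R.d p₁ j)).tensor (Adj.one B K p₂ q₂) +
      (∑ j, (R.d j q₁).comp (P p₁ j)).tensor (Adj.one B K p₂ q₂) =
      (Adj.one A L p₁ q₁).tensor (Adj.one B K p₂ q₂) -
        (Adj.diag (R.defect P P) p₁ q₁).tensor (Adj.one B K p₂ q₂) := by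
    rw [← Adj.add_tensor, ← Finset.sum_add_distrib, ← Adj.sub_tensor, ← hPR, sub_sub_cancel]
  have h6 : (Adj.diag (R.defect P P) p₁ q₁).tensor (∑ i, (Q i q₂).comp (S.d p₂ i)) +
      (Adj.diag (R.defect P P) p₁ q₁).tensor (∑ i, (S.d i q₂).comp (Q p₂ i)) =
      (Adj.diag (R.defect P P) p₁ q₁).tensor (Adj.one B K p₂ q₂) -
        (Adj.diag (R.defect P P) p₁ q₁).tensor (Adj.diag (S.defect Q Q) p₂ q₂) := by
    rw [← Adj.tensor_add, ← Finset.sum_add_distrib, ← Adj.tensor_sub, ← hQS, sub_sub_cancel]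
  rw [Finset.sum_add_distrib, h1, h2]
  change _ = (Adj.one A L p₁ q₁).tensor (Adj.one B K p₂ q₂) -
    (Adj.diag (R.defect P P) p₁ q₁).tensor (Adj.diag (S.defect Q Q) p₂ q₂)
  exact add_four_comm h3 h4 h5 h6

end TensorParametrix

/-! ### From bidegrees to total degrees -/

section TensorParametrix

variable {A B : Type*} [NonUnitalCStarAlgebra A] [PartialOrder A] [StarOrderedRing A]
  [NonUnitalCStarAlgebra B] [PartialOrder B] [StarOrderedRing B]
  {N M : ℕ} {L : Fin (N + 2) → Type*} {K : Fin (M + 2) → Type*}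
  [∀ i, NormedAddCommGroup (L i)] [∀ i, NormedSpace ℂ (L i)] [∀ i, SMul Aᵐᵒᵖ (L i)]
  [∀ i, CStarModule Aᵐᵒᵖ (L i)]
  [∀ i, NormedAddCommGroup (K i)] [∀ i, NormedSpace ℂ (K i)] [∀ i, SMul Bᵐᵒᵖ (K i)]
  [∀ i, CStarModule Bᵐᵒᵖ (K i)]

/-- A sum over all bidegrees is the sum over all total degrees of the sums over the bidegrees of
that total degree. -/
lemma sum_degree {G : Type*} [AddCommMonoid G] (f : Fin (N + 2) × Fin (M + 2) → G) :
    ∑ l : Fin (N + M + 1 + 2), ∑ r : {r : Fin (N + 2) × Fin (M + 2) // (r.1 : ℕ) + r.2 = l}, f r.1 =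
      ∑ r, f r := by
  have h : ∀ l : Fin (N + M + 1 + 2),
      ∑ r : {r : Fin (N + 2) × Fin (M + 2) // (r.1 : ℕ) + r.2 = l}, f r.1 =
        ∑ r, if (r.1 : ℕ) + r.2 = l then f r else 0 := by
    intro l
    rw [← Finset.sum_filter]
    exact (Finset.sum_subtype (Finset.univ.filter fun r : Fin (N + 2) × Fin (M + 2) =>
      (r.1 : ℕ) + r.2 = l) (by simp) f).symm
  rw [Finset.sum_congr rfl fun l _ => h l, Finset.sum_comm]
  refine Finset.sum_congr rfl fun r _ => ?_
  -- The largest total degree `(N + 1) + (M + 1)` is the last index of the tensor complex, so no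
  -- bidegree is lost.
  have hr : (r.1 : ℕ) + r.2 < N + M + 1 + 2 := by omega
  rw [Finset.sum_eq_single ⟨(r.1 : ℕ) + r.2, hr⟩]
  · exact if_pos rfl
  · exact fun l _ hl => if_neg fun h' => hl (Fin.ext h'.symm)
  · simp

lemma one_tensorModule (k : Fin (N + M + 1 + 2))
    (p q : {p : Fin (N + 2) × Fin (M + 2) // (p.1 : ℕ) + p.2 = k}) :
    Adj.one (MinTensor A B) (fun p : {p : Fin (N + 2) × Fin (M + 2) // (p.1 : ℕ) + p.2 = k} =>
      ExtTensor A B (L p.1.1) (K p.1.2)) p q =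
      (Adj.one A L p.1.1 q.1.1).tensor (Adj.one B K p.1.2 q.1.2) := by
  by_cases h : p = q
  · subst h
    rw [Adj.one_self, Adj.one_self, Adj.one_self, Adj.id_tensor_id]
  · rw [Adj.one_of_ne h]
    by_cases h1 : p.1.1 = q.1.1
    · have h2 : p.1.2 ≠ q.1.2 := fun h2 => h (Subtype.ext (Prod.ext h1 h2))
      rw [Adj.one_of_ne h2, Adj.tensor_zero]
    · rw [Adj.one_of_ne h1, Adj.zero_tensor]

namespace HilbComplex

variable (R : HilbComplex A L) (S : HilbComplex B K)

lemma tensorParametrix_eq (P : ∀ i j, Adj A (L i) (L j)) (Q : ∀ i j, Adj B (K i) (K j))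
    (k l : Fin (N + M + 1 + 2)) :
    R.tensorParametrix P Q k l = Adj.matrix fun p q => parametrixEntry R P Q p.1 q.1 := rfl

lemma tensorParametrix_shape {P : ∀ i j, Adj A (L i) (L j)} {Q : ∀ i j, Adj B (K i) (K j)}
    (hP : ∀ i j : Fin (N + 2), (j : ℕ) + 1 ≠ i → P i j = 0)
    (hQ : ∀ i j : Fin (M + 2), (j : ℕ) + 1 ≠ i → Q i j = 0) (k l : Fin (N + M + 1 + 2))
    (h : (l : ℕ) + 1 ≠ k) : R.tensorParametrix P Q k l = 0 := by
  rw [tensorParametrix_eq]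
  refine Adj.matrix_eq_zero fun p q => ?_
  obtain ⟨⟨p₁, p₂⟩, hp⟩ := p
  obtain ⟨⟨q₁, q₂⟩, hq⟩ := q
  simp only at hp hq
  have h1 : (P p₁ q₁).tensor (Adj.one B K p₂ q₂) = 0 := by
    by_cases h2 : p₂ = q₂
    · rw [hP _ _ (by rw [h2] at hp; omega), Adj.zero_tensor]
    · rw [Adj.one_of_ne h2, Adj.tensor_zero]
  have h2 : (Adj.diag (R.defect P P) p₁ q₁).tensor (Q p₂ q₂) = 0 := by
    by_cases h2 : p₁ = q₁
    · rw [hQ _ _ (by rw [h2] at hp; omega), Adj.tensor_zero]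
    · rw [Adj.diag_of_ne _ h2, Adj.zero_tensor]
  rw [parametrixEntry, h1, h2, smul_zero, add_zero]

/-- Summing the matrix products over every intermediate total degree covers each bidegree once
(`sum_degree`), so `sum_parametrixEntry` applies to every entry. -/
lemma defect_tensorParametrix {P : ∀ i j, Adj A (L i) (L j)} {Q : ∀ i j, Adj B (K i) (K j)}
    (hP : ∀ i j : Fin (N + 2), (j : ℕ) + 1 ≠ i → P i j = 0)
    (hQ : ∀ i j : Fin (M + 2), (j : ℕ) + 1 ≠ i → Q i j = 0) (k : Fin (N + M + 1 + 2)) :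
    (R.tensor S).defect (R.tensorParametrix P Q) (R.tensorParametrix P Q) k =
      Adj.matrix fun p q => (Adj.diag (R.defect P P) p.1.1 q.1.1).tensor
        (Adj.diag (S.defect Q Q) p.1.2 q.1.2) := by
  have h : ∀ l, (R.tensorParametrix P Q l k).comp ((R.tensor S).d k l) +
      ((R.tensor S).d l k).comp (R.tensorParametrix P Q k l) =
      Adj.matrix fun p q => ∑ r : {r : Fin (N + 2) × Fin (M + 2) // (r.1 : ℕ) + r.2 = l},
        ((parametrixEntry R P Q r.1 q.1).comp (tensorEntry R S p.1 r.1) +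
        (tensorEntry R S r.1 q.1).comp (parametrixEntry R P Q p.1 r.1)) := by
    intro l
    rw [tensorParametrix_eq, tensorParametrix_eq, tensor, Adj.matrix_comp, Adj.matrix_comp,
      Adj.matrix_add]
    congr 1
    funext p q
    rw [Finset.sum_add_distrib]
  rw [defect, Finset.sum_congr rfl fun l _ => h l, Adj.matrix_sum, ← Adj.matrix_one, Adj.matrix_sub]
  congr 1
  funext p q
  rw [sum_degree fun r => (parametrixEntry R P Q r q.1).comp (tensorEntry R S p.1 r) +
        (tensorEntry R S r q.1).comp (parametrixEntry R P Q p.1 r),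
    sum_parametrixEntry R S hP hQ, one_tensorModule, sub_sub_cancel]

variable {R S}

/-- The remaining defect has entries compact ⊗ compact. The correction `σ C ⊗ Q` is what replaces
the defect `C ⊗ 1` of `P ⊗ 1`, not compact in general, by `C ⊗ C'`. -/
theorem IsParametrix.tensor {P : ∀ i j, Adj A (L i) (L j)} {Q : ∀ i j, Adj B (K i) (K j)}
    (hP : R.IsParametrix P) (hQ : S.IsParametrix Q) :
    (R.tensor S).IsParametrix (R.tensorParametrix P Q) where
  shape_left := R.tensorParametrix_shape hP.shape_left hQ.shape_left
  shape_right := R.tensorParametrix_shape hP.shape_left hQ.shape_left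
  compact k := by
    rw [R.defect_tensorParametrix S hP.shape_left hQ.shape_left]
    exact Adj.IsCompact.matrix fun p q =>
      (isCompact_diag hP.compact _ _).tensor (isCompact_diag hQ.compact _ _)

/-- The tensor formula relies on a defect commuting with the differential, so joint parametrices are
first replaced by parametrices. -/
theorem IsFredholm.tensor (hR : R.IsFredholm) (hS : S.IsFredholm) : (R.tensor S).IsFredholm := by
  obtain ⟨P, hP⟩ := hR.exists_isParametrix
  obtain ⟨Q, hQ⟩ := hS.exists_isParametrix
  exact (hP.tensor hQ).isFredholm

end HilbComplex

end TensorParametrix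

/-! ### Unitary equivalence and the index -/

section Index

variable {A : Type*} [NonUnitalCStarAlgebra A] [PartialOrder A] [StarOrderedRing A]
  {E F G H : Type*}
  [NormedAddCommGroup E] [NormedSpace ℂ E] [SMul Aᵐᵒᵖ E] [CStarModule Aᵐᵒᵖ E]
  [NormedAddCommGroup F] [NormedSpace ℂ F] [SMul Aᵐᵒᵖ F] [CStarModule Aᵐᵒᵖ F]
  [NormedAddCommGroup G] [NormedSpace ℂ G] [SMul Aᵐᵒᵖ G] [CStarModule Aᵐᵒᵖ G]
  [NormedAddCommGroup H] [NormedSpace ℂ H] [SMul Aᵐᵒᵖ H] [CStarModule Aᵐᵒᵖ H]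

lemma Adj.map_uact (T : Adj A E F) (x : E) (c : Unitization ℂ A) :
    T (uact x c) = uact (T x) c := by
  rw [uact, uact, map_add, map_smul, T.map_act]

lemma Adj.IsUnitary.adj_apply_apply {U : Adj A E F} (hU : U.IsUnitary) (x : E) :
    U.adj (U x) = x := congrArg (fun T : Adj A E E => T x) hU.1

lemma Adj.IsUnitary.apply_adj_apply {U : Adj A E F} (hU : U.IsUnitary) (y : F) :
    U (U.adj y) = y := congrArg (fun T : Adj A F F => T y) hU.2

lemma stabilize_unitary (T : Adj A E F) (U : Adj A G E) (V : Adj A H F)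
    {n : ℕ} (x : Fin n → F) (w : G × (Fin n → Unitization ℂ A)) :
    stabilize (V.adj.comp (T.comp U)) (fun i => V.adj (x i)) w =
      V.adj (stabilize T x (U w.1, w.2)) := by
  rw [stabilize, stabilize, map_add, map_sum]
  congr 1
  exact Finset.sum_congr rfl fun i _ => (V.adj.map_uact _ _).symm

/-- Taking the columns `V⋆ x_i` makes the new stabilized map equal to `V⋆ Φ (U ⊕ 1)`. Its kernel is
the image of `ker Φ` under `U⋆ ⊕ 1`, so the same `n` and the same idempotent `p` witness the same
class. -/
lemma HasIndex.of_unitary {T : Adj A E F} {κ : K0 A} (h : HasIndex T κ) {U : Adj A G E}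
    {V : Adj A H F} (hU : U.IsUnitary) (hV : V.IsUnitary) :
    HasIndex (V.adj.comp (T.comp U)) κ := by
  obtain ⟨n, x, hsurj, m, p, hp, φ, hφ, hrange, hker, hκ⟩ := h
  have hV0 : ∀ y, V.adj y = 0 ↔ y = 0 := fun y =>
    ⟨fun h => by rw [← hV.apply_adj_apply y, h, map_zero], fun h => by rw [h, map_zero]⟩
  have hU0 : ∀ y, U.adj y = 0 ↔ y = 0 := fun y =>
    ⟨fun h => by rw [← hU.apply_adj_apply y, h, map_zero], fun h => by rw [h, map_zero]⟩
  refine ⟨n, fun i => V.adj (x i), ?_, m, p, hp,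
    { toFun := fun v => (U.adj (φ v).1, (φ v).2)
      map_zero' := by simp
      map_add' := by simp }, ?_, ?_, ?_, hκ⟩
  · intro z
    obtain ⟨w, hw⟩ := hsurj (V z)
    refine ⟨(U.adj w.1, w.2), ?_⟩
    rw [stabilize_unitary, hU.apply_adj_apply, hw, hV.adj_apply_apply]
  · intro v c
    change (U.adj (φ _).1, (φ _).2) = (uact (U.adj (φ v).1) c, _)
    rw [hφ, ← Adj.map_uact]
    rfl
  · ext w
    rw [Set.mem_ofPred_eq, stabilize_unitary, hV0]
    have : (U w.1, w.2) ∈ Set.range φ ↔ stabilize T x (U w.1, w.2) = 0 := by rw [hrange]; rfl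
    rw [← this]
    constructor
    · rintro ⟨v, rfl⟩
      refine ⟨v, Prod.ext ?_ rfl⟩
      exact (hU.apply_adj_apply _).symm
    · rintro ⟨v, hv⟩
      refine ⟨v, ?_⟩
      change (U.adj (φ v).1, (φ v).2) = w
      rw [hv]
      exact Prod.ext (hU.adj_apply_apply _) rfl
  · intro v
    rw [← hker]
    change (U.adj (φ v).1, (φ v).2) = 0 ↔ _
    rw [Prod.ext_iff, Prod.ext_iff]
    exact and_congr_left fun _ => hU0 _

/-- The Fredholm index is invariant under unitary equivalence. -/
theorem fredholmIndex_unitary (T : Adj A E F) {U : Adj A G E} {V : Adj A H F}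
    (hU : U.IsUnitary) (hV : V.IsUnitary) :
    fredholmIndex (V.adj.comp (T.comp U)) = fredholmIndex T := by
  -- Equality of the predicates themselves forces the choices made from them to agree. The converse
  -- implication conjugates back by `U⋆` and `V⋆`.
  have h : HasIndex (V.adj.comp (T.comp U)) = HasIndex T := by
    funext κ
    refine propext ⟨fun h => ?_, fun h => h.of_unitary hU hV⟩
    have h1 := h.of_unitary hU.adj hV.adj
    have h2 : V.adj.adj.comp ((V.adj.comp (T.comp U)).comp U.adj) = T := by
      have : V.adj.adj.comp ((V.adj.comp (T.comp U)).comp U.adj) =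
        (V.comp V.adj).comp (T.comp (U.comp U.adj)) := rfl
      rw [this, hV.2, hU.2]
      rfl
    rwa [h2] at h1
  unfold fredholmIndex
  rw [h]

end Index

/-! ### Unitaries from families of coordinates -/

namespace Adj

section Families

variable {A : Type*} [NonUnitalCStarAlgebra A] [PartialOrder A] [StarOrderedRing A]
  {ι : Type*} [Fintype ι] {X : ι → Type*}
  [∀ i, NormedAddCommGroup (X i)] [∀ i, NormedSpace ℂ (X i)] [∀ i, SMul Aᵐᵒᵖ (X i)]
  [∀ i, CStarModule Aᵐᵒᵖ (X i)]
  {E F G H : Type*}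
  [NormedAddCommGroup E] [NormedSpace ℂ E] [SMul Aᵐᵒᵖ E] [CStarModule Aᵐᵒᵖ E]
  [NormedAddCommGroup F] [NormedSpace ℂ F] [SMul Aᵐᵒᵖ F] [CStarModule Aᵐᵒᵖ F]
  [NormedAddCommGroup G] [NormedSpace ℂ G] [SMul Aᵐᵒᵖ G] [CStarModule Aᵐᵒᵖ G]
  [NormedAddCommGroup H] [NormedSpace ℂ H] [SMul Aᵐᵒᵖ H] [CStarModule Aᵐᵒᵖ H]

/-- The operator identifying two modules with the same coordinates. -/
def glue (u : ∀ i, Adj A G (X i)) (e : ∀ i, Adj A E (X i)) : Adj A G E :=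
  ∑ i, (e i).adj.comp (u i)

lemma adj_glue (u : ∀ i, Adj A G (X i)) (e : ∀ i, Adj A E (X i)) :
    (glue u e).adj = glue e u := adj_sum _ _

/-- Expanding the two glued maps leaves a double sum in which `D` enters only through its entries
`f_j D e_i⋆`. Replacing these by the entries of `D'`, the sums collapse because `u` and `v` resolve
the identity. -/
lemma glue_comp_comp_glue (u : ∀ i, Adj A G (X i)) (e : ∀ i, Adj A E (X i))
    (v : ∀ i, Adj A H (X i)) (f : ∀ i, Adj A F (X i)) (hu : ∑ i, (u i).adj.comp (u i) = Adj.id A G)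
    (hv : ∑ i, (v i).adj.comp (v i) = Adj.id A H) {D : Adj A E F} {D' : Adj A G H}
    (h : ∀ i j, (f j).comp (D.comp (e i).adj) = (v j).comp (D'.comp (u i).adj)) :
    (glue f v).comp (D.comp (glue u e)) = D' := by
  have key : ∀ j i, ((v j).adj.comp (f j)).comp (D.comp ((e i).adj.comp (u i))) =
      ((v j).adj.comp (v j)).comp (D'.comp ((u i).adj.comp (u i))) := fun j i =>
    calc ((v j).adj.comp (f j)).comp (D.comp ((e i).adj.comp (u i))) =
        (v j).adj.comp (((f j).comp (D.comp (e i).adj)).comp (u i)) := rfl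
      _ = (v j).adj.comp (((v j).comp (D'.comp (u i).adj)).comp (u i)) := by rw [h]
      _ = _ := rfl
  calc (glue f v).comp (D.comp (glue u e)) =
      ∑ j, ∑ i, ((v j).adj.comp (f j)).comp (D.comp ((e i).adj.comp (u i))) := by
        rw [glue, glue, sum_comp]
        refine Finset.sum_congr rfl fun j _ => ?_
        rw [comp_sum, comp_sum]
    _ = ∑ j, ∑ i, ((v j).adj.comp (v j)).comp (D'.comp ((u i).adj.comp (u i))) :=
        Finset.sum_congr rfl fun j _ => Finset.sum_congr rfl fun i _ => key j i
    _ = (∑ j, (v j).adj.comp (v j)).comp (D'.comp (∑ i, (u i).adj.comp (u i))) := by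
        rw [sum_comp]
        refine Finset.sum_congr rfl fun j _ => ?_
        rw [comp_sum, comp_sum]
    _ = D' := by rw [hu, hv]; rfl

/-- Equal Gram matrices say that the identities of `E` and `G` have the same entries, so the
previous lemma with `D` and `D'` the identities applies in both directions. -/
lemma isUnitary_glue {u : ∀ i, Adj A G (X i)} {e : ∀ i, Adj A E (X i)}
    (hu : ∑ i, (u i).adj.comp (u i) = Adj.id A G) (he : ∑ i, (e i).adj.comp (e i) = Adj.id A E)
    (h : ∀ i j, (e j).comp (e i).adj = (u j).comp (u i).adj) : (glue u e).IsUnitary := by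
  constructor
  · rw [adj_glue]
    exact glue_comp_comp_glue u e u e hu hu (D := Adj.id A E) (D' := Adj.id A G) h
  · rw [adj_glue]
    exact glue_comp_comp_glue e u e u he he (D := Adj.id A G) (D' := Adj.id A E)
      fun i j => (h i j).symm

end Families

/-! ### Row operators on a sum of two modules -/

section Row

variable {A : Type*} [NonUnitalCStarAlgebra A] [PartialOrder A] [StarOrderedRing A]
  {E E' F F' G : Type*}
  [NormedAddCommGroup E] [NormedSpace ℂ E] [SMul Aᵐᵒᵖ E] [CStarModule Aᵐᵒᵖ E]
  [NormedAddCommGroup E'] [NormedSpace ℂ E'] [SMul Aᵐᵒᵖ E'] [CStarModule Aᵐᵒᵖ E']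
  [NormedAddCommGroup F] [NormedSpace ℂ F] [SMul Aᵐᵒᵖ F] [CStarModule Aᵐᵒᵖ F]
  [NormedAddCommGroup F'] [NormedSpace ℂ F'] [SMul Aᵐᵒᵖ F'] [CStarModule Aᵐᵒᵖ F']
  [NormedAddCommGroup G] [NormedSpace ℂ G] [SMul Aᵐᵒᵖ G] [CStarModule Aᵐᵒᵖ G]

variable (A E E') in
/-- The first projection. -/
def fst : Adj A (OSum₂ A E E') E where
  toCLM := ContinuousLinearMap.fst ℂ E E' ∘L (WithCStarModule.equivL ℂ).toContinuousLinearMap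
  adjCLM := (WithCStarModule.equivL ℂ).symm.toContinuousLinearMap ∘L ContinuousLinearMap.inl ℂ E E'
  inner_adj x y := by
    change inner Aᵐᵒᵖ x.1 y = inner Aᵐᵒᵖ x.1 y + inner Aᵐᵒᵖ x.2 (0 : E')
    simp

variable (A E E') in
/-- The second projection. -/
def snd : Adj A (OSum₂ A E E') E' where
  toCLM := ContinuousLinearMap.snd ℂ E E' ∘L (WithCStarModule.equivL ℂ).toContinuousLinearMap
  adjCLM := (WithCStarModule.equivL ℂ).symm.toContinuousLinearMap ∘L ContinuousLinearMap.inr ℂ E E'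
  inner_adj x y := by
    change inner Aᵐᵒᵖ x.2 y = inner Aᵐᵒᵖ x.1 (0 : E) + inner Aᵐᵒᵖ x.2 y
    simp

/-- The operator `(x, y) ↦ a x + b y`. -/
def row (a : Adj A E G) (b : Adj A E' G) : Adj A (OSum₂ A E E') G :=
  a.comp (fst A E E') + b.comp (snd A E E')

lemma row_comp_adj (a : Adj A E G) (b : Adj A E' G) (c : Adj A E F) (d : Adj A E' F) :
    (row a b).comp (row c d).adj = a.comp c.adj + b.comp d.adj :=
  Adj.ext fun x => by
    change a (c.adj x + 0) + b (0 + d.adj x) = a (c.adj x) + b (d.adj x)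
    rw [add_zero, zero_add]

lemma row_comp_block (a' : Adj A F G) (b' : Adj A F' G) (a : Adj A E F) (b : Adj A E' F)
    (c : Adj A E F') (d : Adj A E' F') : (row a' b').comp (Adj.block a b c d) =
      row (a'.comp a + b'.comp c) (a'.comp b + b'.comp d) :=
  Adj.ext fun x => by
    change a' (a x.1 + b x.2) + b' (c x.1 + d x.2) =
      (a' (a x.1) + b' (c x.1)) + (a' (b x.2) + b' (d x.2))
    rw [map_add, map_add]
    abel

/-- Since `a_i⋆ b_i = 0`, the cross terms vanish and the resolutions of the identity of the two
summands add up. -/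
lemma sum_adj_row_comp_row {ι : Type*} [Fintype ι] {X : ι → Type*}
    [∀ i, NormedAddCommGroup (X i)] [∀ i, NormedSpace ℂ (X i)] [∀ i, SMul Aᵐᵒᵖ (X i)]
    [∀ i, CStarModule Aᵐᵒᵖ (X i)] (a : ∀ i, Adj A E (X i)) (b : ∀ i, Adj A E' (X i))
    (ha : ∑ i, (a i).adj.comp (a i) = Adj.id A E) (hb : ∑ i, (b i).adj.comp (b i) = Adj.id A E')
    (hab : ∀ i, (a i).adj.comp (b i) = 0) :
    ∑ i, (row (a i) (b i)).adj.comp (row (a i) (b i)) = Adj.id A (OSum₂ A E E') := by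
  have hba : ∀ i, (b i).adj.comp (a i) = 0 := fun i => congrArg Adj.adj (hab i)
  have h : ∀ i, (row (a i) (b i)).adj.comp (row (a i) (b i)) =
      (fst A E E').adj.comp (((a i).adj.comp (a i)).comp (fst A E E')) +
      (snd A E E').adj.comp (((b i).adj.comp (b i)).comp (snd A E E')) := by
    intro i
    have h1 : (row (a i) (b i)).adj.comp (row (a i) (b i)) =
      ((fst A E E').adj.comp (((a i).adj.comp (a i)).comp (fst A E E')) +
      (fst A E E').adj.comp (((a i).adj.comp (b i)).comp (snd A E E'))) +
      ((snd A E E').adj.comp (((b i).adj.comp (a i)).comp (fst A E E')) +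
      (snd A E E').adj.comp (((b i).adj.comp (b i)).comp (snd A E E'))) := by
      rw [row, adj_add, adj_comp, adj_comp, add_comp, comp_add, comp_add]
      rfl
    rw [h1, hab, hba]
    simp only [zero_comp, comp_zero, add_zero, zero_add]
  rw [Finset.sum_congr rfl fun i _ => h i, Finset.sum_add_distrib, ← comp_sum, ← comp_sum,
    ← sum_comp, ← sum_comp, ha, hb]
  refine Adj.ext fun x => ?_
  change (WithCStarModule.equiv Aᵐᵒᵖ (E × E')).symm (x.1 + 0, 0 + x.2) = x
  rw [add_zero, zero_add]
  rfl

end Row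

end Adj

/-! ### The Dirac operator of a tensor product -/

namespace Adj

section Part

variable {A : Type*} [NonUnitalCStarAlgebra A] [PartialOrder A] [StarOrderedRing A]
  {ι : Type*} [Fintype ι] [DecidableEq ι] {L : ι → Type*}
  [∀ i, NormedAddCommGroup (L i)] [∀ i, NormedSpace ℂ (L i)] [∀ i, SMul Aᵐᵒᵖ (L i)]
  [∀ i, CStarModule Aᵐᵒᵖ (L i)] (p : ι → Prop) [DecidablePred p]

variable (A L) in
/-- The `i`-th coordinate on the sum of the summands satisfying `p`; it is zero if `p i` fails. -/
def partProj (i : ι) : Adj A (OSum A fun k : {k // p k} => L k) (L i) :=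
  (proj A L i).comp (subProj A L p).adj

/-- `subProj⋆ subProj` is the diagonal projection onto the summands satisfying `p`. Coordinates can
therefore be indexed by all of `ι`, with zeros outside `p`, avoiding subtypes in later sums. -/
lemma partProj_comp_subProj (i : ι) :
    (partProj A L p i).comp (subProj A L p) = if p i then proj A L i else 0 := by
  have h : (subProj A L p).adj.comp (subProj A L p) =
      Adj.matrix fun j i => if p i then Adj.one A L j i else 0 := by
    rw [subProj, adj_matrix, matrix_comp]
    congr 1
    funext j i
    simp only [one_adj]
    rw [sum_subtype_comp_one (fun k : {k // p k} => Adj.one A L k i)]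
    by_cases hij : j = i
    · subst hij
      split_ifs <;> rfl
    · by_cases h1 : p j <;> by_cases h2 : p i <;> simp [h1, h2, one_of_ne hij]
  rw [partProj, comp_assoc, h]
  refine Adj.ext fun x => ?_
  change Adj.matrix _ x i = _
  rw [matrix_apply]
  split_ifs with hi
  · rw [Finset.sum_eq_single i]
    · rw [one_self]; rfl
    · intro j _ hj
      rw [one_of_ne hj]; rfl
    · simp
  · exact Finset.sum_eq_zero fun j _ => rfl

lemma partProj_comp_adj (i j : ι) :
    (partProj A L p j).comp (partProj A L p i).adj = if p j then Adj.one A L i j else 0 := by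
  have h : (partProj A L p j).comp (partProj A L p i).adj =
      ((partProj A L p j).comp (subProj A L p)).comp (proj A L i).adj := rfl
  rw [h, partProj_comp_subProj]
  split_ifs
  · exact proj_comp_adj i j
  · rfl

lemma partProj_eq_zero {i : ι} (h : ¬p i) : partProj A L p i = 0 := by
  have h1 : partProj A L p i =
      (partProj A L p i).comp ((subProj A L p).comp (subProj A L p).adj) := by
    rw [subProj_comp_adj]; rfl
  rw [h1, ← comp_assoc, partProj_comp_subProj, if_neg h, zero_comp]

lemma sum_adj_partProj_comp : ∑ i, (partProj A L p i).adj.comp (partProj A L p i) = Adj.id A _ := by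
  have h : ∀ i, (partProj A L p i).adj.comp (partProj A L p i) =
      (subProj A L p).comp (((proj A L i).adj.comp (proj A L i)).comp (subProj A L p).adj) :=
    fun i => rfl
  rw [Finset.sum_congr rfl fun i _ => h i, ← comp_sum, ← sum_comp, sum_adj_proj_comp, id_comp,
    subProj_comp_adj]

end Part

end Adj

/-! ### Matrix entries of the even and odd Dirac operators -/

namespace HilbComplex

section Single

variable {A : Type*} [NonUnitalCStarAlgebra A] [PartialOrder A] [StarOrderedRing A]
  {N : ℕ} {L : Fin (N + 2) → Type*}
  [∀ i, NormedAddCommGroup (L i)] [∀ i, NormedSpace ℂ (L i)] [∀ i, SMul Aᵐᵒᵖ (L i)]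
  [∀ i, CStarModule Aᵐᵒᵖ (L i)]

variable (A L) in
/-- The coordinates on the sum of the modules of even degree. -/
def evenProj (i : Fin (N + 2)) : Adj A (EvenPart A L) (L i) :=
  Adj.partProj A L (fun k => Even (k : ℕ)) i

variable (A L) in
/-- The coordinates on the sum of the modules of odd degree. -/
def oddProj (i : Fin (N + 2)) : Adj A (OddPart A L) (L i) :=
  Adj.partProj A L (fun k => Odd (k : ℕ)) i

variable (R : HilbComplex A L)

/-- The matrix entries of `d + d⋆`. -/
def diracEntry (k l : Fin (N + 2)) : Adj A (L k) (L l) := R.d k l + (R.d l k).adj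

/-- Only the parity of `j` needs testing: if `j` and `i` are both odd, the entry `diracEntry i j` is
zero anyway. -/
lemma oddProj_comp_evenDirac (i j : Fin (N + 2)) :
    (oddProj A L j).comp (R.evenDirac.comp (evenProj A L i).adj) =
      if Odd (j : ℕ) then R.diracEntry i j else 0 := by
  have h : (oddProj A L j).comp (R.evenDirac.comp (evenProj A L i).adj) =
      (oddProj A L j).comp ((R.evenDirac.comp (Adj.subProj A L fun k => Even (k : ℕ))).comp
        (Adj.proj A L i).adj) := rfl
  rw [h, ← R.subProj_odd_comp_dirac, Adj.comp_assoc, ← Adj.comp_assoc, oddProj,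
    Adj.partProj_comp_subProj, dirac_eq_matrix]
  split_ifs
  · exact Adj.proj_comp_matrix_comp _ i j
  · exact Adj.zero_comp _

lemma evenProj_comp_oddDirac (i j : Fin (N + 2)) :
    (evenProj A L j).comp (R.oddDirac.comp (oddProj A L i).adj) =
      if Even (j : ℕ) then R.diracEntry i j else 0 := by
  have h : (evenProj A L j).comp (R.oddDirac.comp (oddProj A L i).adj) =
      (evenProj A L j).comp ((R.oddDirac.comp (Adj.subProj A L fun k => Odd (k : ℕ))).comp
        (Adj.proj A L i).adj) := rfl
  rw [h, ← R.subProj_even_comp_dirac, Adj.comp_assoc, ← Adj.comp_assoc, evenProj,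
    Adj.partProj_comp_subProj, dirac_eq_matrix]
  split_ifs
  · exact Adj.proj_comp_matrix_comp _ i j
  · exact Adj.zero_comp _

lemma adj_evenProj_comp_oddProj (i : Fin (N + 2)) :
    (evenProj A L i).adj.comp (oddProj A L i) = 0 := by
  by_cases h : Even (i : ℕ)
  · rw [oddProj, Adj.partProj_eq_zero (fun k : Fin (N + 2) => Odd (k : ℕ))
      (by rwa [Nat.not_odd_iff_even]), Adj.comp_zero]
  · rw [evenProj, Adj.partProj_eq_zero (fun k : Fin (N + 2) => Even (k : ℕ)) h, Adj.adj_zero,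
      Adj.zero_comp]

end Single

/-! ### Coordinates on the tensor complex and on the sharp product -/

section Tensor

variable {A B : Type*} [NonUnitalCStarAlgebra A] [PartialOrder A] [StarOrderedRing A]
  [NonUnitalCStarAlgebra B] [PartialOrder B] [StarOrderedRing B]
  {N M : ℕ} {L : Fin (N + 2) → Type*} {K : Fin (M + 2) → Type*}
  [∀ i, NormedAddCommGroup (L i)] [∀ i, NormedSpace ℂ (L i)] [∀ i, SMul Aᵐᵒᵖ (L i)]
  [∀ i, CStarModule Aᵐᵒᵖ (L i)]
  [∀ i, NormedAddCommGroup (K i)] [∀ i, NormedSpace ℂ (K i)] [∀ i, SMul Bᵐᵒᵖ (K i)]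
  [∀ i, CStarModule Bᵐᵒᵖ (K i)]

/-- The total degree of a bidegree. -/
def totalDegree (r : Fin (N + 2) × Fin (M + 2)) : Fin (N + M + 1 + 2) :=
  ⟨(r.1 : ℕ) + r.2, by omega⟩

variable (A B L K) in
/-- The component `L r.1 ⊗ K r.2` of the module of degree `k` in a tensor product. -/
def bidegreeProj (k : Fin (N + M + 1 + 2))
    (r : {r : Fin (N + 2) × Fin (M + 2) // (r.1 : ℕ) + r.2 = k}) :
    Adj (MinTensor A B) (TensorModule A B L K k) (ExtTensor A B (L r.1.1) (K r.1.2)) :=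
  Adj.proj (MinTensor A B) (fun r : {r : Fin (N + 2) × Fin (M + 2) // (r.1 : ℕ) + r.2 = k} =>
    ExtTensor A B (L r.1.1) (K r.1.2)) r

variable (A B L K) in
/-- The coordinates on the even part of a tensor product. -/
def evenCoord (r : Fin (N + 2) × Fin (M + 2)) :
    Adj (MinTensor A B) (EvenPart (MinTensor A B) (TensorModule A B L K))
      (ExtTensor A B (L r.1) (K r.2)) :=
  (bidegreeProj A B L K (totalDegree r) ⟨r, rfl⟩).comp
    (evenProj (MinTensor A B) (TensorModule A B L K) (totalDegree r))

variable (A B L K) in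
/-- The coordinates on the odd part of a tensor product. -/
def oddCoord (r : Fin (N + 2) × Fin (M + 2)) :
    Adj (MinTensor A B) (OddPart (MinTensor A B) (TensorModule A B L K))
      (ExtTensor A B (L r.1) (K r.2)) :=
  (bidegreeProj A B L K (totalDegree r) ⟨r, rfl⟩).comp
    (oddProj (MinTensor A B) (TensorModule A B L K) (totalDegree r))

lemma bidegreeProj_comp_one (k l : Fin (N + M + 1 + 2))
    (r : {r : Fin (N + 2) × Fin (M + 2) // (r.1 : ℕ) + r.2 = k})
    (s : {r : Fin (N + 2) × Fin (M + 2) // (r.1 : ℕ) + r.2 = l}) :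
    (bidegreeProj A B L K l s).comp
      ((Adj.one (MinTensor A B) (TensorModule A B L K) k l).comp (bidegreeProj A B L K k r).adj) =
    (Adj.one A L r.1.1 s.1.1).tensor (Adj.one B K r.1.2 s.1.2) := by
  by_cases h : k = l
  · subst h
    rw [Adj.one_self, Adj.id_comp, bidegreeProj, bidegreeProj, Adj.proj_comp_adj, one_tensorModule]
  · rw [Adj.one_of_ne h, Adj.zero_comp, Adj.comp_zero]
    by_cases h1 : r.1.1 = s.1.1
    · have h2 : r.1.2 ≠ s.1.2 := fun h2 => h (Fin.ext (by rw [← r.2, ← s.2, h1, h2]))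
      rw [Adj.one_of_ne h2, Adj.tensor_zero]
    · rw [Adj.one_of_ne h1, Adj.zero_tensor]

/-- The Gram matrix of the coordinates; the corresponding lemma for `sharpEvenCoord` has the same
right-hand side, which is what `Adj.isUnitary_glue` compares. -/
lemma evenCoord_comp_adj (r s : Fin (N + 2) × Fin (M + 2)) :
    (evenCoord A B L K s).comp (evenCoord A B L K r).adj =
      if Even ((s.1 : ℕ) + s.2) then (Adj.one A L r.1 s.1).tensor (Adj.one B K r.2 s.2) else 0 := by
  have h : (evenCoord A B L K s).comp (evenCoord A B L K r).adj =
      (bidegreeProj A B L K (totalDegree s) ⟨s, rfl⟩).comp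
      (((evenProj (MinTensor A B) (TensorModule A B L K) (totalDegree s)).comp
        (evenProj (MinTensor A B) (TensorModule A B L K) (totalDegree r)).adj).comp
      (bidegreeProj A B L K (totalDegree r) ⟨r, rfl⟩).adj) := rfl
  rw [h, evenProj, evenProj, Adj.partProj_comp_adj]
  change (bidegreeProj A B L K (totalDegree s) ⟨s, rfl⟩).comp
    ((if Even ((s.1 : ℕ) + s.2) then _ else _ : Adj _ _ _).comp _) = _
  split_ifs
  · exact bidegreeProj_comp_one _ _ _ _
  · rw [Adj.zero_comp, Adj.comp_zero]

lemma oddCoord_comp_adj (r s : Fin (N + 2) × Fin (M + 2)) :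
    (oddCoord A B L K s).comp (oddCoord A B L K r).adj =
      if Odd ((s.1 : ℕ) + s.2) then (Adj.one A L r.1 s.1).tensor (Adj.one B K r.2 s.2) else 0 := by
  have h : (oddCoord A B L K s).comp (oddCoord A B L K r).adj =
      (bidegreeProj A B L K (totalDegree s) ⟨s, rfl⟩).comp
      (((oddProj (MinTensor A B) (TensorModule A B L K) (totalDegree s)).comp
        (oddProj (MinTensor A B) (TensorModule A B L K) (totalDegree r)).adj).comp
      (bidegreeProj A B L K (totalDegree r) ⟨r, rfl⟩).adj) := rfl
  rw [h, oddProj, oddProj, Adj.partProj_comp_adj]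
  change (bidegreeProj A B L K (totalDegree s) ⟨s, rfl⟩).comp
    ((if Odd ((s.1 : ℕ) + s.2) then _ else _ : Adj _ _ _).comp _) = _
  split_ifs
  · exact bidegreeProj_comp_one _ _ _ _
  · rw [Adj.zero_comp, Adj.comp_zero]

lemma sum_adj_coord_comp {E : Type*} [NormedAddCommGroup E] [NormedSpace ℂ E]
    [SMul (MinTensor A B)ᵐᵒᵖ E] [CStarModule (MinTensor A B)ᵐᵒᵖ E]
    (u : ∀ k, Adj (MinTensor A B) E (TensorModule A B L K k))
    (hu : ∑ k, (u k).adj.comp (u k) = Adj.id (MinTensor A B) E) :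
    ∑ r : Fin (N + 2) × Fin (M + 2),
      ((bidegreeProj A B L K (totalDegree r) ⟨r, rfl⟩).comp (u (totalDegree r))).adj.comp
      ((bidegreeProj A B L K (totalDegree r) ⟨r, rfl⟩).comp (u (totalDegree r))) =
      Adj.id (MinTensor A B) E := by
  rw [← sum_degree, ← hu]
  refine Finset.sum_congr rfl fun k _ => ?_
  have h : ∀ r : {r : Fin (N + 2) × Fin (M + 2) // (r.1 : ℕ) + r.2 = k},
      ((bidegreeProj A B L K (totalDegree r.1) ⟨r.1, rfl⟩).comp (u (totalDegree r.1))).adj.comp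
      ((bidegreeProj A B L K (totalDegree r.1) ⟨r.1, rfl⟩).comp (u (totalDegree r.1))) =
      (u k).adj.comp (((bidegreeProj A B L K k r).adj.comp (bidegreeProj A B L K k r)).comp
        (u k)) := by
    rintro ⟨r, hr⟩
    -- Substituting the degree identifies the dependent module types, after which the two sides
    -- agree definitionally.
    obtain rfl : totalDegree r = k := Fin.ext hr
    rfl
  rw [Finset.sum_congr rfl fun r _ => h r, ← Adj.comp_sum, ← Adj.sum_comp]
  simp only [bidegreeProj]
  rw [Adj.sum_adj_proj_comp, Adj.id_comp]

variable (A B L K) in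
/-- The coordinates on `(L_ev ⊗ K_ev) ⊕ (L_odd ⊗ K_odd)`. -/
def sharpEvenCoord (r : Fin (N + 2) × Fin (M + 2)) :
    Adj (MinTensor A B) (OSum₂ (MinTensor A B) (ExtTensor A B (EvenPart A L) (EvenPart B K))
      (ExtTensor A B (OddPart A L) (OddPart B K))) (ExtTensor A B (L r.1) (K r.2)) :=
  Adj.row ((evenProj A L r.1).tensor (evenProj B K r.2))
    ((oddProj A L r.1).tensor (oddProj B K r.2))

variable (A B L K) in
/-- The coordinates on `(L_odd ⊗ K_ev) ⊕ (L_ev ⊗ K_odd)`. -/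
def sharpOddCoord (r : Fin (N + 2) × Fin (M + 2)) :
    Adj (MinTensor A B) (OSum₂ (MinTensor A B) (ExtTensor A B (OddPart A L) (EvenPart B K))
      (ExtTensor A B (EvenPart A L) (OddPart B K))) (ExtTensor A B (L r.1) (K r.2)) :=
  Adj.row ((oddProj A L r.1).tensor (evenProj B K r.2))
    ((evenProj A L r.1).tensor (oddProj B K r.2))

lemma evenProj_comp_adj (i j : Fin (N + 2)) : (evenProj A L j).comp (evenProj A L i).adj =
    if Even (j : ℕ) then Adj.one A L i j else 0 := Adj.partProj_comp_adj _ i j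

lemma oddProj_comp_adj (i j : Fin (N + 2)) : (oddProj A L j).comp (oddProj A L i).adj =
    if Odd (j : ℕ) then Adj.one A L i j else 0 := Adj.partProj_comp_adj _ i j

/-- A total degree is even exactly when both degrees are even or both are odd, and then just one of
the two row components survives. -/
lemma sharpEvenCoord_comp_adj (r s : Fin (N + 2) × Fin (M + 2)) :
    (sharpEvenCoord A B L K s).comp (sharpEvenCoord A B L K r).adj =
      if Even ((s.1 : ℕ) + s.2) then (Adj.one A L r.1 s.1).tensor (Adj.one B K r.2 s.2) else 0 := by
  rw [sharpEvenCoord, sharpEvenCoord, Adj.row_comp_adj, Adj.adj_tensor, Adj.adj_tensor,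
    ← Adj.tensor_comp, ← Adj.tensor_comp, evenProj_comp_adj, evenProj_comp_adj, oddProj_comp_adj,
    oddProj_comp_adj]
  by_cases h1 : Even (s.1 : ℕ) <;> by_cases h2 : Even (s.2 : ℕ) <;>
    simp [-Nat.not_even_iff_odd, ← Nat.not_even_iff_odd, Nat.even_add, h1, h2, Adj.zero_tensor,
      Adj.tensor_zero]

lemma sharpOddCoord_comp_adj (r s : Fin (N + 2) × Fin (M + 2)) :
    (sharpOddCoord A B L K s).comp (sharpOddCoord A B L K r).adj =
      if Odd ((s.1 : ℕ) + s.2) then (Adj.one A L r.1 s.1).tensor (Adj.one B K r.2 s.2) else 0 := by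
  rw [sharpOddCoord, sharpOddCoord, Adj.row_comp_adj, Adj.adj_tensor, Adj.adj_tensor,
    ← Adj.tensor_comp, ← Adj.tensor_comp, evenProj_comp_adj, evenProj_comp_adj, oddProj_comp_adj,
    oddProj_comp_adj]
  by_cases h1 : Even (s.1 : ℕ) <;> by_cases h2 : Even (s.2 : ℕ) <;>
    simp [-Nat.not_even_iff_odd, ← Nat.not_even_iff_odd, Nat.even_add, h1, h2, Adj.zero_tensor,
      Adj.tensor_zero]

lemma sum_adj_sharpEvenCoord_comp :
    ∑ r, (sharpEvenCoord A B L K r).adj.comp (sharpEvenCoord A B L K r) = Adj.id _ _ := by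
  refine Adj.sum_adj_row_comp_row (fun r : Fin (N + 2) × Fin (M + 2) =>
    (evenProj A L r.1).tensor (evenProj B K r.2)) _ ?_ ?_ fun r => ?_
  · simp only [Adj.adj_tensor, ← Adj.tensor_comp]
    rw [Adj.sum_prod_tensor (fun i => (evenProj A L i).adj.comp (evenProj A L i))
      (fun i => (evenProj B K i).adj.comp (evenProj B K i))]
    simp only [evenProj]
    rw [Adj.sum_adj_partProj_comp, Adj.sum_adj_partProj_comp, Adj.id_tensor_id]
  · simp only [Adj.adj_tensor, ← Adj.tensor_comp]
    rw [Adj.sum_prod_tensor (fun i => (oddProj A L i).adj.comp (oddProj A L i))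
      (fun i => (oddProj B K i).adj.comp (oddProj B K i))]
    simp only [oddProj]
    rw [Adj.sum_adj_partProj_comp, Adj.sum_adj_partProj_comp, Adj.id_tensor_id]
  · rw [Adj.adj_tensor, ← Adj.tensor_comp, adj_evenProj_comp_oddProj, Adj.zero_tensor]

lemma sum_adj_sharpOddCoord_comp :
    ∑ r, (sharpOddCoord A B L K r).adj.comp (sharpOddCoord A B L K r) = Adj.id _ _ := by
  refine Adj.sum_adj_row_comp_row (fun r : Fin (N + 2) × Fin (M + 2) =>
    (oddProj A L r.1).tensor (evenProj B K r.2)) _ ?_ ?_ fun r => ?_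
  · simp only [Adj.adj_tensor, ← Adj.tensor_comp]
    rw [Adj.sum_prod_tensor (fun i => (oddProj A L i).adj.comp (oddProj A L i))
      (fun i => (evenProj B K i).adj.comp (evenProj B K i))]
    simp only [evenProj, oddProj]
    rw [Adj.sum_adj_partProj_comp, Adj.sum_adj_partProj_comp, Adj.id_tensor_id]
  · simp only [Adj.adj_tensor, ← Adj.tensor_comp]
    rw [Adj.sum_prod_tensor (fun i => (evenProj A L i).adj.comp (evenProj A L i))
      (fun i => (oddProj B K i).adj.comp (oddProj B K i))]
    simp only [evenProj, oddProj]
    rw [Adj.sum_adj_partProj_comp, Adj.sum_adj_partProj_comp, Adj.id_tensor_id]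
  · rw [Adj.adj_tensor, ← Adj.tensor_comp, adj_evenProj_comp_oddProj, Adj.tensor_zero]

variable (R : HilbComplex A L) (S : HilbComplex B K)

/-- The sign sits on a term that vanishes unless `r.1 = s.1`, so it may be read at the target. The
term and its adjoint counterpart then carry the same sign. -/
lemma tensorEntry_add_adj (r s : Fin (N + 2) × Fin (M + 2)) :
    tensorEntry R S r s + (tensorEntry R S s r).adj =
      (R.diracEntry r.1 s.1).tensor (Adj.one B K r.2 s.2) +
      (-1 : ℤ) ^ (s.1 : ℕ) • (Adj.one A L r.1 s.1).tensor (S.diracEntry r.2 s.2) := by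
  have h : (-1 : ℤ) ^ (r.1 : ℕ) • (Adj.one A L r.1 s.1).tensor (S.d r.2 s.2) =
      (-1 : ℤ) ^ (s.1 : ℕ) • (Adj.one A L r.1 s.1).tensor (S.d r.2 s.2) := by
    by_cases h : r.1 = s.1
    · rw [h]
    · rw [Adj.one_of_ne h, Adj.zero_tensor, smul_zero, smul_zero]
  rw [tensorEntry, tensorEntry, h, Adj.adj_add, Adj.adj_zsmul, Adj.adj_tensor, Adj.adj_tensor,
    Adj.one_adj, Adj.one_adj, diracEntry, diracEntry, Adj.add_tensor, Adj.tensor_add, smul_add]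
  exact add_add_add_comm _ _ _ _

lemma oddCoord_comp_evenDirac (r s : Fin (N + 2) × Fin (M + 2)) :
    (oddCoord A B L K s).comp ((R.tensor S).evenDirac.comp (evenCoord A B L K r).adj) =
      if Odd ((s.1 : ℕ) + s.2) then (R.diracEntry r.1 s.1).tensor (Adj.one B K r.2 s.2) +
      (-1 : ℤ) ^ (s.1 : ℕ) • (Adj.one A L r.1 s.1).tensor (S.diracEntry r.2 s.2) else 0 := by
  have h : (oddCoord A B L K s).comp ((R.tensor S).evenDirac.comp (evenCoord A B L K r).adj) =
      (bidegreeProj A B L K (totalDegree s) ⟨s, rfl⟩).comp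
      (((oddProj (MinTensor A B) (TensorModule A B L K) (totalDegree s)).comp
        ((R.tensor S).evenDirac.comp
        (evenProj (MinTensor A B) (TensorModule A B L K) (totalDegree r)).adj)).comp
      (bidegreeProj A B L K (totalDegree r) ⟨r, rfl⟩).adj) := rfl
  rw [h, oddProj_comp_evenDirac]
  change (bidegreeProj A B L K (totalDegree s) ⟨s, rfl⟩).comp
    ((if Odd ((s.1 : ℕ) + s.2) then _ else _ : Adj _ _ _).comp _) = _
  split_ifs
  · have h1 : (R.tensor S).diracEntry (totalDegree r) (totalDegree s) =
        Adj.matrix fun p q => tensorEntry R S p.1 q.1 + (tensorEntry R S q.1 p.1).adj := by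
      rw [diracEntry, tensor, Adj.adj_matrix, Adj.matrix_add]
    rw [h1, bidegreeProj, bidegreeProj, Adj.proj_comp_matrix_comp, tensorEntry_add_adj]
  · rw [Adj.zero_comp, Adj.comp_zero]

/-- Of the four parities of `s`, only (even, odd) and (odd, even) contribute. In the second the
minus sign of the corner `-1 ⊗ D_S^-` is `(-1)^(s.1)`, and in the first that sign is `+1`. -/
lemma sharpOddCoord_comp_sharp (r s : Fin (N + 2) × Fin (M + 2)) :
    (sharpOddCoord A B L K s).comp
      ((R.evenDirac.sharp S.evenDirac).comp (sharpEvenCoord A B L K r).adj) =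
      if Odd ((s.1 : ℕ) + s.2) then (R.diracEntry r.1 s.1).tensor (Adj.one B K r.2 s.2) +
      (-1 : ℤ) ^ (s.1 : ℕ) • (Adj.one A L r.1 s.1).tensor (S.diracEntry r.2 s.2) else 0 := by
  have h : (sharpOddCoord A B L K s).comp
      ((R.evenDirac.sharp S.evenDirac).comp (sharpEvenCoord A B L K r).adj) =
      ((oddProj A L s.1).comp (R.evenDirac.comp (evenProj A L r.1).adj)).tensor
        ((evenProj B K s.2).comp (evenProj B K r.2).adj) +
      ((evenProj A L s.1).comp (evenProj A L r.1).adj).tensor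
        ((oddProj B K s.2).comp (S.evenDirac.comp (evenProj B K r.2).adj)) +
      (-((oddProj A L s.1).comp (oddProj A L r.1).adj).tensor
        ((evenProj B K s.2).comp (S.oddDirac.comp (oddProj B K r.2).adj)) +
      ((evenProj A L s.1).comp (R.oddDirac.comp (oddProj A L r.1).adj)).tensor
        ((oddProj B K s.2).comp (oddProj B K r.2).adj)) := by
    rw [sharpOddCoord, sharpEvenCoord, Adj.sharp, ← Adj.comp_assoc, Adj.row_comp_block,
      Adj.row_comp_adj, Adj.comp_neg, Adj.add_comp, Adj.add_comp, Adj.neg_comp, adj_evenDirac,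
      adj_evenDirac, Adj.adj_tensor, Adj.adj_tensor]
    simp only [← Adj.tensor_comp]
    rfl
  rw [h, oddProj_comp_evenDirac, oddProj_comp_evenDirac, evenProj_comp_oddDirac,
    evenProj_comp_oddDirac, evenProj_comp_adj, evenProj_comp_adj, oddProj_comp_adj,
    oddProj_comp_adj]
  by_cases h1 : Even (s.1 : ℕ) <;> by_cases h2 : Even (s.2 : ℕ)
  · simp [-Nat.not_even_iff_odd, ← Nat.not_even_iff_odd, Nat.even_add, h1, h2, Adj.zero_tensor,
      Adj.tensor_zero]
  · simp [-Nat.not_even_iff_odd, ← Nat.not_even_iff_odd, Nat.even_add, h1, h2, Adj.tensor_zero,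
      h1.neg_one_pow, add_comm]
  · simp [-Nat.not_even_iff_odd, ← Nat.not_even_iff_odd, Nat.even_add, h1, h2, Adj.tensor_zero,
      (Nat.not_even_iff_odd.1 h1).neg_one_pow]
  · simp [-Nat.not_even_iff_odd, ← Nat.not_even_iff_odd, Nat.even_add, h1, h2, Adj.zero_tensor,
      Adj.tensor_zero]

/-- The even Dirac operator of a tensor product is unitarily equivalent to the sharp product of the
even Dirac operators. -/
theorem exists_unitary_evenDirac_tensor :
    ∃ (U : Adj (MinTensor A B)
          (OSum₂ (MinTensor A B) (ExtTensor A B (EvenPart A L) (EvenPart B K))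
            (ExtTensor A B (OddPart A L) (OddPart B K)))
          (EvenPart (MinTensor A B) (TensorModule A B L K)))
        (V : Adj (MinTensor A B)
          (OSum₂ (MinTensor A B) (ExtTensor A B (OddPart A L) (EvenPart B K))
            (ExtTensor A B (EvenPart A L) (OddPart B K)))
          (OddPart (MinTensor A B) (TensorModule A B L K))),
        U.IsUnitary ∧ V.IsUnitary ∧
        V.adj.comp ((R.tensor S).evenDirac.comp U) = R.evenDirac.sharp S.evenDirac := by
  have he : ∑ r, (evenCoord A B L K r).adj.comp (evenCoord A B L K r) = Adj.id _ _ :=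
    sum_adj_coord_comp _ (Adj.sum_adj_partProj_comp _)
  have ho : ∑ r, (oddCoord A B L K r).adj.comp (oddCoord A B L K r) = Adj.id _ _ :=
    sum_adj_coord_comp _ (Adj.sum_adj_partProj_comp _)
  -- Each unitary matches the coordinates with values in `L j ⊗ K i` on its two sides.
  refine ⟨Adj.glue (sharpEvenCoord A B L K) (evenCoord A B L K),
    Adj.glue (sharpOddCoord A B L K) (oddCoord A B L K),
    Adj.isUnitary_glue sum_adj_sharpEvenCoord_comp he fun r s => ?_,
    Adj.isUnitary_glue sum_adj_sharpOddCoord_comp ho fun r s => ?_, ?_⟩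
  · rw [evenCoord_comp_adj, sharpEvenCoord_comp_adj]
  · rw [oddCoord_comp_adj, sharpOddCoord_comp_adj]
  · rw [Adj.adj_glue]
    refine Adj.glue_comp_comp_glue _ _ _ _ sum_adj_sharpEvenCoord_comp sum_adj_sharpOddCoord_comp
      fun r s => ?_
    rw [oddCoord_comp_evenDirac, sharpOddCoord_comp_sharp]

end Tensor

end HilbComplex

end

end HilbMod

/-! ### Assembly of the three statements -/

theorem mainTheorem11
    {A B : Type*} [NonUnitalCStarAlgebra A] [PartialOrder A] [StarOrderedRing A]
    [NonUnitalCStarAlgebra B] [PartialOrder B] [StarOrderedRing B]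
    {N M : ℕ} {L : Fin (N + 2) → Type*} {K : Fin (M + 2) → Type*}
    [∀ j, NormedAddCommGroup (L j)] [∀ j, NormedSpace ℂ (L j)] [∀ j, SMul Aᵐᵒᵖ (L j)]
    [∀ j, CStarModule Aᵐᵒᵖ (L j)] [∀ j, CompleteSpace (L j)]
    [∀ i, NormedAddCommGroup (K i)] [∀ i, NormedSpace ℂ (K i)] [∀ i, SMul Bᵐᵒᵖ (K i)]
    [∀ i, CStarModule Bᵐᵒᵖ (K i)] [∀ i, CompleteSpace (K i)]
    (R : HilbComplex A L) (S : HilbComplex B K) :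
    (∃ (U : Adj (MinTensor A B)
          (OSum₂ (MinTensor A B) (ExtTensor A B (EvenPart A L) (EvenPart B K))
            (ExtTensor A B (OddPart A L) (OddPart B K)))
          (EvenPart (MinTensor A B) (TensorModule A B L K)))
        (V : Adj (MinTensor A B)
          (OSum₂ (MinTensor A B) (ExtTensor A B (OddPart A L) (EvenPart B K))
            (ExtTensor A B (EvenPart A L) (OddPart B K)))
          (OddPart (MinTensor A B) (TensorModule A B L K))),
        U.IsUnitary ∧ V.IsUnitary ∧
        V.adj.comp ((R.tensor S).evenDirac.comp U) = R.evenDirac.sharp S.evenDirac) ∧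
    (∀ (P : ∀ i j, Adj A (L i) (L j)) (Q : ∀ i j, Adj B (K i) (K j)),
      R.IsParametrix P → S.IsParametrix Q →
        (R.tensor S).IsParametrix (R.tensorParametrix P Q) ∧
        ∀ k, (R.tensor S).defect (R.tensorParametrix P Q) (R.tensorParametrix P Q) k =
          Adj.matrix fun p q => (Adj.diag (R.defect P P) p.1.1 q.1.1).tensor
            (Adj.diag (S.defect Q Q) p.1.2 q.1.2)) ∧
    (R.IsFredholm → S.IsFredholm →
      (R.tensor S).IsFredholm ∧ (R.tensor S).evenDirac.IsFredholm ∧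
      (R.evenDirac.sharp S.evenDirac).IsFredholm ∧
      (R.tensor S).index = fredholmIndex (R.evenDirac.sharp S.evenDirac)) := by
  obtain ⟨U, V, hU, hV, h⟩ := R.exists_unitary_evenDirac_tensor S
  refine ⟨⟨U, V, hU, hV, h⟩, fun P Q hP hQ => ⟨hP.tensor hQ,
    R.defect_tensorParametrix S hP.shape_left hQ.shape_left⟩, fun hR hS => ?_⟩
  have hT := hR.tensor hS
  have hD := hT.evenDirac
  -- Once the sharp product is written as `V⋆ D U`, its Fredholmness and its index are both
  -- transported from the Dirac operator of the tensor complex.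
  rw [← h]
  exact ⟨hT, hD, hD.of_unitary hU hV, (fredholmIndex_unitary _ hU hV).symm⟩
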